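/- Let $0<a\le b$ and $\kappa<0$. There is a constant $C_0=C_0(a,b,\kappa)$, and for every $i_0>0$ there is a constant $C_1=C_1(i_0,a,b,\kappa)$, such that the following holds. Let $M$ be a smooth closed connected surface (for example, an orientable one of genus $G\ge 2$), let $g$ be a $C^2$ Riemannian metric on $M$ with injectivity radius at least $i_0$ and Gaussian curvature contained in $[-b^2,-a^2]$, and let $u\colon M\to\mathbb{R}$ be a $C^2$ function such that the metric $g_1=e^{-2u}g$ has constant Gaussian curvature $\kappa$. Then 1. $\|u\|_{C^0(M)}=\max_M|u|\le C_0$; 2. $\|\nabla u\|_{C^0(M)}\le C_1$, where the gradient and its pointwise norm may be taken with respect to $g$ or with respect to $g_1$: $\max_M\|\nabla_g u\|_g\le C_1$ and $\max_M\|\nabla_{g_1}u\|_{g_1}\le C_1$. -/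

import Mathlib

open scoped Manifold ContDiff NNReal ENNReal

noncomputable section

namespace SurfaceGeometry

/-- The model plane of a surface. -/
abbrev Plane : Type := EuclideanSpace ℝ (Fin 2)

/-! ### Local formulas for a matrix-valued function `G = (g_ij)` on the plane -/

/-- The coordinate vector `e_i` of the plane. -/
def coordVec (i : Fin 2) : Plane := EuclideanSpace.single i 1

/-- The partial derivative `∂_i f (y)`. -/
def partialDeriv (i : Fin 2) (f : Plane → ℝ) (y : Plane) : ℝ := fderiv ℝ f y (coordVec i)

/-- The Christoffel symbol
`Γ^k_ij = ½ ∑_l g^{kl} (∂_i g_jl + ∂_j g_il - ∂_l g_ij)` at `y`. -/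
def christoffel (G : Plane → Matrix (Fin 2) (Fin 2) ℝ) (k i j : Fin 2) (y : Plane) : ℝ :=
  (1 / 2) * ∑ l, (G y)⁻¹ k l *
    (partialDeriv i (fun z => G z j l) y + partialDeriv j (fun z => G z i l) y
      - partialDeriv l (fun z => G z i j) y)

/-- The curvature component `R^l_ijk`, where `R(∂_i, ∂_j) ∂_k = ∑_l R^l_ijk ∂_l` and
`R(X, Y) = ∇_X ∇_Y - ∇_Y ∇_X - ∇_[X, Y]`. -/
def riemannTensor (G : Plane → Matrix (Fin 2) (Fin 2) ℝ) (l i j k : Fin 2) (y : Plane) : ℝ :=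
  partialDeriv i (christoffel G l j k) y - partialDeriv j (christoffel G l i k) y
    + ∑ m, (christoffel G m j k y * christoffel G l i m y
      - christoffel G m i k y * christoffel G l j m y)

/-- The Gaussian curvature `⟨R(∂_0, ∂_1) ∂_1, ∂_0⟩ / det G` at `y`. -/
def localGaussCurvature (G : Plane → Matrix (Fin 2) (Fin 2) ℝ) (y : Plane) : ℝ :=
  (∑ l, riemannTensor G l 0 1 1 y * G y l 0) / (G y).det

/-! ### Riemannian metrics on a surface -/

variable {M : Type*} [TopologicalSpace M] [ChartedSpace Plane M] [IsManifold (𝓡 2) ∞ M]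

variable (M) in
/-- A `C^2` Riemannian metric on the surface `M`. -/
abbrev C2Metric : Type _ :=
  Bundle.ContMDiffRiemannianMetric (𝓡 2) 2 Plane (fun x : M => TangentSpace (𝓡 2) x)

/-- The coefficients `g_ij = g(∂_i, ∂_j)` of the metric in the chart `φ`, as functions of the
coordinates. -/
def metricCoeff (g : C2Metric M) (φ : OpenPartialHomeomorph M Plane) (y : Plane) :
    Matrix (Fin 2) (Fin 2) ℝ :=
  Matrix.of fun i j => g.inner (φ.symm y)
    (mfderiv (𝓡 2) (𝓡 2) φ.symm y (coordVec i)) (mfderiv (𝓡 2) (𝓡 2) φ.symm y (coordVec j))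

/-- The Gaussian curvature of `g` at `p`, computed in the preferred chart at `p`
(its value does not depend on the chart). -/
def gaussCurvature (g : C2Metric M) (p : M) : ℝ :=
  localGaussCurvature (metricCoeff g (chartAt Plane p)) (chartAt Plane p p)

/-- `γ : ℝ → M` is a (complete, affinely parametrized) geodesic of `g`: it is `C^2` and, at every
time `t`, it satisfies the geodesic equation
`(γ^k)'' + ∑_ij Γ^k_ij (γ^i)' (γ^j)' = 0` in the preferred chart at `γ t`. -/
def IsGeodesic (g : C2Metric M) (γ : ℝ → M) : Prop :=
  ContMDiff 𝓘(ℝ) (𝓡 2) 2 γ ∧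
  ∀ (t : ℝ) (k : Fin 2),
    let φ := chartAt Plane (γ t)
    let c : ℝ → Plane := fun s => φ (γ s)
    deriv (deriv c) t k
      + ∑ i, ∑ j, christoffel (metricCoeff g φ) k i j (c t) * deriv c t i * deriv c t j = 0

/-- `γ` is a geodesic of `g` with initial point `p` and initial velocity `v`. -/
def IsGeodesicFrom (g : C2Metric M) (p : M) (v : TangentSpace (𝓡 2) p) (γ : ℝ → M) : Prop :=
  IsGeodesic g γ ∧
  (⟨γ 0, mfderiv 𝓘(ℝ) (𝓡 2) γ 0 (1 : ℝ)⟩ : TangentBundle (𝓡 2) M) = ⟨p, v⟩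

open Classical in
/-- The exponential map `exp_p : T_p M → M` of `g`: `exp_p v = γ 1` for the geodesic `γ` with
`γ 0 = p` and `γ' 0 = v`. (This geodesic exists and is unique if `M` is closed; the value is `p`
if there is none.) The tangent space `T_p M` is by definition a copy of the plane. -/
def expMap (g : C2Metric M) (p : M) (v : Plane) : M :=
  if h : ∃ γ : ℝ → M, IsGeodesicFrom g p v γ then h.choose 1 else p

/-- The open ball of radius `r` around `0` in `(T_p M, g_p)`. -/
def tangentBall (g : C2Metric M) (p : M) (r : ℝ≥0) : Set Plane :=
  {v | Real.sqrt (g.inner p v v) < r}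

/-- The injectivity radius of `g` at `p`: the supremum of those `r` for which `exp_p` is a
diffeomorphism from the open ball of radius `r` in `T_p M` onto its image. (For a `C^2` metric,
`exp_p` is of class `C^1`.) -/
def injectivityRadiusAt (g : C2Metric M) (p : M) : ℝ≥0∞ :=
  ⨆ (r : ℝ≥0) (_ : Set.InjOn (expMap g p) (tangentBall g p r) ∧
    IsLocalDiffeomorphOn (𝓡 2) (𝓡 2) 1 (expMap g p) (tangentBall g p r)), (r : ℝ≥0∞)

/-- The injectivity radius of `(M, g)`. -/
def injectivityRadius (g : C2Metric M) : ℝ≥0∞ := ⨅ p : M, injectivityRadiusAt g p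

/-- The conformal metric `e^{-2u} g`. -/
def conformal (g : C2Metric M) (u : M → ℝ) (hu : ContMDiff (𝓡 2) 𝓘(ℝ) 2 u) : C2Metric M where
  inner x := Real.exp (-2 * u x) • g.inner x
  symm x v w := by
    simp only [smul_apply, g.symm x v w]
  pos x v hv := by
    simp only [smul_apply, smul_eq_mul]
    exact mul_pos (Real.exp_pos _) (g.pos x v hv)
  isVonNBounded x := by
    have h := (g.isVonNBounded x).image
      (Real.exp (u x) • ContinuousLinearMap.id ℝ (TangentSpace (𝓡 2) x))
    refine h.subset ?_
    intro v hv
    refine (Set.mem_image _ _ _).2 ⟨Real.exp (-u x) • v, ?_, ?_⟩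
    · simp only [Set.mem_ofPred_eq, smul_apply, smul_eq_mul] at hv ⊢
      simp only [map_smul, smul_apply, smul_eq_mul]
      rw [← mul_assoc, ← Real.exp_add, show -u x + -u x = -2 * u x by ring]
      exact hv
    · simp [smul_smul, ← Real.exp_add]
  contMDiff := by
    have h : ContMDiff (𝓡 2) 𝓘(ℝ) 2 (fun x => Real.exp (-2 * u x)) :=
      Real.contDiff_exp.contMDiff.comp (contMDiff_const.mul hu)
    exact h.smul_section g.contMDiff

/-- The bilinear form `g_x` on `T_x M`. -/
def bilinAt (g : C2Metric M) (x : M) : LinearMap.BilinForm ℝ (TangentSpace (𝓡 2) x) :=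
  LinearMap.mk₂ ℝ (fun v w => g.inner x v w) (by simp) (by simp) (by simp) (by simp)

theorem bilinAt_nondegenerate (g : C2Metric M) (x : M) : (bilinAt g x).Nondegenerate := by
  constructor
  · intro v hv
    by_contra h
    exact (g.pos x v h).ne' (hv v)
  · intro v hv
    by_contra h
    exact (g.pos x v h).ne' (hv v)

instance (x : M) : FiniteDimensional ℝ (TangentSpace (𝓡 2) x) :=
  inferInstanceAs (FiniteDimensional ℝ Plane)

/-- The gradient of `u` with respect to `g`, i.e. the vector field with `g(∇u, v) = du(v)`. -/
def gradient (g : C2Metric M) (u : M → ℝ) (x : M) : TangentSpace (𝓡 2) x :=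
  ((bilinAt g x).toDual (bilinAt_nondegenerate g x)).symm
    (mfderiv (𝓡 2) 𝓘(ℝ) u x : TangentSpace (𝓡 2) x →L[ℝ] ℝ).toLinearMap

theorem inner_gradient (g : C2Metric M) (u : M → ℝ) (x : M) (v : TangentSpace (𝓡 2) x) :
    g.inner x (gradient g u x) v = mfderiv (𝓡 2) 𝓘(ℝ) u x v :=
  LinearMap.BilinForm.apply_toDual_symm_apply (hB := bilinAt_nondegenerate g x) _ v

/-- The pointwise norm `‖∇u‖_g` of the gradient of `u` with respect to `g`. -/
def gradientNorm (g : C2Metric M) (u : M → ℝ) (x : M) : ℝ :=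
  Real.sqrt (g.inner x (gradient g u x) (gradient g u x))

end SurfaceGeometry

end

/-! Write g₁ = e^{-2u} g. The theorem is a maximum principle followed by an interior gradient
estimate for the prescribed curvature equation Δ_{g₁} u = κ - K_g e^{2u}. At a maximum of u the left
side is ≤ 0, so κ ≤ K_g e^{2u} ≤ -a² e^{2u}; at a minimum the inequalities reverse with b in place
of a (`exp_two_mul_le`, `le_exp_two_mul`). This bounds u by constants in a, b, κ, and hence also the
right side of the equation.

The gradient at p needs coordinates of a fixed size in which the Laplacian is explicit. Since g₁ has
constant curvature κ, there is a local isometry F from the disc of radius 1/2 in the Poincaré model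
to (M, g₁) with F 0 = p (`exists_development`). It need not be injective, because only u ∘ F is
used. With e^{2ρ} the conformal factor of the model, Δ(u ∘ F) = e^{2ρ} (κ - K_g e^{2u}) for the flat
Laplacian (`IsDevAt.flatLaplacian_comp`). The right side is bounded, and comparison with a quadratic
barrier (`partialDeriv_le`, `abs_fderiv_le`) bounds d(u ∘ F) at 0. This is the bound for ∇u in g₁;
passing to g costs a factor controlled by max |u|.

Most of the file constructs F. The 1-jet (f, df) of an isometry solves a total differential equation
whose integrability condition, at isometric jets, is the equality of curvatures
(`jetField_integrable`). The equation is integrated along rays (`exists_radial_solution`), and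
Gronwall's inequality shows that the result stays isometric and solves the full equation
(`isometric_along_ray`, `hasFDerivAt_of_radial_solutions`). Compactness of M makes the radius of
existence uniform (`exists_uniform_extension`), and uniqueness (`IsIsometryNear.eventuallyEq`) glues
the pieces. A C² metric has a C¹ connection and therefore C³ isometries, which is enough to
transport curvature. -/

noncomputable section

namespace SurfaceGeometry

open Filter Topology

/-! ### Levi-Civita connections on open sets of a vector space and their behaviour under isometries.
-/

section LeviCivita

variable {E : Type*} [NormedAddCommGroup E] [NormedSpace ℝ E]

/-- `Γ` is the Levi-Civita connection (in the trivialization of the tangent bundle of a vector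
space) of the `C^2` Riemannian metric `g` on the open set `V`. -/
structure IsLeviCivita (g : E → E →L[ℝ] E →L[ℝ] ℝ) (Γ : E → E →L[ℝ] E →L[ℝ] E) (V : Set E) :
    Prop where
  isOpen : IsOpen V
  contDiffOn_metric : ContDiffOn ℝ 2 g V
  contDiffOn_conn : ContDiffOn ℝ 1 Γ V
  symm : ∀ y ∈ V, ∀ v w, g y v w = g y w v
  pos : ∀ y ∈ V, ∀ v, v ≠ 0 → 0 < g y v v
  torsion_free : ∀ y ∈ V, ∀ v w, Γ y v w = Γ y w v
  compat : ∀ y ∈ V, ∀ u v w, fderiv ℝ g y u v w = g y (Γ y u v) w + g y v (Γ y u w)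

/-- The curvature operator `R(u, v) w` of a connection `Γ`. -/
def curvOp (Γ : E → E →L[ℝ] E →L[ℝ] E) (y u v w : E) : E :=
  fderiv ℝ Γ y u v w - fderiv ℝ Γ y v u w + Γ y u (Γ y v w) - Γ y v (Γ y u w)

/-- The metric `g` with connection `Γ` has constant sectional curvatures `k` at `y`. -/
def HasCurv (g : E → E →L[ℝ] E →L[ℝ] ℝ) (Γ : E → E →L[ℝ] E →L[ℝ] E) (y : E) (k : ℝ) : Prop :=
  ∀ u v w, curvOp Γ y u v w = k • (g y v w • u - g y u w • v)

variable {g gt : E → E →L[ℝ] E →L[ℝ] ℝ} {Γ Γt : E → E →L[ℝ] E →L[ℝ] E} {V U : Set E}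

namespace IsLeviCivita

theorem contDiffAt_metric (h : IsLeviCivita g Γ V) {y : E} (hy : y ∈ V) : ContDiffAt ℝ 2 g y :=
  h.contDiffOn_metric.contDiffAt (h.isOpen.mem_nhds hy)

theorem contDiffAt_conn (h : IsLeviCivita g Γ V) {y : E} (hy : y ∈ V) : ContDiffAt ℝ 1 Γ y :=
  h.contDiffOn_conn.contDiffAt (h.isOpen.mem_nhds hy)

theorem hasFDerivAt_metric (h : IsLeviCivita g Γ V) {y : E} (hy : y ∈ V) :
    HasFDerivAt g (fderiv ℝ g y) y :=
  ((h.contDiffAt_metric hy).differentiableAt (by norm_num)).hasFDerivAt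

theorem hasFDerivAt_conn (h : IsLeviCivita g Γ V) {y : E} (hy : y ∈ V) :
    HasFDerivAt Γ (fderiv ℝ Γ y) y :=
  ((h.contDiffAt_conn hy).differentiableAt (by norm_num)).hasFDerivAt

theorem eq_zero_of_metric (h : IsLeviCivita g Γ V) {y : E} (hy : y ∈ V) {v : E}
    (hv : g y v v = 0) : v = 0 := by
  by_contra hne
  exact (h.pos y hy v hne).ne' hv

set_option maxSynthPendingDepth 3 in
/-- The curvature operator of a Levi-Civita connection is skew-adjoint. -/
theorem curvOp_skew (h : IsLeviCivita g Γ V) {y : E} (hy : y ∈ V) (u v w x : E) :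
    g y (curvOp Γ y u v w) x + g y w (curvOp Γ y u v x) = 0 := by
  have hd : DifferentiableAt ℝ (fderiv ℝ g) y :=
    ((h.contDiffAt_metric hy).fderiv_right (m := 1) (by norm_num)).differentiableAt (by norm_num)
  have hsymm : ∀ a b, fderiv ℝ (fderiv ℝ g) y a b = fderiv ℝ (fderiv ℝ g) y b a := fun a b =>
    ((h.contDiffAt_metric hy).isSymmSndFDerivAt (by simp)) a b
  -- Differentiated metric compatibility. Antisymmetrizing in `a`, `b` kills the second derivative
  -- of `g` and leaves the curvature.
  have key : ∀ a b, fderiv ℝ (fderiv ℝ g) y a b w x =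
      fderiv ℝ g y a (Γ y b w) x + g y (fderiv ℝ Γ y a b w) x
        + fderiv ℝ g y a w (Γ y b x) + g y w (fderiv ℝ Γ y a b x) := by
    intro a b
    have h1 : HasFDerivAt (fun z => fderiv ℝ g z b w x) _ y :=
      ((hd.hasFDerivAt.clm_apply (hasFDerivAt_const b y)).clm_apply
        (hasFDerivAt_const w y)).clm_apply (hasFDerivAt_const x y)
    have hΓ : ∀ c, HasFDerivAt (fun z => Γ z b c) _ y := fun c =>
      ((h.hasFDerivAt_conn hy).clm_apply (hasFDerivAt_const b y)).clm_apply (hasFDerivAt_const c y)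
    have h2 : HasFDerivAt (fun z => g z (Γ z b w) x) _ y :=
      ((h.hasFDerivAt_metric hy).clm_apply (hΓ w)).clm_apply (hasFDerivAt_const x y)
    have h3 : HasFDerivAt (fun z => g z w (Γ z b x)) _ y :=
      ((h.hasFDerivAt_metric hy).clm_apply (hasFDerivAt_const w y)).clm_apply (hΓ x)
    have h4 := h1.unique ((h2.add h3).congr_of_eventuallyEq (by
      filter_upwards [h.isOpen.mem_nhds hy] with z hz using h.compat z hz b w x))
    have h5 := DFunLike.congr_fun h4 a
    simp at h5
    rw [h5]; ring
  have k1 := key u v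
  have k2 := key v u
  rw [hsymm u v, k2] at k1
  simp only [h.compat y hy] at k1
  simp only [curvOp, map_add, map_sub, add_apply, sub_apply]
  linarith

end IsLeviCivita

/-- `f` is an isometry near `z` from the metric `gt` to the metric `g`. -/
def IsIsometryNear (gt g : E → E →L[ℝ] E →L[ℝ] ℝ) (f : E → E) (z : E) : Prop :=
  ∀ᶠ y in 𝓝 z, ∀ v w, g (f y) (fderiv ℝ f y v) (fderiv ℝ f y w) = gt y v w

theorem IsIsometryNear.eventually {f : E → E} {z : E} (h : IsIsometryNear gt g f z) :
    ∀ᶠ y in 𝓝 z, IsIsometryNear gt g f y := eventually_eventually_nhds.2 h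

theorem IsIsometryNear.congr {f f' : E → E} {z : E} (h : IsIsometryNear gt g f z)
    (hf : f' =ᶠ[𝓝 z] f) : IsIsometryNear gt g f' z := by
  filter_upwards [h, hf.eventuallyEq_nhds] with y hy hy' v w
  rw [hy'.fderiv_eq, hy'.eq_of_nhds, hy]

theorem IsIsometryNear.comp {g' : E → E →L[ℝ] E →L[ℝ] ℝ} {f f' : E → E} {z : E}
    (h' : IsIsometryNear g g' f' (f z)) (h : IsIsometryNear gt g f z)
    (hf' : ∀ᶠ y in 𝓝 (f z), DifferentiableAt ℝ f' y) (hf : ∀ᶠ y in 𝓝 z, DifferentiableAt ℝ f y) :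
    IsIsometryNear gt g' (f' ∘ f) z := by
  have hc := hf.self_of_nhds.continuousAt
  filter_upwards [h, hf, hc.eventually h', hc.eventually hf'] with y h1 h2 h3 h4 v w
  rw [fderiv_comp y h4 h2]
  simp [h3, h1]

/-- Definiteness of `gt` gives injectivity, equality of dimensions the rest. -/
theorem fderiv_bijective_of_isometry [FiniteDimensional ℝ E] (ht : IsLeviCivita gt Γt U)
    {f : E → E} {z : E} (hz : z ∈ U)
    (hiso : ∀ v w, g (f z) (fderiv ℝ f z v) (fderiv ℝ f z w) = gt z v w) :
    Function.Bijective (fderiv ℝ f z) := by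
  have hinj : Function.Injective (fderiv ℝ f z) := by
    rw [injective_iff_map_eq_zero]
    intro v hv
    refine ht.eq_zero_of_metric hz ?_
    rw [← hiso, hv]; simp
  exact ⟨hinj, (LinearMap.injective_iff_surjective (f := (fderiv ℝ f z).toLinearMap)).1 hinj⟩

/-- The transformation law of the Christoffel symbols under an isometry. -/
theorem sndFDeriv_of_isometry [FiniteDimensional ℝ E] (h : IsLeviCivita g Γ V)
    (ht : IsLeviCivita gt Γt U) {f : E → E} {z : E} (hz : z ∈ U) (hfz : f z ∈ V)
    (hf : ContDiffAt ℝ 2 f z) (hiso : IsIsometryNear gt g f z) (u v : E) :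
    fderiv ℝ (fderiv ℝ f) z u v = fderiv ℝ f z (Γt z u v)
      - Γ (f z) (fderiv ℝ f z u) (fderiv ℝ f z v) := by
  set D := fderiv ℝ f z with hD
  set H := fderiv ℝ (fderiv ℝ f) z with hH
  have hDf : HasFDerivAt f D z := (hf.differentiableAt (by norm_num)).hasFDerivAt
  have hHf : HasFDerivAt (fderiv ℝ f) H z :=
    ((hf.fderiv_right (m := 1) (by norm_num)).differentiableAt (by norm_num)).hasFDerivAt
  have hHs : ∀ a b, H a b = H b a := fun a b => (hf.isSymmSndFDerivAt (by simp)) a b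
  -- The derivative of the isometry relation in direction `a`, after both metric derivatives are
  -- expressed by the connections.
  have key : ∀ a b c, g (f z) (H a b + Γ (f z) (D a) (D b) - D (Γt z a b)) (D c)
      + g (f z) (D b) (H a c + Γ (f z) (D a) (D c) - D (Γt z a c)) = 0 := by
    intro a b c
    have e : ∀ b, HasFDerivAt (fun y => fderiv ℝ f y b) _ z := fun b =>
      hHf.clm_apply (hasFDerivAt_const b z)
    have h1 : HasFDerivAt (fun y => g (f y) (fderiv ℝ f y b) (fderiv ℝ f y c)) _ z :=
      (((h.hasFDerivAt_metric hfz).comp z hDf).clm_apply (e b)).clm_apply (e c)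
    have h2 : HasFDerivAt (fun y => gt y b c) _ z :=
      ((ht.hasFDerivAt_metric hz).clm_apply (hasFDerivAt_const b z)).clm_apply
        (hasFDerivAt_const c z)
    have h3 := h1.unique (h2.congr_of_eventuallyEq (by
      filter_upwards [hiso] with y hy using hy b c))
    have h4 := DFunLike.congr_fun h3 a
    simp at h4
    have hi := hiso.self_of_nhds
    rw [← hD, h.compat _ hfz, ht.compat _ hz, ← hi, ← hi] at h4
    simp only [map_add, map_sub, add_apply, sub_apply]
    linarith
  set S : E → E → E := fun a b => H a b + Γ (f z) (D a) (D b) - D (Γt z a b) with hS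
  have hSs : ∀ a b, S a b = S b a := fun a b => by
    simp only [hS, hHs a b, h.torsion_free _ hfz (D a), ht.torsion_free _ hz a]
  -- A trilinear expression symmetric in its first two arguments and skew in the last two vanishes:
  -- three alternations return it with the opposite sign.
  have hT : ∀ a b c, g (f z) (S a b) (D c) = 0 := by
    intro a b c
    have sk : ∀ a b c, g (f z) (S a b) (D c) = - g (f z) (S a c) (D b) := fun a b c => by
      have := key a b c
      rw [h.symm _ hfz (D b)] at this
      simp only [hS]; linarith
    have e1 := sk a b c
    have e2 := sk c a b
    have e3 := sk b c a
    rw [hSs a c] at e1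
    rw [hSs c b] at e2
    rw [hSs b a] at e3
    linarith
  obtain ⟨c, hc⟩ := (fderiv_bijective_of_isometry ht hz hiso.self_of_nhds).2 (S u v)
  have h0 := hT u v c
  rw [hD, hc] at h0
  have := h.eq_zero_of_metric hfz h0
  simp only [hS] at this
  have h5 := sub_eq_zero.1 this
  exact eq_sub_of_add_eq h5

/-- The transformation law of the curvature operator under an isometry. -/
theorem curvOp_of_isometry [FiniteDimensional ℝ E] (h : IsLeviCivita g Γ V)
    (ht : IsLeviCivita gt Γt U) {f : E → E} {z : E} (hz : z ∈ U) (hfz : f z ∈ V)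
    (hf : ContDiffAt ℝ 3 f z) (hiso : IsIsometryNear gt g f z) (u v w : E) :
    fderiv ℝ f z (curvOp Γt z u v w)
      = curvOp Γ (f z) (fderiv ℝ f z u) (fderiv ℝ f z v) (fderiv ℝ f z w) := by
  have hf2 : ContDiffAt ℝ 2 f z := hf.of_le (by norm_num)
  have hlaw : ∀ᶠ y in 𝓝 z, ∀ v w, fderiv ℝ (fderiv ℝ f) y v w = fderiv ℝ f y (Γt y v w)
      - Γ (f y) (fderiv ℝ f y v) (fderiv ℝ f y w) := by
    filter_upwards [ht.isOpen.mem_nhds hz, hf.continuousAt.preimage_mem_nhds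
      (h.isOpen.mem_nhds hfz), hf2.eventually (by simp), hiso.eventually] with y h1 h2 h3 h4
    exact sndFDeriv_of_isometry h ht h1 h2 h3 h4
  have hDf : HasFDerivAt f (fderiv ℝ f z) z := (hf.differentiableAt (by norm_num)).hasFDerivAt
  have hf' : ContDiffAt ℝ 2 (fderiv ℝ f) z := hf.fderiv_right (by norm_num)
  have hHf : HasFDerivAt (fderiv ℝ f) (fderiv ℝ (fderiv ℝ f) z) z :=
    (hf'.differentiableAt (by norm_num)).hasFDerivAt
  have hTf : HasFDerivAt (fderiv ℝ (fderiv ℝ f)) (fderiv ℝ (fderiv ℝ (fderiv ℝ f)) z) z :=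
    ((hf'.fderiv_right (m := 1) (by norm_num)).differentiableAt (by norm_num)).hasFDerivAt
  have hTs : ∀ a b, fderiv ℝ (fderiv ℝ (fderiv ℝ f)) z a b
      = fderiv ℝ (fderiv ℝ (fderiv ℝ f)) z b a := fun a b =>
    (hf'.isSymmSndFDerivAt (by simp)) a b
  set D := fderiv ℝ f z with hD
  set H := fderiv ℝ (fderiv ℝ f) z with hH
  set T := fderiv ℝ (fderiv ℝ (fderiv ℝ f)) z with hT
  -- The derivative of the transformation law `hlaw`; symmetry of the third derivative `T` in `a`,
  -- `b` then yields the law for the curvature.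
  have key : ∀ a b, T a b w = H a (Γt z b w) + D (fderiv ℝ Γt z a b w)
      - (fderiv ℝ Γ (f z) (D a) (D b) (D w) + Γ (f z) (H a b) (D w) + Γ (f z) (D b) (H a w)) := by
    intro a b
    have e : ∀ b, HasFDerivAt (fun y => fderiv ℝ f y b) _ z := fun b =>
      hHf.clm_apply (hasFDerivAt_const b z)
    have h1 : HasFDerivAt (fun y => fderiv ℝ (fderiv ℝ f) y b w) _ z :=
      (hTf.clm_apply (hasFDerivAt_const b z)).clm_apply (hasFDerivAt_const w z)
    have h2 : HasFDerivAt (fun y => Γt y b w) _ z :=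
      ((ht.hasFDerivAt_conn hz).clm_apply (hasFDerivAt_const b z)).clm_apply
        (hasFDerivAt_const w z)
    have h3 : HasFDerivAt (fun y => fderiv ℝ f y (Γt y b w)) _ z := hHf.clm_apply h2
    have h4 : HasFDerivAt (fun y => Γ (f y) (fderiv ℝ f y b) (fderiv ℝ f y w)) _ z :=
      (((h.hasFDerivAt_conn hfz).comp z hDf).clm_apply (e b)).clm_apply (e w)
    have h5 := h1.unique ((h3.sub h4).congr_of_eventuallyEq (by
      filter_upwards [hlaw] with y hy using hy b w))
    have h6 := DFunLike.congr_fun h5 a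
    simp at h6
    rw [h6]
    abel
  have hlz := hlaw.self_of_nhds
  have hk : T u v w = T v u w := by rw [hTs u v]
  rw [key, key] at hk
  simp only [← hH, ← hD] at hlz
  simp only [hlz, map_sub, sub_apply] at hk
  rw [h.torsion_free _ hfz (D v) (D u), ht.torsion_free _ hz v u] at hk
  simp only [curvOp, map_add, map_sub]
  rw [← sub_eq_zero] at hk ⊢
  rw [← hk]
  abel

/-- The constant curvature form is natural under isometries, and the injective differential can be
cancelled. This moves curvature between charts and onto the disc. -/
theorem HasCurv.of_isometry [FiniteDimensional ℝ E] (h : IsLeviCivita g Γ V)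
    (ht : IsLeviCivita gt Γt U) {f : E → E} {z : E} (hz : z ∈ U) (hfz : f z ∈ V)
    (hf : ContDiffAt ℝ 3 f z) (hiso : IsIsometryNear gt g f z) {k : ℝ}
    (hk : HasCurv g Γ (f z) k) : HasCurv gt Γt z k := by
  intro u v w
  apply (fderiv_bijective_of_isometry ht hz hiso.self_of_nhds).1
  rw [curvOp_of_isometry h ht hz hfz hf hiso, hk]
  simp [hiso.self_of_nhds v w, hiso.self_of_nhds u w]

end LeviCivita

/-! ### The curvature operator in dimension two. -/

theorem curvOp_add_smul (Γ : Plane → Plane →L[ℝ] Plane →L[ℝ] Plane) (y w : Plane) (a b c d : ℝ)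
    (e f : Plane) : curvOp Γ y (a • e + b • f) (c • e + d • f) w = (a * d - b * c) • curvOp Γ y e f w := by
  simp only [curvOp, map_add, map_smul, add_apply, smul_apply]
  module

theorem plane_eq (v : Plane) : v = v 0 • coordVec 0 + v 1 • coordVec 1 := by
  ext i; fin_cases i <;> simp [coordVec]

/-- On a surface, one component of the curvature tensor determines the curvature operator. -/
theorem hasCurv_of_component {g : Plane → Plane →L[ℝ] Plane →L[ℝ] ℝ}
    {Γ : Plane → Plane →L[ℝ] Plane →L[ℝ] Plane} {V : Set Plane} (h : IsLeviCivita g Γ V)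
    {y : Plane} (hy : y ∈ V) {k : ℝ}
    (hk : g y (curvOp Γ y (coordVec 0) (coordVec 1) (coordVec 1)) (coordVec 0) =
      k * (g y (coordVec 0) (coordVec 0) * g y (coordVec 1) (coordVec 1)
        - g y (coordVec 0) (coordVec 1) ^ 2)) : HasCurv g Γ y k := by
  set e := coordVec 0
  set f := coordVec 1
  have hs : ∀ w x, g y (curvOp Γ y e f w) x + g y w (curvOp Γ y e f x) = 0 :=
    h.curvOp_skew hy e f
  have hlin : ∀ a b : ℝ, curvOp Γ y e f (a • e + b • f) =
      a • curvOp Γ y e f e + b • curvOp Γ y e f f := by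
    intro a b
    simp only [curvOp, map_add, map_smul]
    module
  have main : ∀ w, curvOp Γ y e f w = k • (g y f w • e - g y e w • f) := by
    intro w
    rw [← sub_eq_zero]
    refine h.eq_zero_of_metric hy ?_
    have hee := hs e e
    have hff := hs f f
    have hef := hs e f
    have s1 := h.symm y hy e f
    have s2 := h.symm y hy e (curvOp Γ y e f e)
    have s3 := h.symm y hy f (curvOp Γ y e f f)
    have s4 := h.symm y hy e (curvOp Γ y e f f)
    have gz : ∀ x, g y (curvOp Γ y e f w - k • (g y f w • e - g y e w • f)) x = 0 := by
      intro x
      obtain ⟨a, b, rfl⟩ : ∃ a b : ℝ, w = a • e + b • f := ⟨_, _, plane_eq w⟩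
      obtain ⟨c, d, rfl⟩ : ∃ a b : ℝ, x = a • e + b • f := ⟨_, _, plane_eq x⟩
      simp only [hlin, map_add, map_sub, map_smul, add_apply, sub_apply, smul_apply, smul_eq_mul]
      -- Skewness leaves a single independent entry of the 2 × 2 array ⟨R(e, f) ·, ·⟩, and that
      -- entry is `hk`.
      have a1 : g y (curvOp Γ y e f e) e = 0 := by linarith
      have a2 : g y (curvOp Γ y e f f) f = 0 := by linarith
      have a3 : g y (curvOp Γ y e f e) f = - g y (curvOp Γ y e f f) e := by linarith
      rw [a1, a2, a3, hk, ← s1]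
      ring
    exact gz _
  intro u v w
  rw [plane_eq u, plane_eq v, curvOp_add_smul, main]
  simp only [map_add, map_smul, add_apply, smul_apply, smul_eq_mul]
  module

set_option maxSynthPendingDepth 3

open scoped InnerProductSpace

/-! ### Conformally flat metrics and the Poincaré disc. -/

theorem inner_coordVec (i j : Fin 2) : ⟪coordVec i, coordVec j⟫_ℝ = if i = j then 1 else 0 := by
  simp only [coordVec, EuclideanSpace.inner_single_left, PiLp.single_apply]
  simp

@[simp]
theorem norm_coordVec (i : Fin 2) : ‖coordVec i‖ = 1 := by simp [coordVec]

/-- The vector of the plane representing a linear form. -/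
def dualVec (φ : Plane →L[ℝ] ℝ) : Plane := φ (coordVec 0) • coordVec 0 + φ (coordVec 1) • coordVec 1

theorem inner_dualVec (φ : Plane →L[ℝ] ℝ) (w : Plane) : ⟪dualVec φ, w⟫_ℝ = φ w := by
  have h := plane_eq w
  rw [h]
  simp only [dualVec, inner_add_left, inner_add_right, inner_smul_left, inner_smul_right,
    inner_coordVec, map_add, map_smul]
  simp

/-- The Laplacian of a function on the plane. -/
def flatLaplacian (ρ : Plane → ℝ) (z : Plane) : ℝ :=
  fderiv ℝ (fderiv ℝ ρ) z (coordVec 0) (coordVec 0)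
    + fderiv ℝ (fderiv ℝ ρ) z (coordVec 1) (coordVec 1)

/-- The Euclidean metric of the plane. -/
def flatForm : Plane →L[ℝ] Plane →L[ℝ] ℝ := innerSL ℝ

theorem flatForm_apply (v w : Plane) : flatForm v w = ⟪v, w⟫_ℝ := rfl

/-- The conformally flat metric `e^{2ρ} ⟨·, ·⟩`. -/
def confForm (ρ : Plane → ℝ) (z : Plane) : Plane →L[ℝ] Plane →L[ℝ] ℝ :=
  Real.exp (2 * ρ z) • flatForm

theorem confForm_apply (ρ : Plane → ℝ) (z v w : Plane) :
    confForm ρ z v w = Real.exp (2 * ρ z) * ⟪v, w⟫_ℝ := rfl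

/-- The Levi-Civita connection of `e^{2ρ} ⟨·, ·⟩`. -/
def confConn (ρ : Plane → ℝ) (z : Plane) : Plane →L[ℝ] Plane →L[ℝ] Plane :=
  (fderiv ℝ ρ z).smulRight (ContinuousLinearMap.id ℝ Plane)
    + ContinuousLinearMap.smulRightL ℝ Plane Plane (fderiv ℝ ρ z)
    - (ContinuousLinearMap.smulRightL ℝ Plane Plane).flip (dualVec (fderiv ℝ ρ z)) ∘L flatForm

theorem confConn_apply (ρ : Plane → ℝ) (z u v : Plane) :
    confConn ρ z u v = fderiv ℝ ρ z u • v + fderiv ℝ ρ z v • u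
      - ⟪u, v⟫_ℝ • dualVec (fderiv ℝ ρ z) := rfl

theorem isLeviCivita_conf {ρ : Plane → ℝ} {U : Set Plane} (hU : IsOpen U)
    (hρ : ContDiffOn ℝ 2 ρ U) : IsLeviCivita (confForm ρ) (confConn ρ) U := by
  have hρ' : ContDiffOn ℝ 1 (fderiv ℝ ρ) U := hρ.fderiv_of_isOpen hU (by norm_num)
  have hap : ∀ v, ContDiffOn ℝ 1 (fun z => fderiv ℝ ρ z v) U := fun v =>
    hρ'.clm_apply contDiffOn_const
  refine ⟨hU, ?_, ?_, ?_, ?_, ?_, ?_⟩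
  · exact ((contDiffOn_const.mul hρ).exp).smul contDiffOn_const
  · rw [contDiffOn_clm_apply]; intro u
    rw [contDiffOn_clm_apply]; intro v
    simp only [confConn_apply, dualVec]
    have e : ∀ u c, ContDiffOn ℝ 1 (fun z => fderiv ℝ ρ z u • (c : Plane)) U := fun u c =>
      (hap u).smul contDiffOn_const
    exact ((e u v).add (e v u)).sub (((e _ _).add (e _ _)).const_smul ⟪u, v⟫_ℝ)
  · intro y _ v w
    simp only [confForm_apply, real_inner_comm]
  · intro y _ v hv
    rw [confForm_apply]
    exact mul_pos (Real.exp_pos _) (real_inner_self_pos.2 hv)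
  · intro y _ v w
    simp only [confConn_apply, real_inner_comm v w]
    abel
  · intro y hy u v w
    have hd : HasFDerivAt ρ (fderiv ℝ ρ y) y :=
      ((hρ.contDiffAt (hU.mem_nhds hy)).differentiableAt (by norm_num)).hasFDerivAt
    have h1 : HasFDerivAt (confForm ρ) _ y :=
      ((hd.const_mul 2).exp).smul_const flatForm
    rw [h1.fderiv]
    simp only [ContinuousLinearMap.smulRight_apply, smul_apply, confForm_apply,
      confConn_apply, flatForm_apply, inner_add_left, inner_sub_left, inner_add_right,
      inner_sub_right, inner_smul_left, inner_smul_right, inner_dualVec, smul_eq_mul,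
      RCLike.conj_to_real]
    rw [real_inner_comm (dualVec _) v, inner_dualVec, real_inner_comm u v]
    ring

/-- The classical formula K = -e^{-2ρ} Δρ. The pairing here is Euclidean, and so the left side is K
e^{2ρ}. -/
theorem curvOp_conf {ρ : Plane → ℝ} {z : Plane} (hρ : ContDiffAt ℝ 2 ρ z) :
    ⟪curvOp (confConn ρ) z (coordVec 0) (coordVec 1) (coordVec 1), coordVec 0⟫_ℝ
      = - flatLaplacian ρ z := by
  have hd : HasFDerivAt (fderiv ℝ ρ) (fderiv ℝ (fderiv ℝ ρ) z) z :=
    ((hρ.fderiv_right (m := 1) (by norm_num)).differentiableAt (by norm_num)).hasFDerivAt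
  have hc : DifferentiableAt ℝ (confConn ρ) z := by
    obtain ⟨U, hU, hU'⟩ := hρ.contDiffOn (m := 2) le_rfl (by simp)
    obtain ⟨W, hWU, hW, hzW⟩ := mem_nhds_iff.1 (by simpa using hU)
    exact ((isLeviCivita_conf hW (hU'.mono hWU)).hasFDerivAt_conn hzW).differentiableAt
  have hΓ : ∀ a b c, fderiv ℝ (confConn ρ) z a b c = fderiv ℝ (fderiv ℝ ρ) z a b • c
      + fderiv ℝ (fderiv ℝ ρ) z a c • b - ⟪b, c⟫_ℝ • dualVec (fderiv ℝ (fderiv ℝ ρ) z a) := by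
    intro a b c
    have h1 := (hc.hasFDerivAt.clm_apply (hasFDerivAt_const b z)).clm_apply (hasFDerivAt_const c z)
    have e : ∀ b, HasFDerivAt (fun y => fderiv ℝ ρ y b) _ z := fun b =>
      hd.clm_apply (hasFDerivAt_const b z)
    have h2 := (((e b).smul_const c).add ((e c).smul_const b)).sub
      ((((e (coordVec 0)).smul_const (coordVec 0)).add
        ((e (coordVec 1)).smul_const (coordVec 1))).const_smul ⟪b, c⟫_ℝ)
    have h3 := DFunLike.congr_fun (h1.unique h2) a
    simp at h3
    rw [h3]
    simp [dualVec]
  simp only [curvOp, hΓ, confConn_apply, inner_coordVec, flatLaplacian]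
  simp [inner_add_left, inner_sub_left, inner_smul_left, inner_coordVec,
    inner_add_right, inner_sub_right, inner_smul_right, dualVec]
  ring

theorem HasCurv.flatLaplacian_eq {ρ : Plane → ℝ} {z : Plane} {k : ℝ} (hρ : ContDiffAt ℝ 2 ρ z)
    (h : HasCurv (confForm ρ) (confConn ρ) z k) :
    flatLaplacian ρ z = - k * Real.exp (2 * ρ z) := by
  have h1 := curvOp_conf hρ
  rw [h] at h1
  simp [confForm_apply, inner_smul_left, inner_coordVec] at h1
  linarith

theorem hasCurv_conf {ρ : Plane → ℝ} {U : Set Plane} (hU : IsOpen U) (hρ : ContDiffOn ℝ 2 ρ U)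
    {z : Plane} (hz : z ∈ U) {k : ℝ} (h : flatLaplacian ρ z = - k * Real.exp (2 * ρ z)) :
    HasCurv (confForm ρ) (confConn ρ) z k := by
  refine hasCurv_of_component (isLeviCivita_conf hU hρ) hz ?_
  rw [confForm_apply, curvOp_conf (hρ.contDiffAt (hU.mem_nhds hz)), h]
  simp [confForm_apply, inner_coordVec]
  ring

/-- The conformal exponent of the Poincaré metric of curvature `κ` on the unit disc. -/
def discExp (κ : ℝ) (z : Plane) : ℝ := Real.log (4 / -κ) / 2 - Real.log (1 - ‖z‖ ^ 2)

theorem exp_two_discExp {κ : ℝ} (hκ : κ < 0) {z : Plane} (hz : z ∈ Metric.ball (0 : Plane) 1) :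
    Real.exp (2 * discExp κ z) = 4 / -κ / (1 - ‖z‖ ^ 2) ^ 2 := by
  have hz1 : ‖z‖ < 1 := by simpa using hz
  have h1 : 0 < 1 - ‖z‖ ^ 2 := by nlinarith [norm_nonneg z]
  rw [discExp, show 2 * (Real.log (4 / -κ) / 2 - Real.log (1 - ‖z‖ ^ 2))
    = Real.log (4 / -κ) - 2 * Real.log (1 - ‖z‖ ^ 2) by ring, Real.exp_sub,
    Real.exp_log (div_pos (by norm_num) (by linarith)), two_mul, Real.exp_add, Real.exp_log h1, ← sq]

theorem contDiffOn_discExp (κ : ℝ) (n : WithTop ℕ∞) :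
    ContDiffOn ℝ n (discExp κ) (Metric.ball 0 1) := by
  refine contDiffOn_const.sub (ContDiffOn.log (contDiffOn_const.sub
    (contDiff_norm_sq ℝ).contDiffOn) ?_)
  intro z hz
  have hz1 : ‖z‖ < 1 := by simpa using hz
  nlinarith [norm_nonneg z]

theorem flatLaplacian_discExp {κ : ℝ} (hκ : κ < 0) {z : Plane} (hz : z ∈ Metric.ball (0 : Plane) 1) :
    flatLaplacian (discExp κ) z = - κ * Real.exp (2 * discExp κ z) := by
  have hpos : ∀ z ∈ Metric.ball (0 : Plane) 1, 0 < 1 - ‖z‖ ^ 2 := by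
    intro z hz
    have hz1 : ‖z‖ < 1 := by simpa using hz
    nlinarith [norm_nonneg z]
  have h1 : ∀ y ∈ Metric.ball (0 : Plane) 1, ∀ v, fderiv ℝ (discExp κ) y v
      = 2 * ⟪y, v⟫_ℝ / (1 - ‖y‖ ^ 2) := by
    intro y hy v
    have := (((hasStrictFDerivAt_norm_sq y).hasFDerivAt.const_sub 1).log
      (hpos y hy).ne').const_sub (Real.log (4 / -κ) / 2)
    rw [show discExp κ = fun z => Real.log (4 / -κ) / 2 - Real.log (1 - ‖z‖ ^ 2) from rfl,
      this.fderiv]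
    simp
    ring
  have hρ2 : ContDiffAt ℝ 2 (discExp κ) z :=
    (contDiffOn_discExp κ 2).contDiffAt (Metric.isOpen_ball.mem_nhds hz)
  have hd : HasFDerivAt (fderiv ℝ (discExp κ)) (fderiv ℝ (fderiv ℝ (discExp κ)) z) z :=
    ((hρ2.fderiv_right (m := 1) (by norm_num)).differentiableAt (by norm_num)).hasFDerivAt
  have h2 : ∀ v, fderiv ℝ (fderiv ℝ (discExp κ)) z v v
      = 2 * ⟪v, v⟫_ℝ / (1 - ‖z‖ ^ 2) + 4 * ⟪z, v⟫_ℝ ^ 2 / (1 - ‖z‖ ^ 2) ^ 2 := by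
    intro v
    have e1 := hd.clm_apply (hasFDerivAt_const v z)
    have e2 : HasFDerivAt (fun y : Plane => 2 * ⟪y, v⟫_ℝ) _ z :=
      (((hasFDerivAt_id z).inner ℝ (hasFDerivAt_const v z))).const_mul 2
    have e3 := ((hasStrictFDerivAt_norm_sq z).hasFDerivAt.const_sub (1 : ℝ))
    have e4 := e2.mul ((hasDerivAt_inv (hpos z hz).ne').comp_hasFDerivAt z e3)
    have e5 := DFunLike.congr_fun (e1.unique (e4.congr_of_eventuallyEq (by
      filter_upwards [Metric.isOpen_ball.mem_nhds hz] with y hy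
      rw [h1 y hy v, div_eq_mul_inv]; rfl))) v
    simp at e5
    rw [e5]
    have := (hpos z hz).ne'
    simp
    field_simp
    ring
  rw [flatLaplacian, h2, h2, exp_two_discExp hκ hz]
  have h3 := (hpos z hz).ne'
  have hκ' := hκ.ne
  have hn : ‖z‖ ^ 2 = ⟪z, coordVec 0⟫_ℝ ^ 2 + ⟪z, coordVec 1⟫_ℝ ^ 2 := by
    rw [EuclideanSpace.norm_sq_eq]
    simp [coordVec, EuclideanSpace.inner_single_right]
  rw [inner_coordVec, inner_coordVec]
  field_simp
  simp
  linear_combination (-4 : ℝ) * hn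

theorem hasCurv_disc {κ : ℝ} (hκ : κ < 0) {z : Plane} (hz : z ∈ Metric.ball (0 : Plane) 1) :
    HasCurv (confForm (discExp κ)) (confConn (discExp κ)) z κ :=
  hasCurv_conf Metric.isOpen_ball (contDiffOn_discExp κ 2) hz (flatLaplacian_discExp hκ hz)

/-! ### Total differential equations integrated along rays. -/

section Frobenius

variable {X E : Type*} [NormedAddCommGroup X] [NormedSpace ℝ X]
  [NormedAddCommGroup E] [NormedSpace ℝ E]

/-- Gronwall's inequality from zero initial value. With `ε = 0` it is a uniqueness statement; with
`ε` small it controls differences of neighbouring solutions. -/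
theorem norm_le_of_norm_deriv_le {f f' : ℝ → E} {K ε : ℝ} (hK : 0 < K) (hε : 0 ≤ ε)
    (hf : ∀ t ∈ Set.Icc (0 : ℝ) 1, HasDerivWithinAt f (f' t) (Set.Icc 0 1) t) (h0 : f 0 = 0)
    (bound : ∀ t ∈ Set.Icc (0 : ℝ) 1, ‖f' t‖ ≤ K * ‖f t‖ + ε) {t : ℝ}
    (ht : t ∈ Set.Icc (0 : ℝ) 1) : ‖f t‖ ≤ Real.exp K / K * ε := by
  have h1 := norm_le_gronwallBound_of_norm_deriv_right_le (f := f) (f' := f') (δ := 0) (K := K)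
    (ε := ε) (a := 0) (b := 1) (fun t ht => (hf t ht).continuousWithinAt)
    (fun t ht => (hf t ⟨ht.1, ht.2.le⟩).mono_of_mem_nhdsWithin (Icc_mem_nhdsGE_of_mem ht))
    (by simp [h0]) (fun t ht => bound t ⟨ht.1, ht.2.le⟩) t ht
  refine h1.trans ?_
  rw [gronwallBound_of_K_ne_0 hK.ne', sub_zero]
  simp only [zero_mul, zero_add]
  have h2 : Real.exp (K * t) ≤ Real.exp K := Real.exp_le_exp.2 (by nlinarith [ht.2])
  calc ε / K * (Real.exp (K * t) - 1) ≤ ε / K * Real.exp K := by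
        gcongr; linarith
    _ = _ := by ring

/-- A `C^1` function is uniformly well approximated by its derivative on a convex compact set. -/
theorem exists_uniform_taylor {F : Type*} [NormedAddCommGroup F] [NormedSpace ℝ F] {B : E → F}
    {K Ω : Set E} (hK : IsCompact K) (hKc : Convex ℝ K) (hΩ : IsOpen Ω) (hKΩ : K ⊆ Ω)
    (hB : ContDiffOn ℝ 1 B Ω) {c : ℝ} (hc : 0 < c) :
    ∃ δ > 0, ∀ p ∈ K, ∀ q ∈ K, ‖q - p‖ < δ →
      ‖B q - B p - fderiv ℝ B p (q - p)‖ ≤ c * ‖q - p‖ := by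
  have hcont : ContinuousOn (fderiv ℝ B) K :=
    (hB.continuousOn_fderiv_of_isOpen hΩ (by norm_num)).mono hKΩ
  have hu := hK.uniformContinuousOn_of_continuous hcont
  obtain ⟨δ, hδ, h⟩ := Metric.uniformContinuousOn_iff.1 hu c hc
  refine ⟨δ, hδ, fun p hp q hq hpq => ?_⟩
  have hconv : Convex ℝ (K ∩ Metric.ball p δ) := hKc.inter (convex_ball p δ)
  refine hconv.norm_image_sub_le_of_norm_hasFDerivWithin_le' (f := B) (f' := fderiv ℝ B)
    (fun x hx => ?_) (fun x hx => ?_) ⟨hp, Metric.mem_ball_self hδ⟩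
    ⟨hq, by simpa [dist_eq_norm] using hpq⟩
  · exact ((hB.contDiffAt (hΩ.mem_nhds (hKΩ hx.1))).differentiableAt
      (by norm_num)).hasFDerivAt.hasFDerivWithinAt
  · rw [← dist_eq_norm]
    exact (h x hx.1 p hp hx.2).le

/-- The Lipschitz bound is stated on convex subsets because the compact set in `exists_isometry`
need not be convex, whereas the boxes inside it are. -/
theorem exists_fderiv_bound {F : Type*} [NormedAddCommGroup F] [NormedSpace ℝ F] {B : E → F}
    {K Ω : Set E} (hK : IsCompact K) (hΩ : IsOpen Ω) (hKΩ : K ⊆ Ω)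
    (hB : ContDiffOn ℝ 1 B Ω) :
    ∃ L > 0, (∀ p ∈ K, ‖B p‖ ≤ L) ∧ (∀ p ∈ K, ‖fderiv ℝ B p‖ ≤ L) ∧
      ∀ K' ⊆ K, Convex ℝ K' → ∀ p ∈ K', ∀ q ∈ K', ‖B q - B p‖ ≤ L * ‖q - p‖ := by
  have hcont : ContinuousOn (fderiv ℝ B) K :=
    (hB.continuousOn_fderiv_of_isOpen hΩ (by norm_num)).mono hKΩ
  obtain ⟨L₁, hL₁⟩ := hK.exists_bound_of_continuousOn hcont
  obtain ⟨L₂, hL₂⟩ := hK.exists_bound_of_continuousOn (hB.continuousOn.mono hKΩ)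
  refine ⟨max (max L₁ L₂) 1, by positivity, fun p hp => (hL₂ p hp).trans (by simp),
    fun p hp => (hL₁ p hp).trans (by simp), fun K' hK' hKc p hp q hq => ?_⟩
  refine hKc.norm_image_sub_le_of_norm_hasFDerivWithin_le (f := B) (f' := fderiv ℝ B)
    (fun x hx => ?_) (fun x hx => (hL₁ x (hK' hx)).trans (by simp)) hp hq
  exact ((hB.contDiffAt (hΩ.mem_nhds (hKΩ (hK' hx)))).differentiableAt
      (by norm_num)).hasFDerivAt.hasFDerivWithinAt

/-- The total differential equation `dY = B(z, Y)`, integrated along the rays from `z₀`, is solved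
at the points of a ray along which the integrability condition holds. -/
theorem hasFDerivAt_of_radial_solutions {B : X × E → X →L[ℝ] E} {K Ω : Set (X × E)}
    (hK : IsCompact K) (hKc : Convex ℝ K) (hΩ : IsOpen Ω) (hKΩ : K ⊆ Ω)
    (hB : ContDiffOn ℝ 1 B Ω) {Z : X → ℝ → E} {z₀ : X} {Y₀ : E} {ε : ℝ}
    (hZ0 : ∀ w ∈ Metric.ball (0 : X) ε, Z w 0 = Y₀)
    (hZ : ∀ w ∈ Metric.ball (0 : X) ε, ∀ t ∈ Set.Icc (0 : ℝ) 1,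
      HasDerivWithinAt (Z w) (B (z₀ + t • w, Z w t) w) (Set.Icc 0 1) t)
    (hmem : ∀ w ∈ Metric.ball (0 : X) ε, ∀ t ∈ Set.Icc (0 : ℝ) 1, (z₀ + t • w, Z w t) ∈ K)
    {w : X} (hw : w ∈ Metric.ball (0 : X) ε)
    (hflat : ∀ t ∈ Set.Icc (0 : ℝ) 1, ∀ η,
      fderiv ℝ B (z₀ + t • w, Z w t) (w, B (z₀ + t • w, Z w t) w) η =
        fderiv ℝ B (z₀ + t • w, Z w t) (η, B (z₀ + t • w, Z w t) η) w) :
    HasFDerivAt (fun w => Z w 1) (B (z₀ + w, Z w 1)) w := by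
  obtain ⟨L, hL, hbd, hdbd, hlip⟩ := exists_fderiv_bound hK hΩ hKΩ hB
  replace hlip := hlip K subset_rfl hKc
  set W := ‖w‖ + 1 with hW
  have hW0 : 0 < W := by positivity
  set κ := L * W with hκ
  have hκ0 : 0 < κ := by positivity
  set C₀ := Real.exp κ / κ with hC₀
  have hC₀0 : 0 < C₀ := by positivity
  set C₁ := C₀ * (κ + L) with hC₁
  have hC₁0 : 0 < C₁ := by positivity
  rw [hasFDerivAt_iff_isLittleO_nhds_zero, Asymptotics.isLittleO_iff]
  intro c hc
  -- `M` collects the Gronwall factor and the bound for `q - p`. The tolerance `c` is split in two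
  -- halves, one for the Taylor error and one for the term quadratic in `η`.
  set M := C₀ * (1 + C₁) with hM
  have hM0 : 0 < M := by positivity
  obtain ⟨δ, hδ, htaylor⟩ := exists_uniform_taylor hK hKc hΩ hKΩ hB
    (c := c / (2 * M * W)) (by positivity)
  have e1 : ∀ᶠ η : X in 𝓝 0, w + η ∈ Metric.ball (0 : X) ε := by
    have : Tendsto (fun η => w + η) (𝓝 0) (𝓝 w) := by
      have h : Continuous fun η : X => w + η := by fun_prop
      simpa using h.tendsto 0
    exact this.eventually (Metric.isOpen_ball.mem_nhds hw)
  have e2 : ∀ r > 0, ∀ᶠ η : X in 𝓝 0, ‖η‖ < r := fun r hr => by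
    filter_upwards [Metric.ball_mem_nhds (0 : X) hr] with x hx using by simpa using hx
  filter_upwards [e1, e2 1 one_pos, e2 (δ / (1 + C₁)) (by positivity),
    e2 (c / (2 * M * L)) (by positivity)] with η h1 h2 h3 h4
  set p : ℝ → X × E := fun t => (z₀ + t • w, Z w t) with hp
  set q : ℝ → X × E := fun t => (z₀ + t • (w + η), Z (w + η) t) with hq
  set Δ : ℝ → E := fun t => Z (w + η) t - Z w t with hΔ
  have hpq : ∀ t, q t - p t = (t • η, Δ t) := fun t => by
    ext <;> simp [hp, hq, hΔ]
  have hpq' : ∀ t ∈ Set.Icc (0 : ℝ) 1, ‖q t - p t‖ ≤ ‖η‖ + ‖Δ t‖ := fun t ht => by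
    rw [hpq]
    refine max_le ?_ ?_
    · rw [norm_smul, Real.norm_of_nonneg ht.1]
      nlinarith [norm_nonneg η, norm_nonneg (Δ t), ht.2]
    · simp
  have hwη : ‖w + η‖ ≤ W := (norm_add_le _ _).trans (by simp only [hW]; linarith)
  have hΔ' : ∀ t ∈ Set.Icc (0 : ℝ) 1,
      HasDerivWithinAt Δ (B (q t) (w + η) - B (p t) w) (Set.Icc 0 1) t := fun t ht =>
    (hZ _ h1 t ht).sub (hZ _ hw t ht)
  have hΔ0 : Δ 0 = 0 := by simp [hΔ, hZ0 _ h1, hZ0 _ hw]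
  have hpK : ∀ t ∈ Set.Icc (0 : ℝ) 1, p t ∈ K := hmem w hw
  have hqK : ∀ t ∈ Set.Icc (0 : ℝ) 1, q t ∈ K := hmem _ h1
  -- First Gronwall argument: neighbouring rays differ by O(‖η‖).
  have hΔb : ∀ t ∈ Set.Icc (0 : ℝ) 1, ‖Δ t‖ ≤ C₁ * ‖η‖ := fun t ht => by
    have := norm_le_of_norm_deriv_le hκ0 (ε := (κ + L) * ‖η‖) (by positivity) hΔ' hΔ0
      (fun t ht => ?_) ht
    · rw [hC₁]; linarith
    rw [show B (q t) (w + η) - B (p t) w = (B (q t) - B (p t)) (w + η) + B (p t) η by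
      simp only [map_add, sub_apply]; abel]
    have b1 : ‖(B (q t) - B (p t)) (w + η)‖ ≤ L * (‖η‖ + ‖Δ t‖) * W :=
      ((B (q t) - B (p t)).le_opNorm _).trans (by
        gcongr
        exact (hlip _ (hpK t ht) _ (hqK t ht)).trans (by gcongr; exact hpq' t ht))
    have b2 : ‖B (p t) η‖ ≤ L * ‖η‖ :=
      ((B (p t)).le_opNorm _).trans (by gcongr; exact hbd _ (hpK t ht))
    refine (norm_add_le _ _).trans ((add_le_add b1 b2).trans (le_of_eq ?_))
    rw [hκ]; ring
  have hpqb : ∀ t ∈ Set.Icc (0 : ℝ) 1, ‖q t - p t‖ ≤ (1 + C₁) * ‖η‖ := fun t ht =>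
    (hpq' t ht).trans (by linarith [hΔb t ht])
  -- The expected first variation of the solution is t B(p t) η. A second Gronwall argument shows
  -- that the error `D` is o(‖η‖).
  set D : ℝ → E := fun t => Δ t - t • B (p t) η with hD
  have hDp : ∀ t ∈ Set.Icc (0 : ℝ) 1, HasDerivWithinAt (fun t => B (p t))
      (fderiv ℝ B (p t) (w, B (p t) w)) (Set.Icc 0 1) t := fun t ht => by
    have hBd : HasFDerivAt B (fderiv ℝ B (p t)) (p t) :=
      ((hB.contDiffAt (hΩ.mem_nhds (hKΩ (hpK t ht)))).differentiableAt (by norm_num)).hasFDerivAt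
    have hpd : HasDerivWithinAt p (w, B (p t) w) (Set.Icc 0 1) t := by
      refine HasDerivWithinAt.prodMk ?_ (hZ w hw t ht)
      simpa using (((hasDerivAt_id t).smul_const w).const_add z₀).hasDerivWithinAt
    exact hBd.comp_hasDerivWithinAt t hpd
  have hD' : ∀ t ∈ Set.Icc (0 : ℝ) 1, HasDerivWithinAt D
      ((B (q t) - B (p t) - fderiv ℝ B (p t) (q t - p t)) (w + η)
        + fderiv ℝ B (p t) (q t - p t) η + fderiv ℝ B (p t) (0, D t) w) (Set.Icc 0 1) t := by
    intro t ht
    have a1 := (hΔ' t ht).sub ((hasDerivWithinAt_id t (Set.Icc (0 : ℝ) 1)).smul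
      ((hDp t ht).clm_apply (hasDerivWithinAt_const t (Set.Icc (0 : ℝ) 1) η)))
    convert! a1 using 1
    have a2 : ((0 : X), D t) = (q t - p t) - t • (η, B (p t) η) := by
      rw [hpq, hD]; ext <;> simp
    -- Integrability exchanges `w` and `η` in the derivative of t B(p t) η, so that this term
    -- combines with dB(q - p) w to dB(0, D) w, which is linear in `D`.
    have a3 := hflat t ht η
    simp only [a2, map_sub, map_smul, sub_apply, smul_apply, map_add, map_zero, add_zero,
      one_smul, id]
    rw [show fderiv ℝ B (p t) (η, B (p t) η) w = _ from a3.symm]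
    abel
  have hD0 : D 0 = 0 := by simp [hD, hΔ0]
  have hDb := norm_le_of_norm_deriv_le hκ0
    (ε := (1 + C₁) * (c / (2 * M * W) * W + L * ‖η‖) * ‖η‖) (by positivity) hD' hD0
    (fun t ht => ?_) (t := 1) (by simp)
  · have hη : L * ‖η‖ ≤ c / (2 * M) := by
      have := h4.le
      calc L * ‖η‖ ≤ L * (c / (2 * M * L)) := by gcongr
        _ = _ := by field_simp
    have : ‖D 1‖ ≤ c * ‖η‖ := by
      refine hDb.trans ?_
      calc Real.exp κ / κ * ((1 + C₁) * (c / (2 * M * W) * W + L * ‖η‖) * ‖η‖)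
          = M * (c / (2 * M) + L * ‖η‖) * ‖η‖ := by
            rw [hM, hC₀]; field_simp
        _ ≤ M * (c / (2 * M) + c / (2 * M)) * ‖η‖ := by gcongr
        _ = c * ‖η‖ := by field_simp; ring
    simpa [hD, hΔ, hp] using this
  · have hlt : ‖q t - p t‖ < δ := by
      refine (hpqb t ht).trans_lt ?_
      rw [lt_div_iff₀ (by positivity)] at h3
      linarith
    have b1 : ‖(B (q t) - B (p t) - fderiv ℝ B (p t) (q t - p t)) (w + η)‖
        ≤ c / (2 * M * W) * ((1 + C₁) * ‖η‖) * W :=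
      (ContinuousLinearMap.le_opNorm _ _).trans (by
        gcongr
        exact (htaylor _ (hpK t ht) _ (hqK t ht) hlt).trans (by gcongr; exact hpqb t ht))
    have b2 : ‖fderiv ℝ B (p t) (q t - p t) η‖ ≤ L * ((1 + C₁) * ‖η‖) * ‖η‖ :=
      (ContinuousLinearMap.le_opNorm _ _).trans (by
        gcongr
        exact (ContinuousLinearMap.le_opNorm _ _).trans
          (mul_le_mul (hdbd _ (hpK t ht)) (hpqb t ht) (by positivity) (by positivity)))
    have b3 : ‖fderiv ℝ B (p t) ((0 : X), D t) w‖ ≤ L * ‖D t‖ * W :=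
      (ContinuousLinearMap.le_opNorm _ _).trans (by
        gcongr
        · refine (ContinuousLinearMap.le_opNorm _ _).trans ?_
          rw [Prod.norm_mk, norm_zero, max_eq_right (norm_nonneg _)]
          gcongr
          exact hdbd _ (hpK t ht)
        · simp [hW])
    refine (norm_add₃_le ..).trans ((add_le_add (add_le_add b1 b2) b3).trans (le_of_eq ?_))
    rw [hκ]; ring

/-- Solutions of the total differential equation `dY = B(z, Y)` along the rays from `z₀`. -/
theorem exists_radial_solution [CompleteSpace E] {B : X × E → X →L[ℝ] E} {z₀ : X} {Y₀ : E}
    {a L ε : ℝ} (ha : 0 < a) (hL : 0 < L) (hLε : L * ε ≤ a)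
    (hbd : ∀ z ∈ Metric.closedBall z₀ ε, ∀ Y ∈ Metric.closedBall Y₀ a, ‖B (z, Y)‖ ≤ L)
    (hlip : ∀ z ∈ Metric.closedBall z₀ ε, ∀ Y ∈ Metric.closedBall Y₀ a,
      ∀ z' ∈ Metric.closedBall z₀ ε, ∀ Y' ∈ Metric.closedBall Y₀ a,
        ‖B (z, Y) - B (z', Y')‖ ≤ L * ‖(z, Y) - (z', Y')‖)
    {w : X} (hw : ‖w‖ ≤ ε) :
    ∃ Z : ℝ → E, Z 0 = Y₀ ∧ (∀ t ∈ Set.Icc (0 : ℝ) 1,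
      HasDerivWithinAt Z (B (z₀ + t • w, Z t) w) (Set.Icc 0 1) t) ∧
      ∀ t ∈ Set.Icc (0 : ℝ) 1, Z t ∈ Metric.closedBall Y₀ a := by
  have hε : 0 ≤ ε := (norm_nonneg w).trans hw
  have hz : ∀ t ∈ Set.Icc (0 : ℝ) 1, z₀ + t • w ∈ Metric.closedBall z₀ ε := fun t ht => by
    rw [mem_closedBall_iff_norm, add_sub_cancel_left, norm_smul, Real.norm_of_nonneg ht.1]
    nlinarith [ht.2, norm_nonneg w]
  -- The speed along the ray is at most `L * ε ≤ a`, so in unit time the solution cannot leave the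
  -- ball of radius `a`.
  have hPL : IsPicardLindelof (fun t Y => B (z₀ + t • w, Y) w) (tmin := 0) (tmax := 1)
      ⟨0, by simp⟩ Y₀ (NNReal.mk a ha.le) 0 (NNReal.mk (L * ε) (by positivity)) (NNReal.mk (L * ε) (by positivity)) := by
    refine ⟨fun t ht => ?_, fun Y hY => ?_, fun t ht Y hY => ?_, ?_⟩
    · refine LipschitzOnWith.of_dist_le_mul fun Y hY Y' hY' => ?_
      rw [dist_eq_norm, dist_eq_norm, ← sub_apply]
      refine (ContinuousLinearMap.le_opNorm _ _).trans ?_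
      refine (mul_le_mul (hlip _ (hz t ht) Y hY _ (hz t ht) Y' hY') hw (norm_nonneg _)
        (by positivity)).trans (le_of_eq ?_)
      rw [Prod.mk_sub_mk, sub_self, Prod.norm_mk, norm_zero, max_eq_right (norm_nonneg _)]
      simp only [NNReal.coe_mk]
      ring
    · refine ContinuousOn.clm_apply ?_ continuousOn_const
      have hl : LipschitzOnWith (NNReal.mk (L * ε) (by positivity) : ℝ≥0) (fun t : ℝ => B (z₀ + t • w, Y))
          (Set.Icc 0 1) := by
        refine LipschitzOnWith.of_dist_le_mul fun t ht t' ht' => ?_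
        rw [dist_eq_norm, dist_eq_norm]
        refine (hlip _ (hz t ht) Y hY _ (hz t' ht') Y hY).trans ?_
        rw [Prod.mk_sub_mk, sub_self, Prod.norm_mk, norm_zero, max_eq_left (norm_nonneg _),
          add_sub_add_left_eq_sub, ← sub_smul, norm_smul, NNReal.coe_mk]
        calc L * (‖t - t'‖ * ‖w‖) ≤ L * (‖t - t'‖ * ε) := by gcongr
          _ = _ := by ring
      exact hl.continuousOn
    · refine (ContinuousLinearMap.le_opNorm _ _).trans ?_
      exact mul_le_mul (hbd _ (hz t ht) Y hY) hw (norm_nonneg _) hL.le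
    · simp only [NNReal.coe_mk, NNReal.coe_zero, sub_zero]
      simpa using hLε
  -- The fixed point itself is used because it carries the confinement to the closed ball.
  obtain ⟨α, hα⟩ := ODE.FunSpace.exists_isFixedPt_next hPL (Metric.mem_closedBall_self le_rfl)
  refine ⟨α.compProj, ?_, fun t ht => ?_, fun t ht => ?_⟩
  · have : α.compProj ((⟨0, by simp⟩ : Set.Icc (0 : ℝ) 1) : ℝ) = Y₀ := by
      rw [ODE.FunSpace.compProj_val, ← hα, ODE.FunSpace.next_apply₀]
    exact this
  · apply ODE.hasDerivWithinAt_picard_Icc (t₀ := 0) (by simp) hPL.continuousOn_uncurry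
      α.continuous_compProj.continuousOn (fun _ ht' ↦ α.compProj_mem_closedBall hPL.mul_max_le)
      Y₀ ht |>.congr_of_mem _ ht
    intro t' ht'
    nth_rw 1 [← hα]
    rw [ODE.FunSpace.compProj_of_mem ht', ODE.FunSpace.next_apply]
  · exact α.compProj_mem_closedBall hPL.mul_max_le

end Frobenius

/-! ### The first-order system for the 1-jet of an isometry. -/

section Development

variable {E : Type*} [NormedAddCommGroup E] [NormedSpace ℝ E]

/-- The total differential equation satisfied by the `1`-jet of an isometry between two
manifolds with connections `Γt` and `Γ`. -/
def jetField (Γt Γ : E → E →L[ℝ] E →L[ℝ] E) (p : E × E × (E →L[ℝ] E)) :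
    E →L[ℝ] E × (E →L[ℝ] E) :=
  p.2.2.prod (ContinuousLinearMap.compL ℝ E E E p.2.2 ∘L Γt p.1
    - (ContinuousLinearMap.compL ℝ E E E).flip p.2.2 ∘L Γ p.2.1 ∘L p.2.2)

variable {g gt : E → E →L[ℝ] E →L[ℝ] ℝ} {Γ Γt : E → E →L[ℝ] E →L[ℝ] E} {V U : Set E}

theorem jetField_fst (p : E × E × (E →L[ℝ] E)) (u : E) : (jetField Γt Γ p u).1 = p.2.2 u := rfl

theorem jetField_snd (p : E × E × (E →L[ℝ] E)) (u v : E) :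
    (jetField Γt Γ p u).2 v = p.2.2 (Γt p.1 u v) - Γ p.2.1 (p.2.2 u) (p.2.2 v) := rfl

theorem contDiffOn_jetField [FiniteDimensional ℝ E] (h : IsLeviCivita g Γ V)
    (ht : IsLeviCivita gt Γt U) :
    ContDiffOn ℝ 1 (jetField Γt Γ) (U ×ˢ V ×ˢ Set.univ) := by
  have hP : ∀ u, ContDiffOn ℝ 1 (fun p : E × E × (E →L[ℝ] E) => p.2.2 u) (U ×ˢ V ×ˢ Set.univ) :=
    fun u => (contDiff_snd.snd.clm_apply contDiff_const).contDiffOn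
  have hΓt : ContDiffOn ℝ 1 (fun p : E × E × (E →L[ℝ] E) => Γt p.1) (U ×ˢ V ×ˢ Set.univ) :=
    ht.contDiffOn_conn.comp contDiff_fst.contDiffOn fun p hp => hp.1
  have hΓ : ContDiffOn ℝ 1 (fun p : E × E × (E →L[ℝ] E) => Γ p.2.1) (U ×ˢ V ×ˢ Set.univ) :=
    h.contDiffOn_conn.comp contDiff_snd.fst.contDiffOn fun p hp => hp.2.1
  rw [contDiffOn_clm_apply]
  intro u
  refine ContDiffOn.prodMk (f := fun p : E × E × (E →L[ℝ] E) => p.2.2 u)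
    (g := fun p => (jetField Γt Γ p u).2) (hP u) ?_
  rw [contDiffOn_clm_apply]
  intro v
  simp only [jetField_snd]
  exact (contDiff_snd.snd.contDiffOn.clm_apply ((hΓt.clm_apply contDiffOn_const).clm_apply
    contDiffOn_const)).sub ((hΓ.clm_apply (hP u)).clm_apply (hP v))

theorem isOpen_jetDomain (h : IsLeviCivita g Γ V) (ht : IsLeviCivita gt Γt U) :
    IsOpen (U ×ˢ V ×ˢ (Set.univ : Set (E →L[ℝ] E))) :=
  ht.isOpen.prod (h.isOpen.prod isOpen_univ)

theorem fderiv_jetField [FiniteDimensional ℝ E] (h : IsLeviCivita g Γ V)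
    (ht : IsLeviCivita gt Γt U) {p : E × E × (E →L[ℝ] E)} (hp1 : p.1 ∈ U) (hp2 : p.2.1 ∈ V)
    (q : E × E × (E →L[ℝ] E)) (u v : E) :
    (fderiv ℝ (jetField Γt Γ) p q u).1 = q.2.2 u ∧
    (fderiv ℝ (jetField Γt Γ) p q u).2 v =
      q.2.2 (Γt p.1 u v) + p.2.2 (fderiv ℝ Γt p.1 q.1 u v)
      - (fderiv ℝ Γ p.2.1 q.2.1 (p.2.2 u) (p.2.2 v) + Γ p.2.1 (q.2.2 u) (p.2.2 v)
        + Γ p.2.1 (p.2.2 u) (q.2.2 v)) := by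
  have hd : HasFDerivAt (jetField Γt Γ) (fderiv ℝ (jetField Γt Γ) p) p :=
    (((contDiffOn_jetField h ht).contDiffAt ((isOpen_jetDomain h ht).mem_nhds
      ⟨hp1, hp2, trivial⟩)).differentiableAt (by norm_num)).hasFDerivAt
  have hu := hd.clm_apply (hasFDerivAt_const u p)
  have hP : ∀ u, HasFDerivAt (fun p : E × E × (E →L[ℝ] E) => p.2.2 u) _ p := fun u =>
    (hasFDerivAt_snd.snd : HasFDerivAt (fun p : E × E × (E →L[ℝ] E) => p.2.2) _ p).clm_apply
      (hasFDerivAt_const u p)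
  have hΓt : HasFDerivAt (fun p : E × E × (E →L[ℝ] E) => Γt p.1) _ p :=
    (ht.hasFDerivAt_conn hp1).comp p hasFDerivAt_fst
  have hΓ : HasFDerivAt (fun p : E × E × (E →L[ℝ] E) => Γ p.2.1) _ p :=
    (h.hasFDerivAt_conn hp2).comp p hasFDerivAt_snd.fst
  constructor
  · have e := DFunLike.congr_fun (hu.fst.unique (hP u)) q
    simpa using e
  · have e1 := hu.snd.clm_apply (hasFDerivAt_const v p)
    have e2 := ((hasFDerivAt_snd.snd : HasFDerivAt (fun p : E × E × (E →L[ℝ] E) => p.2.2) _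
      p).clm_apply ((hΓt.clm_apply (hasFDerivAt_const u p)).clm_apply
      (hasFDerivAt_const v p))).sub ((hΓ.clm_apply (hP u)).clm_apply (hP v))
    have e := DFunLike.congr_fun (e1.unique e2) q
    simp at e
    rw [e]
    abel

/-- The integrability condition of the isometry equation between two metrics of the same constant
curvature. -/
theorem jetField_integrable [FiniteDimensional ℝ E] (h : IsLeviCivita g Γ V)
    (ht : IsLeviCivita gt Γt U) {p : E × E × (E →L[ℝ] E)} (hp1 : p.1 ∈ U) (hp2 : p.2.1 ∈ V)
    {k : ℝ} (hk : HasCurv g Γ p.2.1 k) (hkt : HasCurv gt Γt p.1 k)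
    (hiso : ∀ v w, g p.2.1 (p.2.2 v) (p.2.2 w) = gt p.1 v w) (a b : E) :
    fderiv ℝ (jetField Γt Γ) p (a, jetField Γt Γ p a) b
      = fderiv ℝ (jetField Γt Γ) p (b, jetField Γt Γ p b) a := by
  -- For p = (z, y, P), the first component is the symmetry of P Γt(a, b) - Γ(Pa, Pb), i.e. absence
  -- of torsion. In the second, the two sides differ by P R̃(a, b)v - R(Pa, Pb)Pv, where R̃ is the
  -- curvature of `Γt`.
  refine Prod.ext ?_ (ContinuousLinearMap.ext fun v => ?_)
  · rw [(fderiv_jetField h ht hp1 hp2 _ _ 0).1, (fderiv_jetField h ht hp1 hp2 _ _ 0).1]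
    simp only [jetField_snd, ht.torsion_free _ hp1 a, h.torsion_free _ hp2 (p.2.2 a)]
  · rw [(fderiv_jetField h ht hp1 hp2 _ _ v).2, (fderiv_jetField h ht hp1 hp2 _ _ v).2]
    have h1 := congrArg p.2.2 (hkt a b v)
    have h2 := hk (p.2.2 a) (p.2.2 b) (p.2.2 v)
    rw [hiso, hiso] at h2
    simp only [map_smul, map_sub] at h1
    have h3 := h1.trans h2.symm
    simp only [curvOp, map_sub, map_add] at h3
    simp only [jetField_snd, jetField_fst, map_sub, sub_apply]
    rw [ht.torsion_free _ hp1 b a, h.torsion_free _ hp2 (p.2.2 b) (p.2.2 a)]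
    rw [← sub_eq_zero] at h3 ⊢
    rw [← h3]
    abel

/-- A solution of the isometry equation along a ray stays isometric. -/
theorem isometric_along_ray [FiniteDimensional ℝ E] (h : IsLeviCivita g Γ V)
    (ht : IsLeviCivita gt Γt U) {z₀ w : E} {Z : ℝ → E × (E →L[ℝ] E)}
    (hU : ∀ t ∈ Set.Icc (0 : ℝ) 1, z₀ + t • w ∈ U) (hV : ∀ t ∈ Set.Icc (0 : ℝ) 1, (Z t).1 ∈ V)
    (hZ : ∀ t ∈ Set.Icc (0 : ℝ) 1,
      HasDerivWithinAt Z (jetField Γt Γ (z₀ + t • w, Z t) w) (Set.Icc 0 1) t)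
    (h0 : ∀ v x, g (Z 0).1 ((Z 0).2 v) ((Z 0).2 x) = gt z₀ v x)
    {t : ℝ} (ht1 : t ∈ Set.Icc (0 : ℝ) 1) (v x : E) :
    g (Z t).1 ((Z t).2 v) ((Z t).2 x) = gt (z₀ + t • w) v x := by
  -- The defect from being isometric. By compatibility of both connections it satisfies the linear
  -- equation in `hval`, and it vanishes at time 0.
  set D : ℝ → E →L[ℝ] E →L[ℝ] ℝ := fun t =>
    (ContinuousLinearMap.flipₗᵢ ℝ E E ℝ ((g (Z t).1).comp (Z t).2)).comp (Z t).2
      - gt (z₀ + t • w) with hD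
  have hDv : ∀ t v x, D t v x = g (Z t).1 ((Z t).2 x) ((Z t).2 v) - gt (z₀ + t • w) v x :=
    fun t v x => rfl
  have hray : ∀ t, HasDerivWithinAt (fun t : ℝ => z₀ + t • w) w (Set.Icc 0 1) t := fun t => by
    simpa using (((hasDerivAt_id t).smul_const w).const_add z₀).hasDerivWithinAt
  obtain ⟨C, hC⟩ := (isCompact_Icc (a := (0 : ℝ)) (b := 1)).exists_bound_of_continuousOn
    (f := fun t : ℝ => Γt (z₀ + t • w) w)
    ((ht.contDiffOn_conn.continuousOn.comp (by fun_prop) hU).clm_apply continuousOn_const)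
  have hder : ∀ t ∈ Set.Icc (0 : ℝ) 1, ∃ D', HasDerivWithinAt D D' (Set.Icc 0 1) t ∧
      ‖D'‖ ≤ (2 * |C| + 1) * ‖D t‖ + 0 := by
    intro t ht1
    have a1 := (h.hasFDerivAt_metric (hV t ht1)).comp_hasDerivWithinAt t (hZ t ht1).fst
    have a2 := a1.clm_comp (hZ t ht1).snd
    have a3 := ((ContinuousLinearMap.flipₗᵢ ℝ E E ℝ).toContinuousLinearEquiv.toContinuousLinearMap.hasFDerivAt).comp_hasDerivWithinAt t a2
    have a4 := a3.clm_comp (hZ t ht1).snd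
    have a5 := a4.sub ((ht.hasFDerivAt_metric (hU t ht1)).comp_hasDerivWithinAt t (hray t))
    refine ⟨_, a5, ?_⟩
    have hval : ∀ v x, ((ContinuousLinearMap.flipₗᵢ ℝ E E ℝ) ((fderiv ℝ g (Z t).1
        ((jetField Γt Γ (z₀ + t • w, Z t) w).1)).comp (Z t).2
          + (g (Z t).1).comp (jetField Γt Γ (z₀ + t • w, Z t) w).2)).comp (Z t).2 v x
        + ((ContinuousLinearMap.flipₗᵢ ℝ E E ℝ) ((g (Z t).1).comp (Z t).2)).comp
          (jetField Γt Γ (z₀ + t • w, Z t) w).2 v x - fderiv ℝ gt (z₀ + t • w) w v x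
        = D t (Γt (z₀ + t • w) w v) x + D t v (Γt (z₀ + t • w) w x) := by
      intro v x
      simp only [hDv, ContinuousLinearMap.comp_apply, ContinuousLinearMap.coe_flipₗᵢ,
        ContinuousLinearMap.flip_apply, add_apply, jetField_fst, jetField_snd,
        h.compat _ (hV t ht1), ht.compat _ (hU t ht1), map_sub, sub_apply]
      ring
    refine ContinuousLinearMap.opNorm_le_bound₂ _ (by positivity) fun v x => ?_
    have e := hval v x
    refine (le_of_eq (congrArg norm e)).trans ?_
    have b1 : ‖D t (Γt (z₀ + t • w) w v) x‖ ≤ ‖D t‖ * (|C| * ‖v‖) * ‖x‖ :=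
      ((D t).le_opNorm₂ _ _).trans (by
        gcongr
        exact (ContinuousLinearMap.le_opNorm _ _).trans (by
          gcongr; exact (hC t ht1).trans (le_abs_self C)))
    have b2 : ‖D t v (Γt (z₀ + t • w) w x)‖ ≤ ‖D t‖ * ‖v‖ * (|C| * ‖x‖) :=
      ((D t).le_opNorm₂ _ _).trans (by
        gcongr
        exact (ContinuousLinearMap.le_opNorm _ _).trans (by
          gcongr; exact (hC t ht1).trans (le_abs_self C)))
    refine (norm_add_le _ _).trans ((add_le_add b1 b2).trans ?_)
    nlinarith [mul_nonneg (mul_nonneg (norm_nonneg (D t)) (norm_nonneg v)) (norm_nonneg x)]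
  choose! D' hD' hDb using hder
  have hD0 : D 0 = 0 := by
    ext v x
    rw [hDv, h0, zero_smul, add_zero]
    have hz0 : z₀ ∈ U := by simpa using hU 0 (by simp)
    rw [ht.symm _ hz0 x v]; simp
  have := norm_le_of_norm_deriv_le (by positivity) le_rfl hD' hD0 hDb ht1
  have hDt : D t = 0 := by
    rw [mul_zero] at this
    exact norm_le_zero_iff.1 this
  have e := DFunLike.congr_fun (DFunLike.congr_fun hDt x) v
  rw [hDv] at e
  rw [ht.symm _ (hU t ht1) v x]
  exact sub_eq_zero.1 e

end Development

/-! ### Local uniqueness and existence of isometries. -/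

section Development

variable {E : Type*} [NormedAddCommGroup E] [NormedSpace ℝ E] [FiniteDimensional ℝ E]
  {g gt : E → E →L[ℝ] E →L[ℝ] ℝ} {Γ Γt : E → E →L[ℝ] E →L[ℝ] E} {V U : Set E}

/-- The `1`-jet of an isometry solves the isometry equation. -/
theorem hasFDerivAt_jet (h : IsLeviCivita g Γ V) (ht : IsLeviCivita gt Γt U) {f : E → E} {z : E}
    (hz : z ∈ U) (hfz : f z ∈ V) (hf : ContDiffAt ℝ 2 f z) (hiso : IsIsometryNear gt g f z) :
    HasFDerivAt (fun x => (f x, fderiv ℝ f x)) (jetField Γt Γ (z, f z, fderiv ℝ f z)) z := by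
  have hDf : HasFDerivAt f (fderiv ℝ f z) z := (hf.differentiableAt (by norm_num)).hasFDerivAt
  have hHf : HasFDerivAt (fderiv ℝ f) (fderiv ℝ (fderiv ℝ f) z) z :=
    ((hf.fderiv_right (m := 1) (by norm_num)).differentiableAt (by norm_num)).hasFDerivAt
  convert! hDf.prodMk hHf using 1
  refine ContinuousLinearMap.ext fun u => Prod.ext rfl (ContinuousLinearMap.ext fun v => ?_)
  rw [jetField_snd]
  exact (sndFDeriv_of_isometry h ht hz hfz hf hiso u v).symm

/-- An isometry is determined near a point by its `1`-jet at that point. -/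
theorem IsIsometryNear.eventuallyEq (h : IsLeviCivita g Γ V) (ht : IsLeviCivita gt Γt U)
    {f₁ f₂ : E → E} {z : E} (hz : z ∈ U) (hfz : f₁ z ∈ V) (hf₁ : ContDiffAt ℝ 2 f₁ z)
    (hf₂ : ContDiffAt ℝ 2 f₂ z) (hi₁ : IsIsometryNear gt g f₁ z) (hi₂ : IsIsometryNear gt g f₂ z)
    (h0 : f₁ z = f₂ z) (h1 : fderiv ℝ f₁ z = fderiv ℝ f₂ z) : f₁ =ᶠ[𝓝 z] f₂ := by
  have hjet : ∀ {f : E → E}, f z ∈ V → ContDiffAt ℝ 2 f z → IsIsometryNear gt g f z →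
      ∀ᶠ x in 𝓝 z, HasFDerivAt (fun x => (f x, fderiv ℝ f x))
        (jetField Γt Γ (x, f x, fderiv ℝ f x)) x := by
    intro f hfz hf hi
    filter_upwards [ht.isOpen.mem_nhds hz, hf.continuousAt.preimage_mem_nhds
      (h.isOpen.mem_nhds hfz), hf.eventually (by simp), hi.eventually] with x x1 x2 x3 x4
    exact hasFDerivAt_jet h ht x1 x2 x3 x4
  have hcont : ∀ {f : E → E}, ContDiffAt ℝ 2 f z →
      ContinuousAt (fun x => (x, f x, fderiv ℝ f x)) z := fun {f} hf =>
    continuousAt_id.prodMk (hf.continuousAt.prodMk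
      (hf.fderiv_right (m := 1) (by norm_num)).continuousAt)
  obtain ⟨K, N, hN, hK⟩ := ((contDiffOn_jetField h ht).contDiffAt
    ((isOpen_jetDomain h ht).mem_nhds (x := (z, f₁ z, fderiv ℝ f₁ z))
      ⟨hz, hfz, trivial⟩)).exists_lipschitzOnWith
  have n1 := (hcont hf₁).preimage_mem_nhds hN
  have n2 := (hcont hf₂).preimage_mem_nhds (by rw [← h0, ← h1]; exact hN)
  have n12 : ∀ᶠ x in 𝓝 z, (x, f₁ x, fderiv ℝ f₁ x) ∈ N ∧ (x, f₂ x, fderiv ℝ f₂ x) ∈ N := by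
    filter_upwards [n1, n2] with x x1 x2 using ⟨x1, x2⟩
  obtain ⟨δ, hδ, hball⟩ := Metric.eventually_nhds_iff_ball.1
    (((hjet hfz hf₁ hi₁).and (hjet (h0 ▸ hfz) hf₂ hi₂)).and n12)
  filter_upwards [Metric.ball_mem_nhds z hδ] with x hx
  -- Along the segment from `z` to `x` both 1-jets solve the same Lipschitz ordinary differential
  -- equation with equal initial values.
  set γ : ℝ → E := fun t => z + t • (x - z) with hγ
  have hγ' : ∀ t, HasDerivWithinAt γ (x - z) (Set.Icc 0 1) t := fun t => by
    simpa [hγ] using (((hasDerivAt_id t).smul_const (x - z)).const_add z).hasDerivWithinAt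
  have hγb : ∀ t ∈ Set.Icc (0 : ℝ) 1, γ t ∈ Metric.ball z δ := fun t ht => by
    have hx' : ‖x - z‖ < δ := by simpa [dist_eq_norm] using hx
    rw [mem_ball_iff_norm, hγ, add_sub_cancel_left, norm_smul, Real.norm_of_nonneg ht.1]
    nlinarith [ht.2, norm_nonneg (x - z)]
  set Y₁ : E → E × (E →L[ℝ] E) := fun x => (f₁ x, fderiv ℝ f₁ x) with hY₁
  set Y₂ : E → E × (E →L[ℝ] E) := fun x => (f₂ x, fderiv ℝ f₂ x) with hY₂
  have hd : ∀ t ∈ Set.Icc (0 : ℝ) 1, HasDerivWithinAt (fun t => Y₁ (γ t) - Y₂ (γ t))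
      ((jetField Γt Γ (γ t, Y₁ (γ t)) - jetField Γt Γ (γ t, Y₂ (γ t))) (x - z))
      (Set.Icc 0 1) t := fun t ht => by
    have hb := hball _ (hγb t ht)
    exact (hb.1.1.comp_hasDerivWithinAt t (hγ' t)).sub
      (hb.1.2.comp_hasDerivWithinAt t (hγ' t))
  -- The summand 1 only keeps the Gronwall constant positive.
  have hzero := norm_le_of_norm_deriv_le (K := K * ‖x - z‖ + 1) (by positivity) le_rfl hd
    (by simp [hγ, hY₁, hY₂, h0, h1]) (fun t ht => ?_) (t := 1) (by simp)
  · rw [mul_zero] at hzero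
    have e := congrArg Prod.fst (norm_le_zero_iff.1 hzero)
    simp only [hγ, hY₁, hY₂] at e
    simpa [sub_eq_zero] using e
  · have hb := hball _ (hγb t ht)
    have hl := hK.dist_le_mul _ hb.2.1 _ hb.2.2
    rw [dist_eq_norm, dist_eq_norm] at hl
    refine (ContinuousLinearMap.le_opNorm _ _).trans ?_
    have e : ‖(γ t, f₁ (γ t), fderiv ℝ f₁ (γ t)) - (γ t, f₂ (γ t), fderiv ℝ f₂ (γ t))‖
        = ‖Y₁ (γ t) - Y₂ (γ t)‖ := by
      rw [Prod.mk_sub_mk, sub_self, Prod.norm_mk, norm_zero, max_eq_right (norm_nonneg _)]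
    rw [e] at hl
    calc _ ≤ K * ‖Y₁ (γ t) - Y₂ (γ t)‖ * ‖x - z‖ := by gcongr
      _ ≤ (K * ‖x - z‖ + 1) * ‖Y₁ (γ t) - Y₂ (γ t)‖ + 0 := by
        nlinarith [norm_nonneg (Y₁ (γ t) - Y₂ (γ t))]

/-- Regularity of the solutions of the isometry equation. -/
theorem contDiffOn_of_jet (h : IsLeviCivita g Γ V) (ht : IsLeviCivita gt Γt U)
    {Y : E → E × (E →L[ℝ] E)} {O : Set E} (hO : IsOpen O) (hOU : O ⊆ U)
    (hYV : ∀ z ∈ O, (Y z).1 ∈ V)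
    (hY : ∀ z ∈ O, HasFDerivAt Y (jetField Γt Γ (z, Y z)) z) :
    (∀ z ∈ O, HasFDerivAt (fun x => (Y x).1) (Y z).2 z) ∧
      ContDiffOn ℝ 3 (fun x => (Y x).1) O := by
  have hf : ∀ z ∈ O, HasFDerivAt (fun x => (Y x).1) (Y z).2 z := fun z hz => (hY z hz).fst
  refine ⟨hf, ?_⟩
  have hYd : DifferentiableOn ℝ Y O := fun z hz => (hY z hz).differentiableAt.differentiableWithinAt
  have hmaps : Set.MapsTo (fun z => (z, Y z)) O (U ×ˢ V ×ˢ (Set.univ : Set (E →L[ℝ] E))) :=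
    fun z hz => ⟨hOU hz, hYV z hz, trivial⟩
  -- Bootstrapping: `Y` is as regular as its derivative `jetField Γt Γ (z, Y z)` allows. It stops at
  -- C², since the field is only C¹; a last derivative is gained because `(Y z).2` is the
  -- differential of the first component.
  have hY1 : ContDiffOn ℝ 1 Y O := by
    rw [show (1 : WithTop ℕ∞) = 0 + 1 by norm_num, contDiffOn_succ_iff_fderiv_of_isOpen hO]
    refine ⟨hYd, by simp, contDiffOn_zero.2 ?_⟩
    exact ((contDiffOn_jetField h ht).continuousOn.comp
      (continuousOn_id.prodMk hYd.continuousOn) hmaps).congr fun z hz => (hY z hz).fderiv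
  have hY2 : ContDiffOn ℝ 2 Y O := by
    rw [show (2 : WithTop ℕ∞) = 1 + 1 by norm_num, contDiffOn_succ_iff_fderiv_of_isOpen hO]
    refine ⟨hYd, by simp, ?_⟩
    exact ((contDiffOn_jetField h ht).comp (contDiffOn_id.prodMk hY1) hmaps).congr
      fun z hz => (hY z hz).fderiv
  rw [show (3 : WithTop ℕ∞) = 2 + 1 by norm_num, contDiffOn_succ_iff_fderiv_of_isOpen hO]
  refine ⟨fun z hz => (hf z hz).differentiableAt.differentiableWithinAt, by simp, ?_⟩
  exact hY2.snd.congr fun z hz => (hf z hz).fderiv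

/-- Linear isometries between the tangent spaces at the points of compact sets are bounded. -/
theorem exists_bound_of_isometric (h : IsLeviCivita g Γ V) (ht : IsLeviCivita gt Γt U)
    {Kz Ky : Set E} (hKz : IsCompact Kz) (hKzU : Kz ⊆ U) (hKy : IsCompact Ky) (hKyV : Ky ⊆ V) :
    ∃ C, ∀ z ∈ Kz, ∀ y ∈ Ky, ∀ P : E →L[ℝ] E, (∀ v w, g y (P v) (P w) = gt z v w) → ‖P‖ ≤ C := by
  have := FiniteDimensional.proper ℝ E
  obtain ⟨M, hM⟩ := hKz.exists_bound_of_continuousOn (ht.contDiffOn_metric.continuousOn.mono hKzU)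
  obtain ⟨m, hm, hmb⟩ : ∃ m > 0, ∀ y ∈ Ky, ∀ v, m * ‖v‖ ^ 2 ≤ g y v v := by
    have hc : IsCompact (Ky ×ˢ Metric.sphere (0 : E) 1) := hKy.prod (isCompact_sphere _ _)
    have hcont : ContinuousOn (fun p : E × E => g p.1 p.2 p.2) (Ky ×ˢ Metric.sphere (0 : E) 1) :=
      (((h.contDiffOn_metric.continuousOn.mono hKyV).comp continuousOn_fst
        fun p hp => hp.1).clm_apply continuousOn_snd).clm_apply continuousOn_snd
    obtain ⟨m, hm, hmb⟩ : ∃ m > 0, ∀ p ∈ Ky ×ˢ Metric.sphere (0 : E) 1, m ≤ g p.1 p.2 p.2 := by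
      rcases (Ky ×ˢ Metric.sphere (0 : E) 1).eq_empty_or_nonempty with he | hne
      · exact ⟨1, one_pos, by simp [he]⟩
      · obtain ⟨p, hp, hmin⟩ := hc.exists_isMinOn hne hcont
        refine ⟨_, h.pos _ (hKyV hp.1) p.2 ?_, fun q hq => hmin hq⟩
        exact Metric.ne_of_mem_sphere hp.2 one_ne_zero
    refine ⟨m, hm, fun y hy v => ?_⟩
    rcases eq_or_ne v 0 with rfl | hv
    · simp
    have hv' : 0 < ‖v‖ := norm_pos_iff.2 hv
    have e := hmb (y, ‖v‖⁻¹ • v) ⟨hy, by simp [norm_smul, hv'.ne']⟩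
    simp only [map_smul, smul_apply, smul_eq_mul] at e
    calc m * ‖v‖ ^ 2 ≤ ‖v‖⁻¹ * (‖v‖⁻¹ * g y v v) * ‖v‖ ^ 2 := by gcongr
      _ = g y v v := by field_simp
  refine ⟨Real.sqrt (|M| / m), fun z hz y hy P hP => ?_⟩
  refine ContinuousLinearMap.opNorm_le_bound _ (Real.sqrt_nonneg _) fun v => ?_
  have h1 : ‖P v‖ ^ 2 ≤ |M| / m * ‖v‖ ^ 2 := by
    have e1 := hmb y hy (P v)
    rw [hP] at e1
    have e2 : gt z v v ≤ |M| * ‖v‖ * ‖v‖ := (le_abs_self _).trans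
      (((gt z).le_opNorm₂ v v).trans (by gcongr; exact (hM z hz).trans (le_abs_self M)))
    rw [div_mul_eq_mul_div, le_div_iff₀ hm]
    nlinarith
  calc ‖P v‖ = Real.sqrt (‖P v‖ ^ 2) := (Real.sqrt_sq (norm_nonneg _)).symm
    _ ≤ Real.sqrt (|M| / m * ‖v‖ ^ 2) := Real.sqrt_le_sqrt h1
    _ = _ := by rw [Real.sqrt_mul (by positivity), Real.sqrt_sq (norm_nonneg _)]

/-- Local existence of isometries between metrics of the same constant curvature, on balls whose
radius is uniform on compact sets. -/
theorem exists_isometry (h : IsLeviCivita g Γ V) (ht : IsLeviCivita gt Γt U) {k : ℝ}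
    (hk : ∀ y ∈ V, HasCurv g Γ y k) (hkt : ∀ z ∈ U, HasCurv gt Γt z k)
    {Kz Ky : Set E} (hKz : IsCompact Kz) (hKzU : Kz ⊆ U) (hKy : IsCompact Ky) (hKyV : Ky ⊆ V) :
    ∃ ε > 0, ∀ z₀ ∈ Kz, ∀ y₀ ∈ Ky, ∀ P : E →L[ℝ] E, (∀ v w, g y₀ (P v) (P w) = gt z₀ v w) →
      ∃ f : E → E, f z₀ = y₀ ∧ fderiv ℝ f z₀ = P ∧ ∀ z ∈ Metric.ball z₀ ε,
        z ∈ U ∧ f z ∈ V ∧ ContDiffAt ℝ 3 f z ∧ IsIsometryNear gt g f z := by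
  have := FiniteDimensional.proper ℝ E
  have := FiniteDimensional.proper ℝ (E →L[ℝ] E)
  obtain ⟨C, hC⟩ := exists_bound_of_isometric h ht hKz hKzU hKy hKyV
  obtain ⟨r₁, hr₁, hr₁U⟩ := hKz.exists_cthickening_subset_open ht.isOpen hKzU
  obtain ⟨r₂, hr₂, hr₂V⟩ := hKy.exists_cthickening_subset_open h.isOpen hKyV
  -- One compact set contains a box of fixed size around every admissible initial jet, as `C` bounds
  -- all isometric `P`. Hence `L`, and with it `ε`, does not depend on the jet.
  set 𝒦 : Set (E × E × (E →L[ℝ] E)) := Metric.cthickening r₁ Kz ×ˢ Metric.cthickening r₂ Ky ×ˢ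
    Metric.closedBall 0 (C + 1) with h𝒦
  have h𝒦c : IsCompact 𝒦 := hKz.cthickening.prod (hKy.cthickening.prod (isCompact_closedBall _ _))
  have h𝒦Ω : 𝒦 ⊆ U ×ˢ V ×ˢ Set.univ := Set.prod_mono hr₁U (Set.prod_mono hr₂V (Set.subset_univ _))
  obtain ⟨L, hL, hbd, -, hlip⟩ := exists_fderiv_bound h𝒦c (isOpen_jetDomain h ht) h𝒦Ω
    (contDiffOn_jetField h ht)
  set a := min r₂ 1 with ha
  have ha0 : 0 < a := by positivity
  set ε := min r₁ (a / L) with hε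
  have hε0 : 0 < ε := by positivity
  refine ⟨ε, hε0, fun z₀ hz₀ y₀ hy₀ P hP => ?_⟩
  set Y₀ : E × (E →L[ℝ] E) := (y₀, P) with hY₀
  set K : Set (E × E × (E →L[ℝ] E)) := Metric.closedBall z₀ ε ×ˢ Metric.closedBall Y₀ a with hK
  have hKc : IsCompact K := (isCompact_closedBall _ _).prod (isCompact_closedBall _ _)
  have hKconv : Convex ℝ K := (convex_closedBall _ _).prod (convex_closedBall _ _)
  have hK𝒦 : K ⊆ 𝒦 := by
    rintro ⟨z, y, Q⟩ ⟨hz, hy⟩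
    have hy' : (y, Q) ∈ Metric.closedBall y₀ a ×ˢ Metric.closedBall P a := by
      rw [closedBall_prod_same]; exact hy
    refine ⟨?_, ?_, ?_⟩
    · exact Metric.mem_cthickening_of_dist_le _ z₀ _ _ hz₀
        ((Metric.mem_closedBall.1 hz).trans (min_le_left _ _))
    · exact Metric.mem_cthickening_of_dist_le _ y₀ _ _ hy₀
        ((Metric.mem_closedBall.1 hy'.1).trans (min_le_left _ _))
    · have h1 : ‖Q - P‖ ≤ 1 := by
        simpa [dist_eq_norm] using (Metric.mem_closedBall.1 hy'.2).trans (min_le_right _ _)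
      have h2 := hC z₀ hz₀ y₀ hy₀ P hP
      rw [mem_closedBall_zero_iff]
      calc ‖Q‖ = ‖P + (Q - P)‖ := by congr 1; abel
        _ ≤ ‖P‖ + ‖Q - P‖ := norm_add_le _ _
        _ ≤ C + 1 := add_le_add h2 h1
  have hex : ∀ w : E, ∃ Z : ℝ → E × (E →L[ℝ] E), w ∈ Metric.ball (0 : E) ε → (Z 0 = Y₀ ∧
      (∀ t ∈ Set.Icc (0 : ℝ) 1,
        HasDerivWithinAt Z (jetField Γt Γ (z₀ + t • w, Z t) w) (Set.Icc 0 1) t) ∧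
      ∀ t ∈ Set.Icc (0 : ℝ) 1, Z t ∈ Metric.closedBall Y₀ a) := by
    intro w
    by_cases hw : w ∈ Metric.ball (0 : E) ε
    · have hLε : L * ε ≤ a := by
        have : ε ≤ a / L := min_le_right _ _
        rwa [le_div_iff₀ hL, mul_comm] at this
      obtain ⟨Z, hZ⟩ := exists_radial_solution (B := jetField Γt Γ) (z₀ := z₀) (Y₀ := Y₀)
        ha0 hL hLε (fun z hz Y hY => hbd _ (hK𝒦 ⟨hz, hY⟩))
        (fun z hz Y hY z' hz' Y' hY' => hlip K hK𝒦 hKconv _ ⟨hz', hY'⟩ _ ⟨hz, hY⟩) (w := w)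
        (by simpa using (mem_ball_zero_iff.1 hw).le)
      exact ⟨Z, fun _ => hZ⟩
    · exact ⟨fun _ => 0, fun h => absurd h hw⟩
  choose Z hZ using hex
  have hray : ∀ w ∈ Metric.ball (0 : E) ε, ∀ t ∈ Set.Icc (0 : ℝ) 1,
      z₀ + t • w ∈ Metric.closedBall z₀ ε := fun w hw t ht => by
    have hw' : ‖w‖ < ε := by simpa using hw
    rw [mem_closedBall_iff_norm, add_sub_cancel_left, norm_smul, Real.norm_of_nonneg ht.1]
    nlinarith [ht.2, norm_nonneg w]
  have hmem : ∀ w ∈ Metric.ball (0 : E) ε, ∀ t ∈ Set.Icc (0 : ℝ) 1, (z₀ + t • w, Z w t) ∈ K :=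
    fun w hw t ht => ⟨hray w hw t ht, (hZ w hw).2.2 t ht⟩
  have hmemΩ : ∀ w ∈ Metric.ball (0 : E) ε, ∀ t ∈ Set.Icc (0 : ℝ) 1,
      z₀ + t • w ∈ U ∧ (Z w t).1 ∈ V := fun w hw t ht =>
    ⟨(h𝒦Ω (hK𝒦 (hmem w hw t ht))).1, (h𝒦Ω (hK𝒦 (hmem w hw t ht))).2.1⟩
  -- `jetField_integrable` applies at isometric jets only, so this has to precede `hfd`.
  have hisoray : ∀ w ∈ Metric.ball (0 : E) ε, ∀ t ∈ Set.Icc (0 : ℝ) 1, ∀ v x,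
      g (Z w t).1 ((Z w t).2 v) ((Z w t).2 x) = gt (z₀ + t • w) v x := fun w hw t ht1 =>
    isometric_along_ray h ht (fun t ht => (hmemΩ w hw t ht).1) (fun t ht => (hmemΩ w hw t ht).2)
      (hZ w hw).2.1 (by rw [(hZ w hw).1]; exact hP) ht1
  have hfd : ∀ w ∈ Metric.ball (0 : E) ε,
      HasFDerivAt (fun w => Z w 1) (jetField Γt Γ (z₀ + w, Z w 1)) w := fun w hw =>
    hasFDerivAt_of_radial_solutions hKc hKconv (isOpen_jetDomain h ht) (hK𝒦.trans h𝒦Ω)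
      (contDiffOn_jetField h ht) (fun w hw => (hZ w hw).1) (fun w hw => (hZ w hw).2.1) hmem hw
      (fun t ht1 η => jetField_integrable h ht (hmemΩ w hw t ht1).1 (hmemΩ w hw t ht1).2
        (hk _ (hmemΩ w hw t ht1).2) (hkt _ (hmemΩ w hw t ht1).1) (hisoray w hw t ht1) w η)
  have hsub : ∀ z ∈ Metric.ball z₀ ε, z - z₀ ∈ Metric.ball (0 : E) ε := fun z hz => by
    rw [mem_ball_zero_iff, ← dist_eq_norm]; exact hz
  have hone : (1 : ℝ) ∈ Set.Icc (0 : ℝ) 1 := by simp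
  set Y : E → E × (E →L[ℝ] E) := fun z => Z (z - z₀) 1 with hY
  have hYd : ∀ z ∈ Metric.ball z₀ ε, HasFDerivAt Y (jetField Γt Γ (z, Y z)) z := fun z hz => by
    have e := (hfd _ (hsub z hz)).comp z ((hasFDerivAt_id z).sub_const z₀)
    rw [add_sub_cancel] at e
    exact e
  have hYU : Metric.ball z₀ ε ⊆ U := fun z hz => by
    simpa using (hmemΩ _ (hsub z hz) 1 hone).1
  have hYV : ∀ z ∈ Metric.ball z₀ ε, (Y z).1 ∈ V := fun z hz => (hmemΩ _ (hsub z hz) 1 hone).2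
  have hYiso : ∀ z ∈ Metric.ball z₀ ε, ∀ v x, g (Y z).1 ((Y z).2 v) ((Y z).2 x) = gt z v x :=
    fun z hz v x => by simpa using hisoray _ (hsub z hz) 1 hone v x
  obtain ⟨hfY, hf3⟩ := contDiffOn_of_jet h ht Metric.isOpen_ball hYU hYV hYd
  have hYz₀ : Y z₀ = Y₀ := by
    have h0 : (0 : E) ∈ Metric.ball (0 : E) ε := Metric.mem_ball_self hε0
    have e := norm_le_of_norm_deriv_le (f := fun t => Z 0 t - Y₀) (f' := fun _ => 0) (K := 1)
      one_pos le_rfl (fun t ht => by simpa using ((hZ 0 h0).2.1 t ht).sub_const Y₀)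
      (by simp [(hZ 0 h0).1]) (by simp) hone
    rw [mul_zero] at e
    simpa [hY] using sub_eq_zero.1 (norm_le_zero_iff.1 e)
  refine ⟨fun z => (Y z).1, congrArg Prod.fst hYz₀, ?_, fun z hz => ⟨hYU hz, hYV z hz,
    hf3.contDiffAt (Metric.isOpen_ball.mem_nhds hz), ?_⟩⟩
  · rw [(hfY z₀ (Metric.mem_ball_self hε0)).fderiv, hYz₀]
  · filter_upwards [Metric.isOpen_ball.mem_nhds hz] with x hx v w
    rw [(hfY x hx).fderiv, hYiso x hx]

end Development

/-! ### Christoffel symbols and curvature in coordinates. -/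

section Coordinates

/-- The connection with the Christoffel symbols of the matrix-valued function `G`. -/
def connOf (G : Plane → Matrix (Fin 2) (Fin 2) ℝ) (y : Plane) : Plane →L[ℝ] Plane →L[ℝ] Plane :=
  ∑ k, ∑ i, ∑ j, christoffel G k i j y • (EuclideanSpace.proj i : Plane →L[ℝ] ℝ).smulRight
    ((EuclideanSpace.proj j : Plane →L[ℝ] ℝ).smulRight (coordVec k))

theorem connOf_apply (G : Plane → Matrix (Fin 2) (Fin 2) ℝ) (y u v : Plane) (k : Fin 2) :
    connOf G y u v k = ∑ i, ∑ j, christoffel G k i j y * u i * v j := by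
  fin_cases k <;> simp [connOf, coordVec, Fin.sum_univ_two] <;> ring

theorem coordVec_apply (i j : Fin 2) : coordVec i j = if j = i then 1 else 0 := by
  simp [coordVec, PiLp.single_apply]

theorem connOf_coordVec (G : Plane → Matrix (Fin 2) (Fin 2) ℝ) (y : Plane) (i j k : Fin 2) :
    connOf G y (coordVec i) (coordVec j) k = christoffel G k i j y := by
  rw [connOf_apply]
  simp [coordVec_apply]

variable {g : Plane → Plane →L[ℝ] Plane →L[ℝ] ℝ} {G : Plane → Matrix (Fin 2) (Fin 2) ℝ}
  {V : Set Plane}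

theorem det_pos_of_form (hG : ∀ y i j, G y i j = g y (coordVec i) (coordVec j))
    (hsymm : ∀ y ∈ V, ∀ v w, g y v w = g y w v) (hpos : ∀ y ∈ V, ∀ v, v ≠ 0 → 0 < g y v v)
    {y : Plane} (hy : y ∈ V) : 0 < (G y).det := by
  have hne : ∀ i, coordVec i ≠ 0 := fun i hi => by
    have := congrArg norm hi
    simp at this
  have h0 := hpos y hy _ (hne 0)
  -- This vector is orthogonal to e₀ and has square length g₀₀ det G.
  have hw : g y (coordVec 0) (coordVec 0) • coordVec 1
      - g y (coordVec 0) (coordVec 1) • coordVec 0 ≠ 0 := by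
    intro h
    have := congrArg (fun v : Plane => v 1) h
    simp [coordVec_apply] at this
    exact h0.ne' this
  have h1 := hpos y hy _ hw
  simp only [map_sub, map_smul, sub_apply, smul_apply, smul_eq_mul,
    hsymm y hy (coordVec 1) (coordVec 0)] at h1
  rw [Matrix.det_fin_two, hG, hG, hG, hG, hsymm y hy (coordVec 1) (coordVec 0)]
  have : 0 < g y (coordVec 0) (coordVec 0) * (g y (coordVec 0) (coordVec 0) *
    g y (coordVec 1) (coordVec 1) - g y (coordVec 0) (coordVec 1) * g y (coordVec 0) (coordVec 1)) := by
    linarith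
  exact (mul_pos_iff_of_pos_left h0).1 this

theorem contDiffOn_christoffel (hV : IsOpen V) (hg : ∀ i j, ContDiffOn ℝ 2 (fun y => G y i j) V)
    (hdet : ∀ y ∈ V, (G y).det ≠ 0) (k i j : Fin 2) :
    ContDiffOn ℝ 1 (christoffel G k i j) V := by
  have hp : ∀ i j l, ContDiffOn ℝ 1 (fun y => partialDeriv i (fun z => G z j l) y) V :=
    fun i j l => ((hg j l).fderiv_of_isOpen hV (by norm_num)).clm_apply contDiffOn_const
  have hg1 : ∀ i j, ContDiffOn ℝ 1 (fun y => G y i j) V := fun i j => (hg i j).of_le (by norm_num)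
  have hd : ContDiffOn ℝ 1 (fun y => ((G y).det)⁻¹) V := by
    refine ContDiffOn.inv ?_ hdet
    simp only [Matrix.det_fin_two]
    exact ((hg1 0 0).mul (hg1 1 1)).sub ((hg1 0 1).mul (hg1 1 0))
  have hinv : ∀ k l, ContDiffOn ℝ 1 (fun y => (G y)⁻¹ k l) V := by
    intro k l
    simp only [Matrix.inv_def, Ring.inverse_eq_inv', Matrix.adjugate_fin_two, Matrix.smul_apply,
      smul_eq_mul]
    refine hd.mul ?_
    fin_cases k <;> fin_cases l
    · exact hg1 1 1
    · exact (hg1 0 1).neg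
    · exact (hg1 1 0).neg
    · exact hg1 0 0
  unfold christoffel
  refine contDiffOn_const.mul (ContDiffOn.sum fun l _ => (hinv k l).mul ?_)
  exact ((hp _ _ _).add (hp _ _ _)).sub (hp _ _ _)

theorem isLeviCivita_connOf (hV : IsOpen V) (hg : ContDiffOn ℝ 2 g V)
    (hG : ∀ y i j, G y i j = g y (coordVec i) (coordVec j))
    (hsymm : ∀ y ∈ V, ∀ v w, g y v w = g y w v) (hpos : ∀ y ∈ V, ∀ v, v ≠ 0 → 0 < g y v v) :
    IsLeviCivita g (connOf G) V := by
  have hGc : ∀ i j, ContDiffOn ℝ 2 (fun y => G y i j) V := fun i j => by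
    simp only [hG]
    exact (hg.clm_apply contDiffOn_const).clm_apply contDiffOn_const
  have hdet : ∀ y ∈ V, (G y).det ≠ 0 := fun y hy => (det_pos_of_form hG hsymm hpos hy).ne'
  have hGs : ∀ y ∈ V, ∀ i j, G y i j = G y j i := fun y hy i j => by rw [hG, hG, hsymm y hy]
  have hpd : ∀ y ∈ V, ∀ i j l, partialDeriv i (fun z => G z j l) y
      = fderiv ℝ g y (coordVec i) (coordVec j) (coordVec l) := by
    intro y hy i j l
    have hd : HasFDerivAt g (fderiv ℝ g y) y :=
      ((hg.contDiffAt (hV.mem_nhds hy)).differentiableAt (by norm_num)).hasFDerivAt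
    simp only [partialDeriv, hG]
    rw [((hd.clm_apply (hasFDerivAt_const _ y)).clm_apply (hasFDerivAt_const _ y)).fderiv]
    simp
  have hdsymm : ∀ y ∈ V, ∀ u v w, fderiv ℝ g y u v w = fderiv ℝ g y u w v := by
    intro y hy u v w
    have hd : HasFDerivAt g (fderiv ℝ g y) y :=
      ((hg.contDiffAt (hV.mem_nhds hy)).differentiableAt (by norm_num)).hasFDerivAt
    have e1 := (hd.clm_apply (hasFDerivAt_const v y)).clm_apply (hasFDerivAt_const w y)
    have e2 := (hd.clm_apply (hasFDerivAt_const w y)).clm_apply (hasFDerivAt_const v y)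
    have := DFunLike.congr_fun (e1.unique (e2.congr_of_eventuallyEq (by
      filter_upwards [hV.mem_nhds hy] with x hx using hsymm x hx v w))) u
    simpa using this
  have htor : ∀ y ∈ V, ∀ k i j, christoffel G k i j y = christoffel G k j i y := by
    intro y hy k i j
    simp only [christoffel, hpd y hy]
    congr 1
    refine Finset.sum_congr rfl fun l _ => ?_
    rw [hdsymm y hy (coordVec l) (coordVec i) (coordVec j)]
    ring
  -- Lowering the index cancels the inverse matrix and leaves the Koszul formula. Compatibility is
  -- the sum of two instances of it.
  have hlower : ∀ y ∈ V, ∀ i j m, g y (connOf G y (coordVec i) (coordVec j)) (coordVec m) =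
      1 / 2 * (fderiv ℝ g y (coordVec i) (coordVec j) (coordVec m)
        + fderiv ℝ g y (coordVec j) (coordVec i) (coordVec m)
        - fderiv ℝ g y (coordVec m) (coordVec i) (coordVec j)) := by
    intro y hy i j m
    have hone := Matrix.mul_nonsing_inv (G y) (Ne.isUnit (hdet y hy))
    have e : ∀ l, G y m 0 * (G y)⁻¹ 0 l + G y m 1 * (G y)⁻¹ 1 l = if m = l then 1 else 0 := by
      intro l
      have := congrFun (congrFun hone m) l
      rwa [Matrix.mul_apply, Fin.sum_univ_two, Matrix.one_apply] at this
    rw [plane_eq (connOf G y (coordVec i) (coordVec j))]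
    simp only [connOf_coordVec, map_add, map_smul, add_apply, smul_apply, smul_eq_mul, ← hG,
      christoffel, hpd y hy, Fin.sum_univ_two]
    rw [hGs y hy 0 m, hGs y hy 1 m]
    have e0 := e 0
    have e1 := e 1
    set A := fderiv ℝ g y (coordVec i) (coordVec j)
    set B := fderiv ℝ g y (coordVec j) (coordVec i)
    have hm : ∀ φ : Fin 2 → ℝ, (if m = 0 then 1 else 0) * φ 0 + (if m = 1 then 1 else 0) * φ 1
        = φ m := by
      intro φ; fin_cases m <;> simp
    rw [← hm fun m => 1 / 2 * (A (coordVec m) + B (coordVec m)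
      - fderiv ℝ g y (coordVec m) (coordVec i) (coordVec j)), ← e0, ← e1]
    ring
  have hcb : ∀ y ∈ V, ∀ i j l, fderiv ℝ g y (coordVec i) (coordVec j) (coordVec l) =
      g y (connOf G y (coordVec i) (coordVec j)) (coordVec l)
        + g y (coordVec j) (connOf G y (coordVec i) (coordVec l)) := by
    intro y hy i j l
    rw [hsymm y hy (coordVec j), hlower y hy, hlower y hy,
      hdsymm y hy (coordVec i) (coordVec l) (coordVec j),
      hdsymm y hy (coordVec j) (coordVec i) (coordVec l)]
    ring
  refine ⟨hV, hg, ?_, hsymm, hpos, ?_, ?_⟩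
  · unfold connOf
    refine ContDiffOn.sum fun k _ => ContDiffOn.sum fun i _ => ContDiffOn.sum fun j _ => ?_
    exact (contDiffOn_christoffel hV hGc hdet k i j).smul contDiffOn_const
  · intro y hy v w
    ext k
    rw [connOf_apply, connOf_apply]
    simp only [Fin.sum_univ_two, htor y hy k 0 1]
    ring
  · intro y hy u v w
    rw [plane_eq u, plane_eq v, plane_eq w]
    simp only [map_add, map_smul, add_apply, smul_apply, smul_eq_mul, hcb y hy]
    ring

/-- The bridge from the index formula for the curvature to the invariant `HasCurv`, which can be
transported by isometries. By `hasCurv_of_component` one component suffices. -/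
theorem hasCurv_localGaussCurvature (hV : IsOpen V) (hg : ContDiffOn ℝ 2 g V)
    (hG : ∀ y i j, G y i j = g y (coordVec i) (coordVec j))
    (hsymm : ∀ y ∈ V, ∀ v w, g y v w = g y w v) (hpos : ∀ y ∈ V, ∀ v, v ≠ 0 → 0 < g y v v)
    {y : Plane} (hy : y ∈ V) : HasCurv g (connOf G) y (localGaussCurvature G y) := by
  have hLC := isLeviCivita_connOf hV hg hG hsymm hpos
  have hdet := det_pos_of_form hG hsymm hpos hy
  refine hasCurv_of_component hLC hy ?_
  have hder : ∀ i j k l, (fderiv ℝ (connOf G) y (coordVec i) (coordVec j) (coordVec k)) l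
      = partialDeriv i (christoffel G l j k) y := by
    intro i j k l
    have e1 := ((hLC.hasFDerivAt_conn hy).clm_apply (hasFDerivAt_const (coordVec j) y)).clm_apply
      (hasFDerivAt_const (coordVec k) y)
    have e2 := ((EuclideanSpace.proj l : Plane →L[ℝ] ℝ).hasFDerivAt).comp y e1
    have e3 : (EuclideanSpace.proj l : Plane →L[ℝ] ℝ) ∘
        (fun x => connOf G x (coordVec j) (coordVec k)) = christoffel G l j k := by
      ext x
      exact connOf_coordVec G x j k l
    rw [e3] at e2
    rw [partialDeriv, e2.fderiv]
    simp
  have hR : ∀ l, curvOp (connOf G) y (coordVec 0) (coordVec 1) (coordVec 1) l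
      = riemannTensor G l 0 1 1 y := by
    intro l
    simp only [curvOp, PiLp.add_apply, PiLp.sub_apply, hder, riemannTensor]
    rw [connOf_apply, connOf_apply]
    simp only [connOf_coordVec, Fin.sum_univ_two, coordVec_apply]
    simp
    ring
  rw [plane_eq (curvOp (connOf G) y (coordVec 0) (coordVec 1) (coordVec 1))]
  simp only [hR, map_add, map_smul, add_apply, smul_apply, smul_eq_mul, ← hG]
  have h1 : G y 0 0 * G y 1 1 - G y 0 1 ^ 2 = (G y).det := by
    rw [Matrix.det_fin_two, show G y 1 0 = G y 0 1 by rw [hG, hG, hsymm y hy]]; ring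
  rw [h1, localGaussCurvature, div_mul_cancel₀ _ hdet.ne', Fin.sum_univ_two]

end Coordinates

/-! ### The metric of the surface in its charts. -/

section Charts

variable {M : Type*} [TopologicalSpace M] [ChartedSpace Plane M]

/-- The transition map between the preferred charts at `q` and `q'`. -/
def transition (q q' : M) : Plane → Plane := (chartAt Plane q') ∘ (chartAt Plane q).symm

theorem eventually_mem_overlap {q q' : M} {y : Plane} (hy : y ∈ (chartAt Plane q).target)
    (hy' : (chartAt Plane q).symm y ∈ (chartAt Plane q').source) :
    ∀ᶠ z in 𝓝 y, z ∈ (chartAt Plane q).target ∧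
      (chartAt Plane q).symm z ∈ (chartAt Plane q').source := by
  filter_upwards [(chartAt Plane q).open_target.mem_nhds hy,
    ((chartAt Plane q).symm.continuousAt hy).preimage_mem_nhds
      ((chartAt Plane q').open_source.mem_nhds hy')] with z h1 h2 using ⟨h1, h2⟩

variable [IsManifold (𝓡 2) ∞ M]

/-- The metric `g` in the preferred chart at `q`. -/
def chartForm (g : C2Metric M) (q : M) (y : Plane) : Plane →L[ℝ] Plane →L[ℝ] ℝ :=
  let D : Plane →L[ℝ] Plane := mfderiv (𝓡 2) (𝓡 2) (chartAt Plane q).symm y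
  let B : Plane →L[ℝ] Plane →L[ℝ] ℝ := g.inner ((chartAt Plane q).symm y)
  B.bilinearComp D D

theorem metricCoeff_chartAt (g : C2Metric M) (q : M) (y : Plane) (i j : Fin 2) :
    metricCoeff g (chartAt Plane q) y i j = chartForm g q y (coordVec i) (coordVec j) := rfl

theorem chartForm_symm (g : C2Metric M) (q : M) (y v w : Plane) :
    chartForm g q y v w = chartForm g q y w v := g.symm _ _ _

theorem contMDiffAt_chart_symm (q : M) {y : Plane} (hy : y ∈ (chartAt Plane q).target) :
    ContMDiffAt (𝓡 2) (𝓡 2) ∞ (chartAt Plane q).symm y :=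
  (contMDiffOn_chart_symm (x := q)).contMDiffAt ((chartAt Plane q).open_target.mem_nhds hy)

theorem contMDiffAt_chart {q x : M} (hx : x ∈ (chartAt Plane q).source) :
    ContMDiffAt (𝓡 2) (𝓡 2) ∞ (chartAt Plane q) x :=
  (contMDiffOn_chart (x := q)).contMDiffAt ((chartAt Plane q).open_source.mem_nhds hx)

theorem mfderiv_chart_comp_symm (q : M) {y : Plane} (hy : y ∈ (chartAt Plane q).target)
    (v : Plane) : (mfderiv (𝓡 2) (𝓡 2) (chartAt Plane q) ((chartAt Plane q).symm y)
      (mfderiv (𝓡 2) (𝓡 2) (chartAt Plane q).symm y v) : Plane) = v := by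
  have h1 := (contMDiffAt_chart_symm q hy).mdifferentiableAt (by simp)
  have h2 := (contMDiffAt_chart ((chartAt Plane q).map_target hy)).mdifferentiableAt (by simp)
  have h3 := mfderiv_comp_apply y h2 h1 v
  have h4 : (chartAt Plane q) ∘ (chartAt Plane q).symm =ᶠ[𝓝 y] id := by
    filter_upwards [(chartAt Plane q).open_target.mem_nhds hy] with z hz
    exact (chartAt Plane q).right_inv hz
  rw [h4.mfderiv_eq, mfderiv_id] at h3
  exact h3.symm

theorem mfderiv_chart_symm_comp (q : M) {x : M} (hx : x ∈ (chartAt Plane q).source)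
    (v : TangentSpace (𝓡 2) x) : (mfderiv (𝓡 2) (𝓡 2) (chartAt Plane q).symm
      (chartAt Plane q x) (mfderiv (𝓡 2) (𝓡 2) (chartAt Plane q) x v) : Plane) = v := by
  have h1 := (contMDiffAt_chart_symm q ((chartAt Plane q).map_source hx)).mdifferentiableAt
    (by simp)
  have h2 := (contMDiffAt_chart hx).mdifferentiableAt (by simp)
  have h3 := mfderiv_comp_apply x h1 h2 v
  have h4 : (chartAt Plane q).symm ∘ (chartAt Plane q) =ᶠ[𝓝 x] id := by
    filter_upwards [(chartAt Plane q).open_source.mem_nhds hx] with z hz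
    exact (chartAt Plane q).left_inv hz
  rw [h4.mfderiv_eq, mfderiv_id] at h3
  exact h3.symm

theorem chartForm_pos (g : C2Metric M) (q : M) {y : Plane} (hy : y ∈ (chartAt Plane q).target)
    {v : Plane} (hv : v ≠ 0) : 0 < chartForm g q y v v := by
  refine g.pos _ _ fun h => hv ?_
  rw [← mfderiv_chart_comp_symm q hy v]
  exact (congrArg (mfderiv (𝓡 2) (𝓡 2) (chartAt Plane q) ((chartAt Plane q).symm y)) h).trans
    (map_zero _)

/-- The coordinate fields of a smooth chart are C² sections of the tangent bundle, and a C² metric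
evaluated on them is C². -/
theorem contDiffOn_chartForm (g : C2Metric M) (q : M) :
    ContDiffOn ℝ 2 (chartForm g q) (chartAt Plane q).target := by
  rw [contDiffOn_clm_apply]; intro v
  rw [contDiffOn_clm_apply]; intro w
  have hsec : ∀ v : Plane, ContMDiffOn (𝓡 2) (𝓡 2).tangent 2
      (fun y : Plane => (⟨(chartAt Plane q).symm y, mfderiv (𝓡 2) (𝓡 2) (chartAt Plane q).symm y v⟩ :
        TangentBundle (𝓡 2) M)) (chartAt Plane q).target := by
    intro v
    have h1 := (contMDiffOn_chart_symm (x := q) (n := ∞) (I := 𝓡 2)).contMDiffOn_tangentMapWithin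
      (m := 2) (by norm_cast) (chartAt Plane q).open_target.uniqueMDiffOn
    have h2 : ContMDiff (𝓡 2) (𝓡 2).tangent 2
        (fun y : Plane => (⟨y, v⟩ : TangentBundle (𝓡 2) Plane)) := by
      exact contMDiff_vectorSpace_iff_contDiff.2 contDiff_const
    refine (h1.comp h2.contMDiffOn (fun y hy => hy)).congr fun y hy => ?_
    simp only [Function.comp, tangentMapWithin]
    rw [mfderivWithin_of_isOpen (chartAt Plane q).open_target hy]
  have hg : ContMDiffOn (𝓡 2) ((𝓡 2).prod 𝓘(ℝ, Plane →L[ℝ] Plane →L[ℝ] ℝ)) 2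
      (fun y : Plane => Bundle.TotalSpace.mk' (Plane →L[ℝ] Plane →L[ℝ] ℝ)
        (E := fun x : M => TangentSpace (𝓡 2) x →L[ℝ] TangentSpace (𝓡 2) x →L[ℝ] ℝ)
        ((chartAt Plane q).symm y) (g.inner ((chartAt Plane q).symm y)))
      (chartAt Plane q).target :=
    g.contMDiff.comp_contMDiffOn ((contMDiffOn_chart_symm (x := q) (n := ∞)).of_le (by norm_cast))
  have h : ContMDiffOn (𝓡 2) ((𝓡 2).prod 𝓘(ℝ, ℝ)) 2
      (fun y : Plane => Bundle.TotalSpace.mk' ℝ (E := Bundle.Trivial M ℝ)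
        ((chartAt Plane q).symm y) (chartForm g q y v w)) (chartAt Plane q).target := by
    exact ContMDiffOn.clm_bundle_apply₂ (F₁ := Plane) (F₂ := Plane) (F₃ := ℝ)
      (E₃ := Bundle.Trivial M ℝ) hg (hsec v) (hsec w)
  intro y hy
  have := h y hy
  simp only [Bundle.contMDiffWithinAt_totalSpace] at this
  exact this.2.contDiffWithinAt

/-- The connection of the metric `g` in the preferred chart at `q`. -/
def chartConn (g : C2Metric M) (q : M) : Plane → Plane →L[ℝ] Plane →L[ℝ] Plane :=
  connOf (metricCoeff g (chartAt Plane q))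

theorem isLeviCivita_chart (g : C2Metric M) (q : M) :
    IsLeviCivita (chartForm g q) (chartConn g q) (chartAt Plane q).target :=
  isLeviCivita_connOf (chartAt Plane q).open_target (contDiffOn_chartForm g q)
    (metricCoeff_chartAt g q) (fun y _ => chartForm_symm g q y) fun _ hy _ hv =>
      chartForm_pos g q hy hv

theorem contDiffAt_transition {q q' : M} {y : Plane} (hy : y ∈ (chartAt Plane q).target)
    (hy' : (chartAt Plane q).symm y ∈ (chartAt Plane q').source) :
    ContDiffAt ℝ ∞ (transition q q') y :=
  ((contMDiffAt_chart hy').comp y (contMDiffAt_chart_symm q hy)).contDiffAt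

theorem isIsometryNear_transition (g : C2Metric M) {q q' : M} {y : Plane}
    (hy : y ∈ (chartAt Plane q).target)
    (hy' : (chartAt Plane q).symm y ∈ (chartAt Plane q').source) :
    IsIsometryNear (chartForm g q) (chartForm g q') (transition q q') y := by
  filter_upwards [eventually_mem_overlap hy hy'] with z hz v w
  have hτ : MDifferentiableAt (𝓡 2) (𝓡 2) (transition q q') z :=
    ((contDiffAt_transition hz.1 hz.2).differentiableAt (by simp)).mdifferentiableAt
  have hzt : transition q q' z ∈ (chartAt Plane q').target := (chartAt Plane q').map_source hz.2
  have hs := (contMDiffAt_chart_symm q' hzt).mdifferentiableAt (by simp)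
  have heq : (chartAt Plane q').symm ∘ transition q q' =ᶠ[𝓝 z] (chartAt Plane q).symm := by
    filter_upwards [eventually_mem_overlap hz.1 hz.2] with x hx
    exact (chartAt Plane q').left_inv hx.2
  have hd : ∀ v : Plane, (mfderiv (𝓡 2) (𝓡 2) (chartAt Plane q).symm z v : Plane)
      = mfderiv (𝓡 2) (𝓡 2) (chartAt Plane q').symm (transition q q' z)
        (fderiv ℝ (transition q q') z v) := by
    intro v
    have h1 := mfderiv_comp_apply z hs hτ v
    rw [heq.mfderiv_eq, mfderiv_eq_fderiv] at h1
    exact h1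
  have hpt : (chartAt Plane q').symm (transition q q' z) = (chartAt Plane q).symm z :=
    heq.self_of_nhds
  -- The two sides live over base points that are only propositionally equal, so the equality is
  -- transported with vectors read in the model plane.
  have aux : ∀ x x' : M, x' = x → ∀ a b a' b' : Plane, a' = a → b' = b →
      g.inner x' (a' : Plane) (b' : Plane) = g.inner x (a : Plane) (b : Plane) := by
    rintro x _ rfl a b _ _ rfl rfl; rfl
  exact aux _ _ hpt _ _ _ _ (hd v).symm (hd w).symm

/-- The curvature of `g` in an arbitrary preferred chart. -/
theorem hasCurv_chart (g : C2Metric M) (q : M) {y : Plane} (hy : y ∈ (chartAt Plane q).target) :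
    HasCurv (chartForm g q) (chartConn g q) y (gaussCurvature g ((chartAt Plane q).symm y)) := by
  set x := (chartAt Plane q).symm y with hx
  have hxs : x ∈ (chartAt Plane x).source := mem_chart_source _ _
  -- `gaussCurvature` at `x` is defined in the preferred chart at `x` itself; the transition
  -- isometry carries it to the chart at `q`.
  have hc : HasCurv (chartForm g x) (chartConn g x) (transition q x y) (gaussCurvature g x) :=
    hasCurv_localGaussCurvature (chartAt Plane x).open_target (contDiffOn_chartForm g x)
      (metricCoeff_chartAt g x) (fun y _ => chartForm_symm g x y)
      (fun _ hy _ hv => chartForm_pos g x hy hv) ((chartAt Plane x).map_source hxs)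
  exact hc.of_isometry (isLeviCivita_chart g x) (isLeviCivita_chart g q) hy
    ((chartAt Plane x).map_source hxs) ((contDiffAt_transition hy hxs).of_le (by norm_cast))
    (isIsometryNear_transition g hy hxs)

theorem chartForm_conformal (g : C2Metric M) (u : M → ℝ) (hu : ContMDiff (𝓡 2) 𝓘(ℝ) 2 u) (q : M)
    (y v w : Plane) : chartForm (conformal g u hu) q y v w
      = Real.exp (-2 * u ((chartAt Plane q).symm y)) * chartForm g q y v w := rfl

end Charts

/-! ### Local isometries from the Poincaré disc and their continuation. -/

section Developments

variable {M : Type*} [TopologicalSpace M] [ChartedSpace Plane M] [IsManifold (𝓡 2) ∞ M]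

/-- Near `z`, the map `F` is in the preferred chart at `q` a `C^3` isometry from the Poincaré disc
of curvature `κ` to `(M, g)`. -/
def IsChartDev (g : C2Metric M) (κ : ℝ) (q : M) (F : Plane → M) (z : Plane) : Prop :=
  ContDiffAt ℝ 3 (chartAt Plane q ∘ F) z ∧
    IsIsometryNear (confForm (discExp κ)) (chartForm g q) (chartAt Plane q ∘ F) z

/-- The map `F` is near `z` a local isometry from the Poincaré disc of curvature `κ` to
`(M, g)`. -/
def IsDevAt (g : C2Metric M) (κ : ℝ) (F : Plane → M) (z : Plane) : Prop :=
  ContinuousAt F z ∧ IsChartDev g κ (F z) F z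

variable {g : C2Metric M} {κ : ℝ}

/-- Transition maps are smooth isometries, so the notion does not depend on the chart around `F z`.
-/
theorem IsChartDev.change {q q' : M} {F : Plane → M} {z : Plane} (h : IsChartDev g κ q F z)
    (hF : ContinuousAt F z) (hq : F z ∈ (chartAt Plane q).source)
    (hq' : F z ∈ (chartAt Plane q').source) : IsChartDev g κ q' F z := by
  have heq : chartAt Plane q' ∘ F =ᶠ[𝓝 z] transition q q' ∘ (chartAt Plane q ∘ F) := by
    filter_upwards [hF.preimage_mem_nhds ((chartAt Plane q).open_source.mem_nhds hq)] with x hx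
    simp only [transition, Function.comp]
    rw [(chartAt Plane q).left_inv hx]
  have hz : chartAt Plane q (F z) ∈ (chartAt Plane q).target := (chartAt Plane q).map_source hq
  have hz' : (chartAt Plane q).symm (chartAt Plane q (F z)) ∈ (chartAt Plane q').source := by
    rwa [(chartAt Plane q).left_inv hq]
  have hτ := contDiffAt_transition hz hz'
  refine ⟨((hτ.of_le (by norm_cast)).comp z h.1 : ContDiffAt ℝ 3 _ z).congr_of_eventuallyEq heq, ?_⟩
  refine IsIsometryNear.congr ((isIsometryNear_transition g hz hz').comp h.2 ?_ ?_) heq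
  · filter_upwards [eventually_mem_overlap hz hz'] with y hy
    exact (contDiffAt_transition hy.1 hy.2).differentiableAt (by simp)
  · filter_upwards [h.1.eventually (by simp)] with y hy using hy.differentiableAt (by norm_num)

theorem IsDevAt.chartDev {F : Plane → M} {z : Plane} (h : IsDevAt g κ F z) {q : M}
    (hq : F z ∈ (chartAt Plane q).source) : IsChartDev g κ q F z :=
  h.2.change h.1 (mem_chart_source _ _) hq

theorem IsChartDev.isDevAt {q : M} {F : Plane → M} {z : Plane} (h : IsChartDev g κ q F z)
    (hF : ContinuousAt F z) (hq : F z ∈ (chartAt Plane q).source) : IsDevAt g κ F z :=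
  ⟨hF, h.change hF hq (mem_chart_source _ _)⟩

theorem IsDevAt.congr {F F' : Plane → M} {z : Plane} (h : IsDevAt g κ F z) (hF : F' =ᶠ[𝓝 z] F) :
    IsDevAt g κ F' z := by
  have hc : ContinuousAt F' z := h.1.congr hF.symm
  have hz : F' z ∈ (chartAt Plane (F z)).source := by
    rw [hF.eq_of_nhds]; exact mem_chart_source _ _
  have heq : chartAt Plane (F z) ∘ F' =ᶠ[𝓝 z] chartAt Plane (F z) ∘ F := hF.fun_comp _
  exact IsChartDev.isDevAt ⟨h.2.1.congr_of_eventuallyEq heq, h.2.2.congr heq⟩ hc hz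

theorem isLeviCivita_disc (κ : ℝ) :
    IsLeviCivita (confForm (discExp κ)) (confConn (discExp κ)) (Metric.ball 0 1) :=
  isLeviCivita_conf Metric.isOpen_ball (contDiffOn_discExp κ 2)

/-- Two developments that agree near one point agree near every point. -/
theorem eventuallyEq_of_isDevAt [T2Space M] {F₁ F₂ : Plane → M} {O : Set Plane}
    (hO : IsPreconnected O) (hO1 : O ⊆ Metric.ball 0 1) (h₁ : ∀ z ∈ O, IsDevAt g κ F₁ z)
    (h₂ : ∀ z ∈ O, IsDevAt g κ F₂ z) {z₀ : Plane} (hz₀ : z₀ ∈ O) (heq : F₁ =ᶠ[𝓝 z₀] F₂)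
    {z : Plane} (hz : z ∈ O) : F₁ =ᶠ[𝓝 z] F₂ := by
  -- `S` is open by definition. It is closed in `O`, since values and differentials agree at limit
  -- points by continuity, and a 1-jet determines the isometry.
  set S : Set Plane := {z | F₁ =ᶠ[𝓝 z] F₂} with hS
  have hSo : IsOpen S := isOpen_iff_mem_nhds.2 fun x hx => hx.eventuallyEq_nhds
  refine hO.subset_of_closure_inter_subset hSo ⟨z₀, hz₀, heq⟩ ?_ hz
  rintro x ⟨hxS, hxO⟩
  have hne : (𝓝[S] x).NeBot := mem_closure_iff_nhdsWithin_neBot.1 hxS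
  have hSmem : ∀ᶠ y in 𝓝[S] x, y ∈ S := self_mem_nhdsWithin
  have hx12 : F₁ x = F₂ x := by
    have t₁ : Tendsto F₁ (𝓝[S] x) (𝓝 (F₁ x)) := (h₁ x hxO).1.mono_left nhdsWithin_le_nhds
    have t₂ : Tendsto F₂ (𝓝[S] x) (𝓝 (F₂ x)) := (h₂ x hxO).1.mono_left nhdsWithin_le_nhds
    refine tendsto_nhds_unique t₁ (t₂.congr' ?_)
    filter_upwards [hSmem] with y hy using hy.eq_of_nhds.symm
  set φ := chartAt Plane (F₁ x) with hφ
  have d₁ : IsChartDev g κ (F₁ x) F₁ x := (h₁ x hxO).2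
  have d₂ : IsChartDev g κ (F₁ x) F₂ x := by rw [hx12]; exact (h₂ x hxO).2
  have hfd : fderiv ℝ (φ ∘ F₁) x = fderiv ℝ (φ ∘ F₂) x := by
    have c₁ := (d₁.1.fderiv_right (m := 1) (by norm_num)).continuousAt
    have c₂ := (d₂.1.fderiv_right (m := 1) (by norm_num)).continuousAt
    have t₁ : Tendsto (fderiv ℝ (φ ∘ F₁)) (𝓝[S] x) (𝓝 (fderiv ℝ (φ ∘ F₁) x)) :=
      c₁.mono_left nhdsWithin_le_nhds
    have t₂ : Tendsto (fderiv ℝ (φ ∘ F₂)) (𝓝[S] x) (𝓝 (fderiv ℝ (φ ∘ F₂) x)) :=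
      c₂.mono_left nhdsWithin_le_nhds
    refine tendsto_nhds_unique t₁ (t₂.congr' ?_)
    filter_upwards [hSmem] with y hy
    exact ((hy.fun_comp φ).fderiv_eq).symm
  have hsrc : F₁ x ∈ φ.source := mem_chart_source _ _
  have hff := IsIsometryNear.eventuallyEq (isLeviCivita_chart g (F₁ x)) (isLeviCivita_disc κ)
    (hO1 hxO) (φ.map_source hsrc) (d₁.1.of_le (by norm_num)) (d₂.1.of_le (by norm_num)) d₁.2 d₂.2
    (by simp only [Function.comp, hx12]) hfd
  have hs := φ.open_source.mem_nhds hsrc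
  filter_upwards [hff, (h₁ x hxO).1.preimage_mem_nhds hs,
    (h₂ x hxO).1.preimage_mem_nhds (hx12 ▸ hs)] with y hy hy1 hy2
  exact φ.injOn hy1 hy2 hy

/-- Developments exist near every point with every isometric initial `1`-jet, on balls whose
radius is locally uniform. -/
theorem exists_isDevAt_of_isometric (hκ : κ < 0) (hcurv : ∀ x, gaussCurvature g x = κ) (q : M)
    {Ky : Set Plane} (hKy : IsCompact Ky) (hKyV : Ky ⊆ (chartAt Plane q).target) :
    ∃ ε > 0, ∀ z₀ ∈ Metric.closedBall (0 : Plane) (1 / 2), ∀ y₀ ∈ Ky, ∀ P : Plane →L[ℝ] Plane,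
      (∀ v w, chartForm g q y₀ (P v) (P w) = confForm (discExp κ) z₀ v w) →
      ∃ F : Plane → M, F z₀ = (chartAt Plane q).symm y₀ ∧
        fderiv ℝ (chartAt Plane q ∘ F) z₀ = P ∧ ∀ z ∈ Metric.ball z₀ ε, IsDevAt g κ F z := by
  have hsub : Metric.closedBall (0 : Plane) (1 / 2) ⊆ Metric.ball 0 1 :=
    Metric.closedBall_subset_ball (by norm_num)
  obtain ⟨ε, hε, hex⟩ := exists_isometry (isLeviCivita_chart g q) (isLeviCivita_disc κ) (k := κ)
    (fun y hy => by simpa only [hcurv] using hasCurv_chart g q hy)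
    (fun z hz => hasCurv_disc hκ hz) (isCompact_closedBall (0 : Plane) (1 / 2)) hsub hKy hKyV
  refine ⟨ε, hε, fun z₀ hz₀ y₀ hy₀ P hP => ?_⟩
  obtain ⟨f, hf0, hfP, hf⟩ := hex z₀ hz₀ y₀ hy₀ P hP
  set φ := chartAt Plane q with hφ
  have heq : ∀ z ∈ Metric.ball z₀ ε, φ ∘ (φ.symm ∘ f) =ᶠ[𝓝 z] f := fun z hz => by
    filter_upwards [Metric.isOpen_ball.mem_nhds hz] with x hx
    exact φ.right_inv (hf x hx).2.1
  refine ⟨φ.symm ∘ f, by simp [hf0], ?_, fun z hz => ?_⟩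
  · rw [(heq z₀ (Metric.mem_ball_self hε)).fderiv_eq, hfP]
  · obtain ⟨-, hzV, hz3, hzi⟩ := hf z hz
    refine IsChartDev.isDevAt (q := q) ⟨hz3.congr_of_eventuallyEq (heq z hz),
      hzi.congr (heq z hz)⟩ ?_ (φ.map_target hzV)
    exact (φ.symm.continuousAt hzV).comp hz3.continuousAt

/-- Gram–Schmidt for `B`. It supplies the initial 1-jet of a development. -/
theorem exists_isometric_map {B : Plane →L[ℝ] Plane →L[ℝ] ℝ} (hs : ∀ v w, B v w = B w v)
    (hpos : ∀ v, v ≠ 0 → 0 < B v v) (ρ : Plane → ℝ) (z : Plane) :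
    ∃ P : Plane →L[ℝ] Plane, ∀ v w, B (P v) (P w) = confForm ρ z v w := by
  set e := coordVec 0
  set f := coordVec 1
  have hne : ∀ i, coordVec i ≠ 0 := fun i hi => by
    have := congrArg norm hi
    simp at this
  have ha := hpos e (hne 0)
  set a := B e e with hadef
  set f' := f - (B e f / a) • e with hf'
  have hf'0 : f' ≠ 0 := by
    intro h
    have := congrArg (fun v : Plane => v 1) h
    simp [hf', e, f, coordVec_apply] at this
  have hc := hpos f' hf'0
  set c := B f' f' with hcdef
  have hef : B e f' = 0 := by
    simp only [hf', map_sub, map_smul, smul_eq_mul, ← hadef]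
    field_simp
    ring
  have hfe : B f' e = 0 := by rw [hs, hef]
  set s := Real.exp (ρ z) with hsdef
  have hsa : Real.sqrt a * Real.sqrt a = a := Real.mul_self_sqrt ha.le
  have hsc : Real.sqrt c * Real.sqrt c = c := Real.mul_self_sqrt hc.le
  have hsa0 : Real.sqrt a ≠ 0 := (Real.sqrt_pos.2 ha).ne'
  have hsc0 : Real.sqrt c ≠ 0 := (Real.sqrt_pos.2 hc).ne'
  refine ⟨(EuclideanSpace.proj 0 : Plane →L[ℝ] ℝ).smulRight ((s / Real.sqrt a) • e)
    + (EuclideanSpace.proj 1 : Plane →L[ℝ] ℝ).smulRight ((s / Real.sqrt c) • f'), fun v w => ?_⟩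
  have hss : Real.exp (2 * ρ z) = s * s := by rw [hsdef, ← Real.exp_add]; ring_nf
  rw [confForm_apply, hss, PiLp.inner_apply, Fin.sum_univ_two]
  have hpr : ∀ i (x : Plane), (EuclideanSpace.proj i : Plane →L[ℝ] ℝ) x = x i := fun _ _ => rfl
  simp only [add_apply, ContinuousLinearMap.smulRight_apply, hpr, map_add,
    map_smul, smul_apply, smul_eq_mul, hef, hfe, ← hadef, ← hcdef]
  simp only [RCLike.inner_apply, conj_trivial]
  have h1 : s / Real.sqrt a * (s / Real.sqrt a * a) = s * s := by
    nth_rw 3 [← hsa]; field_simp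
  have h2 : s / Real.sqrt c * (s / Real.sqrt c * c) = s * s := by
    nth_rw 3 [← hsc]; field_simp
  linear_combination (v 0 * w 0) * h1 + (v 1 * w 1) * h2

variable [CompactSpace M]

/-- Every development near a point of the disc of radius `1/2` extends to a ball of uniform
radius. -/
theorem exists_uniform_extension (hκ : κ < 0) (hcurv : ∀ x, gaussCurvature g x = κ) :
    ∃ ε > 0, ∀ z₀ ∈ Metric.closedBall (0 : Plane) (1 / 2), ∀ F : Plane → M, IsDevAt g κ F z₀ →
      ∃ Ψ : Plane → M, Ψ =ᶠ[𝓝 z₀] F ∧ ∀ z ∈ Metric.ball z₀ ε, IsDevAt g κ Ψ z := by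
  have key : ∃ ε > 0, ∀ z₀ ∈ Metric.closedBall (0 : Plane) (1 / 2), ∀ F : Plane → M,
      IsDevAt g κ F z₀ → F z₀ ∈ (Set.univ : Set M) →
      ∃ Ψ : Plane → M, Ψ =ᶠ[𝓝 z₀] F ∧ ∀ z ∈ Metric.ball z₀ ε, IsDevAt g κ Ψ z := by
    -- Having a uniform radius for all values of `F z₀` in `s` passes to subsets and finite unions
    -- and holds near each point, so it holds for the compact surface.
    refine isCompact_univ.induction_on (p := fun s : Set M => ∃ ε > 0,
      ∀ z₀ ∈ Metric.closedBall (0 : Plane) (1 / 2), ∀ F : Plane → M, IsDevAt g κ F z₀ → F z₀ ∈ s →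
      ∃ Ψ : Plane → M, Ψ =ᶠ[𝓝 z₀] F ∧ ∀ z ∈ Metric.ball z₀ ε, IsDevAt g κ Ψ z)
      ⟨1, one_pos, by simp⟩ ?_ ?_ ?_
    · rintro s t hst ⟨ε, hε, h⟩
      exact ⟨ε, hε, fun z₀ hz₀ F hF hs => h z₀ hz₀ F hF (hst hs)⟩
    · rintro s t ⟨ε₁, hε₁, h₁⟩ ⟨ε₂, hε₂, h₂⟩
      refine ⟨min ε₁ ε₂, lt_min hε₁ hε₂, fun z₀ hz₀ F hF hst => ?_⟩
      rcases hst with hs | ht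
      · obtain ⟨Ψ, h, h'⟩ := h₁ z₀ hz₀ F hF hs
        exact ⟨Ψ, h, fun z hz => h' z (Metric.ball_subset_ball (min_le_left _ _) hz)⟩
      · obtain ⟨Ψ, h, h'⟩ := h₂ z₀ hz₀ F hF ht
        exact ⟨Ψ, h, fun z hz => h' z (Metric.ball_subset_ball (min_le_right _ _) hz)⟩
    · intro q _
      set φ := chartAt Plane q with hφ
      have hq : q ∈ φ.source := mem_chart_source _ _
      obtain ⟨r, hr, hrt⟩ := Metric.nhds_basis_closedBall.mem_iff.1
        (φ.open_target.mem_nhds (φ.map_source hq))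
      obtain ⟨ε, hε, hex⟩ := exists_isDevAt_of_isometric hκ hcurv q
        (isCompact_closedBall (φ q) r) hrt
      refine ⟨φ.source ∩ φ ⁻¹' Metric.closedBall (φ q) r, ?_, ε, hε, ?_⟩
      · exact mem_nhdsWithin_of_mem_nhds (inter_mem (φ.open_source.mem_nhds hq)
          ((φ.continuousAt hq).preimage_mem_nhds (Metric.closedBall_mem_nhds _ hr)))
      · rintro z₀ hz₀ F hF ⟨hFs, hFb⟩
        have hd := hF.chartDev hFs
        -- `Ψ` is built with the 1-jet of `F` at `z₀`, which forces it to agree with `F` nearby.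
        obtain ⟨Ψ, hΨ0, hΨP, hΨ⟩ := hex z₀ hz₀ (φ (F z₀)) hFb (fderiv ℝ (φ ∘ F) z₀)
          hd.2.self_of_nhds
        refine ⟨Ψ, ?_, hΨ⟩
        rw [φ.left_inv hFs] at hΨ0
        have hΨz := hΨ z₀ (Metric.mem_ball_self hε)
        have hdΨ := hΨz.chartDev (q := q) (by rw [hΨ0]; exact hFs)
        have hff := IsIsometryNear.eventuallyEq (isLeviCivita_chart g q) (isLeviCivita_disc κ)
          (Metric.closedBall_subset_ball (by norm_num) hz₀)
          (by rw [Function.comp_apply, hΨ0]; exact φ.map_source hFs)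
          (hdΨ.1.of_le (by norm_num)) (hd.1.of_le (by norm_num)) hdΨ.2 hd.2
          (by simp only [Function.comp, hΨ0]) hΨP
        have hs := φ.open_source.mem_nhds hFs
        filter_upwards [hff, hΨz.1.preimage_mem_nhds (hΨ0 ▸ hs),
          hF.1.preimage_mem_nhds hs] with y hy hy1 hy2
        exact φ.injOn hy1 hy2 hy
  obtain ⟨ε, hε, h⟩ := key
  exact ⟨ε, hε, fun z₀ hz₀ F hF => h z₀ hz₀ F hF trivial⟩

/-- A closed surface of constant curvature `κ < 0` is locally isometric to a disc of uniform size
in the Poincaré disc, centred at any given point. -/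
theorem exists_development [T2Space M] (hκ : κ < 0) (hcurv : ∀ x, gaussCurvature g x = κ) (p : M) :
    ∃ F : Plane → M, F 0 = p ∧ ∀ z ∈ Metric.ball (0 : Plane) (1 / 2), IsDevAt g κ F z := by
  obtain ⟨ε₀, hε₀, hext₀⟩ := exists_uniform_extension (g := g) hκ hcurv
  -- The cap 1/2 keeps the `ε`-balls around points of the half disc inside the unit disc.
  set ε := min ε₀ (1 / 2) with hε
  have hε0 : 0 < ε := by positivity
  have hext : ∀ z₀ ∈ Metric.closedBall (0 : Plane) (1 / 2), ∀ F : Plane → M, IsDevAt g κ F z₀ →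
      ∃ Ψ : Plane → M, Ψ =ᶠ[𝓝 z₀] F ∧ ∀ z ∈ Metric.ball z₀ ε, IsDevAt g κ Ψ z := by
    intro z₀ hz₀ F hF
    obtain ⟨Ψ, h, h'⟩ := hext₀ z₀ hz₀ F hF
    exact ⟨Ψ, h, fun z hz => h' z (Metric.ball_subset_ball (min_le_left _ _) hz)⟩
  have hstep : ∀ r : ℝ, 0 < r → r ≤ 1 / 2 →
      (∃ F : Plane → M, F 0 = p ∧ ∀ z ∈ Metric.ball (0 : Plane) r, IsDevAt g κ F z) →
      ∃ F : Plane → M, F 0 = p ∧ ∀ z ∈ Metric.ball (0 : Plane) (r + ε / 2), IsDevAt g κ F z := by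
    rintro r hr hr2 ⟨F, hF0, hF⟩
    have hsub : Metric.ball (0 : Plane) r ⊆ Metric.closedBall 0 (1 / 2) :=
      Metric.ball_subset_closedBall.trans (Metric.closedBall_subset_closedBall hr2)
    have hex : ∀ z : Plane, ∃ Ψ : Plane → M, z ∈ Metric.ball (0 : Plane) r →
        Ψ =ᶠ[𝓝 z] F ∧ ∀ w ∈ Metric.ball z ε, IsDevAt g κ Ψ w := by
      intro z
      by_cases hz : z ∈ Metric.ball (0 : Plane) r
      · obtain ⟨Ψ, h⟩ := hext z (hsub hz) F (hF z hz)
        exact ⟨Ψ, fun _ => h⟩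
      · exact ⟨F, fun h => absurd h hz⟩
    choose Ψ hΨ using hex
    have hball1 : ∀ z ∈ Metric.ball (0 : Plane) r, Metric.ball z ε ⊆ Metric.ball 0 1 := by
      intro z hz w hw
      rw [mem_ball_zero_iff] at hz ⊢
      have h1 : ‖w - z‖ < ε := by simpa [dist_eq_norm] using hw
      have h2 : ε ≤ 1 / 2 := min_le_right _ _
      calc ‖w‖ = ‖(w - z) + z‖ := by rw [sub_add_cancel]
        _ ≤ ‖w - z‖ + ‖z‖ := norm_add_le _ _
        _ < 1 := by linarith
    -- Intersections of two balls are convex, hence connected. First `Ψ z` is identified with `F`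
    -- near `z'`, then with `Ψ z'` on the overlap of their balls.
    have hagree : ∀ z ∈ Metric.ball (0 : Plane) r, ∀ z' ∈ Metric.ball (0 : Plane) r,
        z' ∈ Metric.ball z ε → ∀ w ∈ Metric.ball z ε, w ∈ Metric.ball z' ε → Ψ z' w = Ψ z w := by
      intro z hz z' hz' hzz' w hw hw'
      have e1 : Ψ z =ᶠ[𝓝 z'] F := eventuallyEq_of_isDevAt
        (O := Metric.ball z ε ∩ Metric.ball 0 r)
        ((convex_ball _ _).inter (convex_ball _ _)).isPreconnected
        (Set.inter_subset_left.trans (hball1 z hz)) (fun x hx => (hΨ z hz).2 x hx.1)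
        (fun x hx => hF x hx.2) ⟨Metric.mem_ball_self hε0, hz⟩ (hΨ z hz).1 ⟨hzz', hz'⟩
      exact (eventuallyEq_of_isDevAt (O := Metric.ball z ε ∩ Metric.ball z' ε)
        ((convex_ball _ _).inter (convex_ball _ _)).isPreconnected
        (Set.inter_subset_left.trans (hball1 z hz)) (fun x hx => (hΨ z' hz').2 x hx.2)
        (fun x hx => (hΨ z hz).2 x hx.1) ⟨hzz', Metric.mem_ball_self hε0⟩
        ((hΨ z' hz').1.trans e1.symm) ⟨hw, hw'⟩).eq_of_nhds
    -- Scaling by `c` maps the enlarged ball into the ball of radius `r` and moves each point by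
    -- less than `ε / 2`. The glued map uses at `w` the extension centred at `c • w`.
    set c := r / (r + ε / 2) with hc
    have hc0 : 0 < c := by positivity
    have hc1 : 1 - c = (ε / 2) / (r + ε / 2) := by rw [hc]; field_simp; ring
    have hcb : ∀ w ∈ Metric.ball (0 : Plane) (r + ε / 2), c • w ∈ Metric.ball (0 : Plane) r ∧
        w ∈ Metric.ball (c • w) ε := by
      intro w hw
      rw [mem_ball_zero_iff] at hw
      constructor
      · rw [mem_ball_zero_iff, norm_smul, Real.norm_of_nonneg hc0.le, hc, div_mul_eq_mul_div,
          div_lt_iff₀ (by positivity)]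
        gcongr
      · rw [mem_ball_iff_norm, show w - c • w = (1 - c) • w by rw [sub_smul, one_smul], norm_smul,
          hc1, Real.norm_of_nonneg (by positivity), div_mul_eq_mul_div, div_lt_iff₀ (by positivity)]
        nlinarith
    refine ⟨fun w => Ψ (c • w) w, ?_, fun w hw => ?_⟩
    · simp only [smul_zero]
      rw [(hΨ 0 (Metric.mem_ball_self hr)).1.eq_of_nhds, hF0]
    · obtain ⟨hw1, hw2⟩ := hcb w hw
      refine ((hΨ _ hw1).2 w hw2).congr ?_
      have hcont : ContinuousAt (fun x : Plane => c • x) w := by fun_prop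
      filter_upwards [Metric.isOpen_ball.mem_nhds hw, Metric.isOpen_ball.mem_nhds hw2,
        hcont.preimage_mem_nhds (Metric.ball_mem_nhds (c • w) hε0)] with x hx hx2 hx3
      exact hagree _ hw1 _ (hcb x hx).1 hx3 x hx2 (hcb x hx).2
  have hinit : ∃ r > 0, ∃ F : Plane → M, F 0 = p ∧
      ∀ z ∈ Metric.ball (0 : Plane) r, IsDevAt g κ F z := by
    have hp := mem_chart_source Plane p
    obtain ⟨r, hr, hex⟩ := exists_isDevAt_of_isometric hκ hcurv p
      (isCompact_singleton (x := chartAt Plane p p))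
      (Set.singleton_subset_iff.2 ((chartAt Plane p).map_source hp))
    obtain ⟨P, hP⟩ := exists_isometric_map (chartForm_symm g p (chartAt Plane p p))
      (fun v hv => chartForm_pos g p ((chartAt Plane p).map_source hp) hv) (discExp κ) 0
    obtain ⟨F, hF0, -, hF⟩ := hex 0 (by simp) _ rfl P hP
    exact ⟨r, hr, F, by rw [hF0, (chartAt Plane p).left_inv hp], hF⟩
  obtain ⟨r, hr, F₀, hF₀0, hF₀⟩ := hinit
  have hind : ∀ n : ℕ, ∃ F : Plane → M, F 0 = p ∧
      ∀ z ∈ Metric.ball (0 : Plane) (min (1 / 2) (min r (1 / 2) + n * (ε / 2))), IsDevAt g κ F z := by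
    intro n
    induction n with
    | zero =>
      refine ⟨F₀, hF₀0, fun z hz => hF₀ z (Metric.ball_subset_ball ?_ hz)⟩
      simp
    | succ n ih =>
      obtain ⟨F, hF0, hF⟩ := hstep _ (by positivity) (min_le_left _ _) ih
      refine ⟨F, hF0, fun z hz => hF z (Metric.ball_subset_ball ?_ hz)⟩
      push_cast
      rcases le_total (1 / 2) (min r (1 / 2) + n * (ε / 2)) with h | h
      · rw [min_eq_left h]
        exact (min_le_left _ _).trans (by linarith)
      · rw [min_eq_right h]
        exact (min_le_right _ _).trans (by linarith)
  obtain ⟨n, hn⟩ := exists_nat_gt (1 / 2 / (ε / 2))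
  obtain ⟨F, hF0, hF⟩ := hind n
  refine ⟨F, hF0, fun z hz => hF z (Metric.ball_subset_ball (le_min le_rfl ?_) hz)⟩
  rw [div_lt_iff₀ (by positivity)] at hn
  have : 0 ≤ min r (1 / 2) := by positivity
  linarith

end Developments

/-! ### Interior gradient estimate for the flat Poisson equation. -/

section GradientEstimate

/-- The second derivative test. -/
theorem sndFDeriv_nonpos_of_isLocalMax {w : Plane → ℝ} {z : Plane} (hw : ContDiffAt ℝ 2 w z)
    (hmax : IsLocalMax w z) (ξ : Plane) : fderiv ℝ (fderiv ℝ w) z ξ ξ ≤ 0 := by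
  by_contra! hpos
  set c : ℝ → Plane := fun t => z + t • ξ with hc
  have hc0 : c 0 = z := by simp [hc]
  have hcd : ∀ t, HasDerivAt c ξ t := fun t => by
    have h := ((hasDerivAt_id t).smul_const ξ).const_add z
    rw [one_smul] at h
    exact h
  have hct : Tendsto c (𝓝 0) (𝓝 z) := by
    simpa only [hc0] using (hcd 0).continuousAt.tendsto
  have hd1 : deriv (w ∘ c) =ᶠ[𝓝 0] fun t => fderiv ℝ w (c t) ξ := by
    filter_upwards [hct.eventually (hw.eventually (by simp))] with t ht
    exact ((ht.differentiableAt (by norm_num)).hasFDerivAt.comp_hasDerivAt t (hcd t)).deriv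
  have hf' : HasFDerivAt (fderiv ℝ w) (fderiv ℝ (fderiv ℝ w) z) (c 0) := by
    rw [hc0]
    exact ((hw.fderiv_right (m := 1) (by norm_num)).differentiableAt (by norm_num)).hasFDerivAt
  have hd2 : deriv (deriv (w ∘ c)) 0 = fderiv ℝ (fderiv ℝ w) z ξ ξ := by
    rw [hd1.deriv_eq]
    have h1 := (hf'.comp_hasDerivAt (0 : ℝ) (hcd 0)).clm_apply (hasDerivAt_const (0 : ℝ) ξ)
    simpa using h1.deriv
  have hmaxc : IsLocalMax (w ∘ c) 0 := by
    have := hct.eventually hmax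
    simpa only [IsLocalMax, IsMaxFilter, Function.comp, hc0] using this
  have hcont : ContinuousAt (w ∘ c) 0 :=
    ContinuousAt.comp (by rw [hc0]; exact hw.continuousAt) (hcd 0).continuousAt
  -- A positive second derivative would make the maximum also a minimum, hence `w ∘ c` locally
  -- constant, and its second derivative zero.
  have hmin : IsLocalMin (w ∘ c) 0 :=
    isLocalMin_of_deriv_deriv_pos (by rw [hd2]; exact hpos) hmaxc.deriv_eq_zero hcont
  have hconst : w ∘ c =ᶠ[𝓝 0] fun _ => (w ∘ c) 0 := by
    filter_upwards [hmaxc, hmin] with t h1 h2 using le_antisymm h1 h2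
  have h0 : deriv (w ∘ c) =ᶠ[𝓝 0] fun _ => 0 := by
    filter_upwards [hconst.eventuallyEq_nhds] with t ht
    rw [ht.deriv_eq, deriv_const]
  rw [← hd2, h0.deriv_eq, deriv_const] at hpos
  exact lt_irrefl _ hpos

theorem sndFDeriv_comp_clm {v : Plane → ℝ} {z : Plane} (L : Plane →L[ℝ] Plane)
    (hv : ContDiffAt ℝ 2 v (L z)) (ξ : Plane) :
    fderiv ℝ (fderiv ℝ (v ∘ L)) z ξ ξ = fderiv ℝ (fderiv ℝ v) (L z) (L ξ) (L ξ) := by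
  have hd1 : fderiv ℝ (v ∘ L) =ᶠ[𝓝 z] fun x => (fderiv ℝ v (L x)).comp L := by
    filter_upwards [L.continuous.continuousAt.eventually (hv.eventually (by simp))] with x hx
    exact ((hx.differentiableAt (by norm_num)).hasFDerivAt.comp x L.hasFDerivAt).fderiv
  have hf' : HasFDerivAt (fderiv ℝ v) (fderiv ℝ (fderiv ℝ v) (L z)) (L z) :=
    ((hv.fderiv_right (m := 1) (by norm_num)).differentiableAt (by norm_num)).hasFDerivAt
  rw [hd1.fderiv_eq]
  have h1 := (hf'.comp z L.hasFDerivAt).clm_comp (hasFDerivAt_const L z)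
  have h2 := h1.fderiv
  simp only [Function.comp_def] at h2
  rw [h2]
  simp

/-- The barrier `α (x² - y²) + β y - γ y²`, where `x = z i` and `y = z j`. -/
def barrier (i j : Fin 2) (α β γ : ℝ) (z : Plane) : ℝ :=
  α * (z i ^ 2 - z j ^ 2) + β * z j - γ * z j ^ 2

theorem contDiff_coord (i : Fin 2) {n : WithTop ℕ∞} : ContDiff ℝ n fun z : Plane => z i :=
  (EuclideanSpace.proj i : Plane →L[ℝ] ℝ).contDiff

theorem contDiff_barrier (i j : Fin 2) (α β γ : ℝ) {n : WithTop ℕ∞} :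
    ContDiff ℝ n (barrier i j α β γ) := by
  have hi := contDiff_coord i (n := n)
  have hj := contDiff_coord j (n := n)
  exact ((contDiff_const.mul ((hi.pow 2).sub (hj.pow 2))).add (contDiff_const.mul hj)).sub
    (contDiff_const.mul (hj.pow 2))

theorem sndFDeriv_barrier (i j : Fin 2) (α β γ : ℝ) (z ξ : Plane) :
    fderiv ℝ (fderiv ℝ (barrier i j α β γ)) z ξ ξ
      = 2 * α * (ξ i ^ 2 - ξ j ^ 2) - 2 * γ * ξ j ^ 2 := by
  set p : Fin 2 → Plane →L[ℝ] ℝ := fun i => EuclideanSpace.proj i with hp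
  have hpa : ∀ i (x : Plane), p i x = x i := fun _ _ => rfl
  have hc : ∀ i (z : Plane), HasFDerivAt (fun z : Plane => z i) (p i) z :=
    fun i z => (p i).hasFDerivAt
  have h1 : fderiv ℝ (barrier i j α β γ)
      = fun z => (2 * α * z i) • p i + (β - 2 * (α + γ) * z j) • p j := by
    ext1 z
    have h := ((((hc i z).pow 2).sub ((hc j z).pow 2)).const_mul α).add ((hc j z).const_mul β)
      |>.sub (((hc j z).pow 2).const_mul γ)
    refine h.fderiv.trans ?_
    ext w
    simp [hpa]
    ring
  rw [h1]
  have h2 := (((hc i z).const_mul (2 * α)).smul_const (p i)).add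
    ((((hc j z).const_mul (2 * (α + γ))).const_sub β).smul_const (p j))
  refine (congrArg (fun A => A ξ ξ) h2.fderiv).trans ?_
  simp [hpa]
  ring

/-- The reflection of the plane in the line `z j = 0`. -/
def reflect (j : Fin 2) : Plane →L[ℝ] Plane :=
  ContinuousLinearMap.id ℝ Plane - (EuclideanSpace.proj j : Plane →L[ℝ] ℝ).smulRight
    ((2 : ℝ) • coordVec j)

theorem reflect_apply (j : Fin 2) (z : Plane) : reflect j z = z - (2 * z j) • coordVec j := by
  have : (EuclideanSpace.proj j : Plane →L[ℝ] ℝ) z = z j := rfl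
  simp [reflect, this, smul_smul, mul_comm]

theorem norm_sq_eq_of_ne {i j : Fin 2} (hij : i ≠ j) (z : Plane) :
    ‖z‖ ^ 2 = z i ^ 2 + z j ^ 2 := by
  rw [EuclideanSpace.norm_sq_eq, Fin.sum_univ_two]
  simp only [Real.norm_eq_abs, sq_abs]
  fin_cases i <;> fin_cases j <;> first | exact absurd rfl hij | simp [add_comm]

theorem norm_reflect {i j : Fin 2} (hij : i ≠ j) (z : Plane) : ‖reflect j z‖ = ‖z‖ := by
  have h : ‖reflect j z‖ ^ 2 = ‖z‖ ^ 2 := by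
    rw [norm_sq_eq_of_ne hij, norm_sq_eq_of_ne hij, reflect_apply]
    simp [coordVec_apply, hij]
    ring
  exact (sq_eq_sq₀ (norm_nonneg _) (norm_nonneg _)).1 h

/-- One-sided interior estimate for the derivative of a solution of a Poisson equation. -/
theorem partialDeriv_le {v : Plane → ℝ} {A N : ℝ} {i j : Fin 2} (hij : i ≠ j)
    (hv : ∀ z ∈ Metric.ball (0 : Plane) (1 / 2), ContDiffAt ℝ 2 v z)
    (hA : ∀ z ∈ Metric.ball (0 : Plane) (1 / 2), |v z| ≤ A)
    (hN : ∀ z ∈ Metric.ball (0 : Plane) (1 / 2),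
      |fderiv ℝ (fderiv ℝ v) z (coordVec i) (coordVec i)
        + fderiv ℝ (fderiv ℝ v) z (coordVec j) (coordVec j)| ≤ N) :
    fderiv ℝ v 0 (coordVec j) ≤ 8 * A + (N + 1) / 8 := by
  have hA0 : 0 ≤ A := (abs_nonneg _).trans (hA 0 (by simp))
  have hN0 : 0 ≤ N := (abs_nonneg _).trans (hN 0 (by simp))
  set R := reflect j with hR
  set K : Set Plane := {z | -(1 / 4) ≤ z i ∧ z i ≤ 1 / 4 ∧ 0 ≤ z j ∧ z j ≤ 1 / 4} with hK
  -- The odd part of `v` across z j = 0 is compared with `ψ` on the half square `K`. The coefficient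
  -- (N + 1)/2 gives Δψ = -(N + 1), so `w` is strictly subharmonic. The odd part vanishes on z j =
  -- 0, where ψ ≥ 0, and is at most `A` on the other sides. There 16 A makes the first term equal to
  -- A when z i = ±1/4 and z j = 0, and the coefficient of z j makes up for the two negative squares
  -- up to z j = 1/4.
  set ψ := barrier i j (16 * A) (8 * A + (N + 1) / 8) ((N + 1) / 2) with hψ
  set w : Plane → ℝ := fun z => (1 / 2) * (v z - (v ∘ R) z) - ψ z with hw
  have hKb : K ⊆ Metric.ball 0 (1 / 2) := by
    rintro z ⟨h1, h2, h3, h4⟩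
    rw [mem_ball_zero_iff]
    refine lt_of_pow_lt_pow_left₀ 2 (by norm_num) ?_
    rw [norm_sq_eq_of_ne hij]
    nlinarith
  have hRb : ∀ z ∈ Metric.ball (0 : Plane) (1 / 2), R z ∈ Metric.ball (0 : Plane) (1 / 2) := by
    intro z hz
    rw [mem_ball_zero_iff] at hz ⊢
    rwa [hR, norm_reflect hij]
  have hvR : ∀ z ∈ Metric.ball (0 : Plane) (1 / 2), ContDiffAt ℝ 2 (v ∘ R) z := fun z hz =>
    (hv _ (hRb z hz)).comp z R.contDiff.contDiffAt
  have hwC : ∀ z ∈ Metric.ball (0 : Plane) (1 / 2), ContDiffAt ℝ 2 w z := fun z hz =>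
    (contDiffAt_const.mul ((hv z hz).sub (hvR z hz))).sub (contDiff_barrier _ _ _ _ _).contDiffAt
  have hw2 : ∀ z ∈ Metric.ball (0 : Plane) (1 / 2), ∀ ξ, fderiv ℝ (fderiv ℝ w) z ξ ξ
      = (1 / 2) * (fderiv ℝ (fderiv ℝ v) z ξ ξ - fderiv ℝ (fderiv ℝ v) (R z) (R ξ) (R ξ))
        - fderiv ℝ (fderiv ℝ ψ) z ξ ξ := by
    intro z hz ξ
    have hψC : ContDiff ℝ 2 ψ := contDiff_barrier _ _ _ _ _
    have hd : fderiv ℝ w =ᶠ[𝓝 z]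
        fun x => (1 / 2 : ℝ) • (fderiv ℝ v x - fderiv ℝ (v ∘ R) x) - fderiv ℝ ψ x := by
      filter_upwards [Metric.isOpen_ball.mem_nhds hz] with x hx
      have e1 := ((hv x hx).differentiableAt (by norm_num)).hasFDerivAt
      have e2 := ((hvR x hx).differentiableAt (by norm_num)).hasFDerivAt
      have e3 := ((hψC.differentiable (by norm_num)) x).hasFDerivAt
      exact (((e1.sub e2).const_mul (1 / 2)).sub e3).fderiv
    have g1 := (((hv z hz).fderiv_right (m := 1) (by norm_num)).differentiableAt
      (by norm_num)).hasFDerivAt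
    have g2 := (((hvR z hz).fderiv_right (m := 1) (by norm_num)).differentiableAt
      (by norm_num)).hasFDerivAt
    have g3 := (((hψC.contDiffAt (x := z)).fderiv_right (m := 1) (by norm_num)).differentiableAt
      (by norm_num)).hasFDerivAt
    have g4 : HasFDerivAt
        (fun x => (1 / 2 : ℝ) • (fderiv ℝ v x - fderiv ℝ (v ∘ R) x) - fderiv ℝ ψ x) _ z :=
      ((g1.sub g2).const_smul (1 / 2 : ℝ)).sub g3
    rw [hd.fderiv_eq, g4.fderiv]
    simp only [sub_apply, smul_apply, smul_eq_mul]
    rw [sndFDeriv_comp_clm R (hv _ (hRb z hz))]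
  have hRi : R (coordVec i) = coordVec i := by
    rw [hR, reflect_apply]; simp [coordVec_apply, hij.symm]
  have hRj : R (coordVec j) = -coordVec j := by
    rw [hR, reflect_apply]; simp [coordVec_apply, two_smul]
  have hlap : ∀ z ∈ Metric.ball (0 : Plane) (1 / 2),
      0 < fderiv ℝ (fderiv ℝ w) z (coordVec i) (coordVec i)
        + fderiv ℝ (fderiv ℝ w) z (coordVec j) (coordVec j) := by
    intro z hz
    have b1 := abs_le.1 (hN z hz)
    have b2 := abs_le.1 (hN _ (hRb z hz))
    rw [hw2 z hz, hw2 z hz, hRi, hRj, hψ, sndFDeriv_barrier, sndFDeriv_barrier]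
    simp only [map_neg, neg_apply, neg_neg, coordVec_apply, hij, hij.symm, if_true, if_false]
    linarith [b1.1, b2.2]
  have hKc : IsCompact K := by
    have ci := (contDiff_coord i (n := 1)).continuous
    have cj := (contDiff_coord j (n := 1)).continuous
    refine Metric.isCompact_of_isClosed_isBounded ?_ (Metric.isBounded_ball.subset hKb)
    exact (isClosed_le continuous_const ci).inter ((isClosed_le ci continuous_const).inter
      ((isClosed_le continuous_const cj).inter (isClosed_le cj continuous_const)))
  obtain ⟨z, hz, hzmax⟩ := hKc.exists_isMaxOn (f := w) ⟨0, by simp [hK]⟩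
    fun x hx => (hwC x (hKb hx)).continuousAt.continuousWithinAt
  have hzb := hKb hz
  have hwz : w z ≤ 0 := by
    have hv1 := abs_le.1 (hA z hzb)
    have hv2 := abs_le.1 (hA _ (hRb z hzb))
    have hwz : w z = (1 / 2) * (v z - v (R z)) - (16 * A * (z i ^ 2 - z j ^ 2)
      + (8 * A + (N + 1) / 8) * z j - (N + 1) / 2 * z j ^ 2) := rfl
    have hzi : z i ^ 2 ≤ 1 / 16 := by nlinarith [hz.1, hz.2.1]
    by_cases h0 : z j = 0
    · have hRz : R z = z := by rw [hR, reflect_apply, h0]; simp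
      rw [hwz, hRz, h0]
      nlinarith [mul_nonneg hA0 (sq_nonneg (z i))]
    have hzj : 0 < z j := lt_of_le_of_ne hz.2.2.1 (Ne.symm h0)
    by_cases h1 : z i ^ 2 = 1 / 16
    · rw [hwz, h1]
      nlinarith [mul_nonneg hA0 (mul_nonneg hzj.le (sub_nonneg.2 hz.2.2.2)),
        mul_nonneg hN0 (mul_nonneg hzj.le (sub_nonneg.2 hz.2.2.2)), mul_nonneg hA0 hzj.le,
        mul_nonneg hzj.le (sub_nonneg.2 hz.2.2.2)]
    by_cases h2 : z j = 1 / 4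
    · rw [hwz, h2]
      nlinarith [mul_nonneg hA0 (sq_nonneg (z i))]
    exfalso
    have hloc : IsLocalMax w z := by
      have ci := (contDiff_coord i (n := 1)).continuous
      have cj := (contDiff_coord j (n := 1)).continuous
      have l1 : -(1 / 4) < z i := lt_of_le_of_ne hz.1 fun h => h1 (by rw [← h]; norm_num)
      have l2 : z i < 1 / 4 := lt_of_le_of_ne hz.2.1 fun h => h1 (by rw [h]; norm_num)
      have l3 : z j < 1 / 4 := lt_of_le_of_ne hz.2.2.2 h2
      filter_upwards [continuousAt_const.eventually_lt ci.continuousAt l1,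
        ci.continuousAt.eventually_lt continuousAt_const l2,
        continuousAt_const.eventually_lt cj.continuousAt hzj,
        cj.continuousAt.eventually_lt continuousAt_const l3] with x x1 x2 x3 x4
      exact hzmax ⟨x1.le, x2.le, x3.le, x4.le⟩
    exact (hlap z hzb).not_ge (add_nonpos (sndFDeriv_nonpos_of_isLocalMax (hwC z hzb) hloc _)
      (sndFDeriv_nonpos_of_isLocalMax (hwC z hzb) hloc _))
  -- On the normal ray the quadratic terms of `ψ` are nonpositive, leaving only the linear
  -- coefficient as a bound for the difference quotient.
  have hray : ∀ᶠ t in 𝓝[>] (0 : ℝ),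
      t⁻¹ * ((1 / 2) * (v (t • coordVec j) - v (-t • coordVec j))) ≤ 8 * A + (N + 1) / 8 := by
    filter_upwards [Ioc_mem_nhdsGT (show (0 : ℝ) < 1 / 4 by norm_num)] with t ht
    have htK : t • coordVec j ∈ K := by
      have e1 : (t • coordVec j) i = 0 := by simp [coordVec_apply, hij]
      have e2 : (t • coordVec j) j = t := by simp [coordVec_apply]
      refine ⟨?_, ?_, ?_, ?_⟩
      · rw [e1]; norm_num
      · rw [e1]; norm_num
      · rw [e2]; exact ht.1.le
      · rw [e2]; exact ht.2
    have hle : w (t • coordVec j) ≤ 0 := (hzmax htK).trans hwz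
    have hval : w (t • coordVec j) = (1 / 2) * (v (t • coordVec j) - v (-t • coordVec j))
        - (16 * A * (0 - t ^ 2) + (8 * A + (N + 1) / 8) * t - (N + 1) / 2 * t ^ 2) := by
      have e1 : (t • coordVec j) i = 0 := by simp [coordVec_apply, hij]
      have e2 : (t • coordVec j) j = t := by simp [coordVec_apply]
      simp only [hw, hψ, barrier, Function.comp, map_smul, hRj, e1, e2, smul_neg, neg_smul]
      ring
    rw [inv_mul_le_iff₀ ht.1]
    nlinarith [mul_nonneg hA0 (sq_nonneg t), mul_nonneg hN0 (sq_nonneg t), sq_nonneg t]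
  have hlim : Tendsto (fun t : ℝ => t⁻¹ * ((1 / 2) * (v (t • coordVec j) - v (-t • coordVec j))))
      (𝓝[>] 0) (𝓝 (fderiv ℝ v 0 (coordVec j))) := by
    have hD : HasFDerivAt v (fderiv ℝ v 0) 0 :=
      ((hv 0 (by simp)).differentiableAt (by norm_num)).hasFDerivAt
    have c1 : HasDerivAt (fun t : ℝ => t • coordVec j) (coordVec j) 0 := by
      simpa using (hasDerivAt_id (0 : ℝ)).smul_const (coordVec j)
    have c2 : HasDerivAt (fun t : ℝ => -t • coordVec j) (-coordVec j) 0 := by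
      simpa using (hasDerivAt_id (0 : ℝ)).neg.smul_const (coordVec j)
    have d1 : HasDerivAt (fun t : ℝ => v (t • coordVec j)) (fderiv ℝ v 0 (coordVec j)) 0 :=
      HasFDerivAt.comp_hasDerivAt (l := v) (0 : ℝ) (by simpa using hD) c1
    have d2 : HasDerivAt (fun t : ℝ => v (-t • coordVec j)) (fderiv ℝ v 0 (-coordVec j)) 0 :=
      HasFDerivAt.comp_hasDerivAt (l := v) (0 : ℝ) (by simpa using hD) c2
    have d3 := (d1.sub d2).const_mul (1 / 2)
    have h := d3.tendsto_slope_zero_right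
    simp only [Pi.sub_apply, zero_add, zero_smul, neg_zero, sub_self, mul_zero, sub_zero, map_neg,
      smul_eq_mul] at h
    convert h using 2
    ring
  exact le_of_tendsto hlim hray

/-- Interior gradient estimate for the Poisson equation on the disc of radius `1/2`. -/
theorem abs_fderiv_le {v : Plane → ℝ} {A N : ℝ}
    (hv : ∀ z ∈ Metric.ball (0 : Plane) (1 / 2), ContDiffAt ℝ 2 v z)
    (hA : ∀ z ∈ Metric.ball (0 : Plane) (1 / 2), |v z| ≤ A)
    (hN : ∀ z ∈ Metric.ball (0 : Plane) (1 / 2), |flatLaplacian v z| ≤ N) (ξ : Plane) :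
    |fderiv ℝ v 0 ξ| ≤ 2 * (8 * A + (N + 1) / 8) * ‖ξ‖ := by
  set C := 8 * A + (N + 1) / 8 with hC
  have hneg : fderiv ℝ (fderiv ℝ fun z => -v z) = fun z => -fderiv ℝ (fderiv ℝ v) z := by
    ext1 z
    rw [show (fderiv ℝ fun z => -v z) = fun z => -fderiv ℝ v z from by ext1 z; exact fderiv_fun_neg]
    exact fderiv_fun_neg
  have key : ∀ i j : Fin 2, i ≠ j → |fderiv ℝ v 0 (coordVec j)| ≤ C := by
    intro i j hij
    have hN' : ∀ z ∈ Metric.ball (0 : Plane) (1 / 2),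
        |fderiv ℝ (fderiv ℝ v) z (coordVec i) (coordVec i)
          + fderiv ℝ (fderiv ℝ v) z (coordVec j) (coordVec j)| ≤ N := by
      intro z hz
      have h := hN z hz
      rw [flatLaplacian] at h
      fin_cases i <;> fin_cases j <;>
        first | exact absurd rfl hij | exact h | (rw [add_comm]; exact h)
    refine abs_le.2 ⟨?_, partialDeriv_le hij hv hA hN'⟩
    have h := partialDeriv_le (v := fun z => -v z) hij (fun z hz => (hv z hz).neg)
      (fun z hz => by rw [abs_neg]; exact hA z hz) (fun z hz => by
        rw [hneg]
        simp only [neg_apply]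
        rw [← neg_add, abs_neg]
        exact hN' z hz)
    rw [fderiv_fun_neg, neg_apply] at h
    linarith
  have hC0 : 0 ≤ C := (abs_nonneg _).trans (key 0 1 (by simp))
  have hξ : ξ = ξ 0 • coordVec 0 + ξ 1 • coordVec 1 := by
    ext i
    fin_cases i <;> simp [coordVec_apply]
  have hcoord : ∀ i, |ξ i| ≤ ‖ξ‖ := fun i => by
    simpa using PiLp.norm_apply_le ξ i
  have hval : fderiv ℝ v 0 ξ
      = ξ 0 * fderiv ℝ v 0 (coordVec 0) + ξ 1 * fderiv ℝ v 0 (coordVec 1) := by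
    conv_lhs => rw [hξ]
    simp only [map_add, map_smul, smul_eq_mul]
  rw [hval]
  refine (abs_add_le _ _).trans ?_
  rw [abs_mul, abs_mul]
  have h0 := mul_le_mul (hcoord 0) (key 1 0 (by simp)) (abs_nonneg _) (norm_nonneg _)
  have h1 := mul_le_mul (hcoord 1) (key 0 1 (by simp)) (abs_nonneg _) (norm_nonneg _)
  linarith

end GradientEstimate

/-! ### The curvature equation and the estimates for the conformal factor. -/

section Conformal

variable {M : Type*} [TopologicalSpace M] [ChartedSpace Plane M] [IsManifold (𝓡 2) ∞ M]

theorem flatLaplacian_nonpos_of_isLocalMax {w : Plane → ℝ} {z : Plane}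
    (hw : ContDiffAt ℝ 2 w z) (hmax : IsLocalMax w z) : flatLaplacian w z ≤ 0 :=
  add_nonpos (sndFDeriv_nonpos_of_isLocalMax hw hmax _) (sndFDeriv_nonpos_of_isLocalMax hw hmax _)

theorem flatLaplacian_neg (w : Plane → ℝ) (z : Plane) :
    flatLaplacian (fun x => -w x) z = -flatLaplacian w z := by
  have hneg : fderiv ℝ (fderiv ℝ fun x => -w x) z = -fderiv ℝ (fderiv ℝ w) z := by
    rw [show (fderiv ℝ fun x => -w x) = fun x => -fderiv ℝ w x from by ext1 x; exact fderiv_fun_neg]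
    exact fderiv_fun_neg
  simp only [flatLaplacian, hneg, neg_apply]
  ring

theorem flatLaplacian_add {v w : Plane → ℝ} {z : Plane} (hv : ContDiffAt ℝ 2 v z)
    (hw : ContDiffAt ℝ 2 w z) :
    flatLaplacian (fun x => v x + w x) z = flatLaplacian v z + flatLaplacian w z := by
  have hd : fderiv ℝ (fun x => v x + w x) =ᶠ[𝓝 z] fun x => fderiv ℝ v x + fderiv ℝ w x := by
    filter_upwards [hv.eventually (by simp), hw.eventually (by simp)] with x h1 h2
    exact fderiv_fun_add (h1.differentiableAt (by norm_num)) (h2.differentiableAt (by norm_num))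
  have g1 := (hv.fderiv_right (m := 1) (by norm_num)).differentiableAt (by norm_num)
  have g2 := (hw.fderiv_right (m := 1) (by norm_num)).differentiableAt (by norm_num)
  simp only [flatLaplacian]
  rw [hd.fderiv_eq, fderiv_fun_add g1 g2]
  simp only [add_apply]
  ring

theorem flatLaplacian_nonneg_of_isLocalMin {w : Plane → ℝ} {z : Plane}
    (hw : ContDiffAt ℝ 2 w z) (hmin : IsLocalMin w z) : 0 ≤ flatLaplacian w z := by
  have h := flatLaplacian_nonpos_of_isLocalMax (w := fun x => -w x) hw.neg hmin.neg
  rw [flatLaplacian_neg] at h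
  linarith

/-- The differential of a real function. -/
def differential (u : M → ℝ) (x : M) : TangentSpace (𝓡 2) x →L[ℝ] ℝ :=
  mfderiv (𝓡 2) 𝓘(ℝ) u x

variable {u : M → ℝ} {κ : ℝ} {F : Plane → M} {z : Plane}

theorem contDiffAt_comp_chart_symm (hu : ContMDiff (𝓡 2) 𝓘(ℝ) 2 u) (q : M) {y : Plane}
    (hy : y ∈ (chartAt Plane q).target) : ContDiffAt ℝ 2 (u ∘ (chartAt Plane q).symm) y :=
  ((hu _).comp y ((contMDiffAt_chart_symm q hy).of_le (by norm_cast))).contDiffAt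

theorem IsDevAt.eventuallyEq_comp {h : C2Metric M} (hF : IsDevAt h κ F z) (u : M → ℝ) :
    u ∘ F =ᶠ[𝓝 z] (u ∘ (chartAt Plane (F z)).symm) ∘ (chartAt Plane (F z) ∘ F) := by
  filter_upwards [hF.1.preimage_mem_nhds ((chartAt Plane (F z)).open_source.mem_nhds
    (mem_chart_source _ _))] with x hx
  simp only [Function.comp]
  rw [(chartAt Plane (F z)).left_inv hx]

theorem IsDevAt.contDiffAt_comp {h : C2Metric M} (hF : IsDevAt h κ F z)
    (hu : ContMDiff (𝓡 2) 𝓘(ℝ) 2 u) : ContDiffAt ℝ 2 (u ∘ F) z :=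
  ((contDiffAt_comp_chart_symm hu (F z) ((chartAt Plane (F z)).map_source
    (mem_chart_source _ _))).comp z (hF.2.1.of_le (by norm_num))).congr_of_eventuallyEq
      (hF.eventuallyEq_comp u)

/-- The equation of prescribed Gaussian curvature in a development of `e^{-2u} g`. -/
theorem IsDevAt.flatLaplacian_comp (hκ : κ < 0) {g : C2Metric M}
    {hu : ContMDiff (𝓡 2) 𝓘(ℝ) 2 u} (hF : IsDevAt (conformal g u hu) κ F z)
    (hz : z ∈ Metric.ball (0 : Plane) 1) :
    flatLaplacian (u ∘ F) z = Real.exp (2 * discExp κ z)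
      * (κ - gaussCurvature g (F z) * Real.exp (2 * u (F z))) := by
  set φ := chartAt Plane (F z) with hφ
  have hsrc : F z ∈ φ.source := mem_chart_source _ _
  have hv : ContDiffAt ℝ 2 (u ∘ F) z := hF.contDiffAt_comp hu
  have hρ : ContDiffAt ℝ 2 (discExp κ) z :=
    (contDiffOn_discExp κ 2).contDiffAt (Metric.isOpen_ball.mem_nhds hz)
  set σ : Plane → ℝ := fun x => (u ∘ F) x + discExp κ x with hσ
  have hσC : ContDiffAt ℝ 2 σ z := hv.add hρ
  -- The factor e^{2u} in `confForm σ` undoes the e^{-2u} in `conformal`, so the same map is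
  -- isometric onto `g`. Thus e^{2σ}|dz|² has the curvature of `g`, and its equation minus that of
  -- `discExp κ` is the claim.
  have hiso : IsIsometryNear (confForm σ) (chartForm g (F z)) (φ ∘ F) z := by
    filter_upwards [hF.2.2, hF.1.preimage_mem_nhds (φ.open_source.mem_nhds hsrc)] with y hy hys a b
    have h := hy a b
    rw [chartForm_conformal, Function.comp_apply, φ.left_inv hys, confForm_apply] at h
    rw [confForm_apply, hσ, Function.comp_apply]
    simp only [Function.comp_apply]
    rw [mul_add, Real.exp_add, mul_assoc, ← h, ← mul_assoc, ← Real.exp_add]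
    rw [show 2 * u (F y) + -2 * u (F y) = 0 by ring, Real.exp_zero, one_mul]
  obtain ⟨W, hW, hWo, hzW⟩ := eventually_nhds_iff.1 (hσC.eventually (by simp))
  have hLC : IsLeviCivita (confForm σ) (confConn σ) W :=
    isLeviCivita_conf hWo fun x hx => (hW x hx).contDiffWithinAt
  have hc := hasCurv_chart g (F z) (φ.map_source hsrc)
  rw [φ.left_inv hsrc] at hc
  have hcσ := HasCurv.of_isometry (isLeviCivita_chart g (F z)) hLC hzW (φ.map_source hsrc)
    hF.2.1 hiso hc
  have heq := hcσ.flatLaplacian_eq hσC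
  rw [hσ, flatLaplacian_add hv hρ, flatLaplacian_discExp hκ hz, mul_add, Real.exp_add,
    Function.comp_apply] at heq
  linear_combination heq

theorem chartForm_mfderiv_chart (g : C2Metric M) (q : M) {x : M}
    (hx : x ∈ (chartAt Plane q).source) (V : TangentSpace (𝓡 2) x) :
    chartForm g q (chartAt Plane q x) (mfderiv (𝓡 2) (𝓡 2) (chartAt Plane q) x V)
      (mfderiv (𝓡 2) (𝓡 2) (chartAt Plane q) x V) = g.inner x V V := by
  have key : ∀ x', x' = x → ∀ W : Plane, (g.inner x' : Plane →L[ℝ] Plane →L[ℝ] ℝ) W W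
      = (g.inner x : Plane →L[ℝ] Plane →L[ℝ] ℝ) W W := by
    rintro _ rfl _; rfl
  exact (key _ ((chartAt Plane q).left_inv hx) _).trans
    (congrArg (fun W : Plane => (g.inner x : Plane →L[ℝ] Plane →L[ℝ] ℝ) W W)
      (mfderiv_chart_symm_comp q hx V))

theorem differential_eq_fderiv_chart (hu : ContMDiff (𝓡 2) 𝓘(ℝ) 2 u) (q : M) {x : M}
    (hx : x ∈ (chartAt Plane q).source) (V : TangentSpace (𝓡 2) x) :
    differential u x V = fderiv ℝ (u ∘ (chartAt Plane q).symm) (chartAt Plane q x)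
      (mfderiv (𝓡 2) (𝓡 2) (chartAt Plane q) x V) := by
  set φ := chartAt Plane q with hφ
  have heq : u =ᶠ[𝓝 x] (u ∘ φ.symm) ∘ φ := by
    filter_upwards [φ.open_source.mem_nhds hx] with y hy
    simp only [Function.comp]
    rw [φ.left_inv hy]
  have h1 : MDifferentiableAt (𝓡 2) 𝓘(ℝ) (u ∘ φ.symm) (φ x) :=
    ((contDiffAt_comp_chart_symm hu q (φ.map_source hx)).differentiableAt
      (by norm_num)).mdifferentiableAt
  have h2 : MDifferentiableAt (𝓡 2) (𝓡 2) φ x := (contMDiffAt_chart hx).mdifferentiableAt (by simp)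
  have h3 := mfderiv_comp_apply x h1 h2 V
  rw [mfderiv_eq_fderiv] at h3
  exact (congrArg (fun A : Plane →L[ℝ] ℝ => A V) heq.mfderiv_eq).trans h3

/-- Tangent vectors at a point of a development come from the disc. -/
theorem IsDevAt.exists_preimage {h : C2Metric M} (hF : IsDevAt h κ F z)
    (hz : z ∈ Metric.ball (0 : Plane) 1) (hu : ContMDiff (𝓡 2) 𝓘(ℝ) 2 u)
    (V : TangentSpace (𝓡 2) (F z)) :
    ∃ ξ : Plane, h.inner (F z) V V = Real.exp (2 * discExp κ z) * ‖ξ‖ ^ 2 ∧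
      differential u (F z) V = fderiv ℝ (u ∘ F) z ξ := by
  set φ := chartAt Plane (F z) with hφ
  have hsrc : F z ∈ φ.source := mem_chart_source _ _
  obtain ⟨ξ, hξ⟩ := (fderiv_bijective_of_isometry (isLeviCivita_disc κ) hz
    hF.2.2.self_of_nhds).2 (mfderiv (𝓡 2) (𝓡 2) φ (F z) V : Plane)
  refine ⟨ξ, ?_, ?_⟩
  · rw [← chartForm_mfderiv_chart h (F z) hsrc V]
    have hi := hF.2.2.self_of_nhds ξ ξ
    rw [hξ, confForm_apply, real_inner_self_eq_norm_sq] at hi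
    exact hi
  · rw [differential_eq_fderiv_chart hu (F z) hsrc V]
    have h1 := (contDiffAt_comp_chart_symm hu (F z) (φ.map_source hsrc)).differentiableAt
      (by norm_num)
    have h2 : DifferentiableAt ℝ (φ ∘ F) z := hF.2.1.differentiableAt (by norm_num)
    rw [(hF.eventuallyEq_comp u).fderiv_eq, fderiv_comp z h1 h2]
    exact congrArg (fderiv ℝ (u ∘ φ.symm) (φ (F z))) hξ.symm

/-- Testing with V = ∇u gives |∇u|⁴ ≤ L² |∇u|². -/
theorem gradientNorm_le (h : C2Metric M) {x : M} {L : ℝ} (hL : 0 ≤ L)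
    (hdu : ∀ V : TangentSpace (𝓡 2) x,
      differential u x V ^ 2 ≤ L ^ 2 * h.inner x V V) :
    gradientNorm h u x ≤ L := by
  refine Real.sqrt_le_iff.2 ⟨hL, ?_⟩
  have h1 := hdu (gradient h u x)
  have h2 : h.inner x (gradient h u x) (gradient h u x) = differential u x (gradient h u x) :=
    inner_gradient h u x _
  set s := h.inner x (gradient h u x) (gradient h u x)
  rw [← h2] at h1
  by_contra! hlt
  nlinarith [sq_nonneg L]

variable {a b : ℝ} {g : C2Metric M}

/-- A bound for the Laplacian of the conformal factor on the disc of radius `1/2`. -/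
def laplacianBound (b κ A : ℝ) : ℝ := 4 / -κ / (9 / 16) * (-κ + b ^ 2 * Real.exp (2 * A))

theorem IsDevAt.abs_flatLaplacian_comp_le (hκ : κ < 0) {A : ℝ}
    {hu : ContMDiff (𝓡 2) 𝓘(ℝ) 2 u} (hK : ∀ x, gaussCurvature g x ∈ Set.Icc (-b ^ 2) 0)
    (hA : ∀ x, |u x| ≤ A) (hF : IsDevAt (conformal g u hu) κ F z)
    (hz : z ∈ Metric.ball (0 : Plane) (1 / 2)) :
    |flatLaplacian (u ∘ F) z| ≤ laplacianBound b κ A := by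
  have hz1 : z ∈ Metric.ball (0 : Plane) 1 := Metric.ball_subset_ball (by norm_num) hz
  rw [hF.flatLaplacian_comp hκ hz1, abs_mul, Real.abs_exp, exp_two_discExp hκ hz1, laplacianBound]
  have hκ0 : 0 < -κ := by linarith
  rw [mem_ball_zero_iff] at hz
  -- Hence (1 - ‖z‖²)² ≥ 9/16, the constant in `laplacianBound`.
  have hn : ‖z‖ ^ 2 ≤ 1 / 4 := by nlinarith [norm_nonneg z]
  gcongr
  · nlinarith
  · have hexp : Real.exp (2 * u (F z)) ≤ Real.exp (2 * A) :=
      Real.exp_le_exp.2 (by linarith [(abs_le.1 (hA (F z))).2])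
    have h0 := Real.exp_pos (2 * u (F z))
    obtain ⟨k1, k2⟩ := hK (F z)
    have hmul : 0 ≤ -gaussCurvature g (F z) * Real.exp (2 * u (F z)) :=
      mul_nonneg (by linarith) h0.le
    have hmul2 : -gaussCurvature g (F z) * Real.exp (2 * u (F z)) ≤ b ^ 2 * Real.exp (2 * A) :=
      mul_le_mul (by linarith) hexp h0.le (sq_nonneg b)
    refine abs_le.2 ⟨?_, ?_⟩ <;> linarith

variable [T2Space M] [CompactSpace M]

/-- Maximum principle in a development centred at a maximum point of `u`: Δ(u ∘ F) ≤ 0 there forces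
κ ≤ K_g e^{2u} ≤ -a² e^{2u}. -/
theorem exp_two_mul_le (hκ : κ < 0) (ha : 0 < a) (hu : ContMDiff (𝓡 2) 𝓘(ℝ) 2 u)
    (hK : ∀ x, gaussCurvature g x ≤ -a ^ 2)
    (hκ' : ∀ x, gaussCurvature (conformal g u hu) x = κ) (x : M) :
    Real.exp (2 * u x) ≤ -κ / a ^ 2 := by
  obtain ⟨p, -, hp⟩ := isCompact_univ.exists_isMaxOn ⟨x, Set.mem_univ x⟩ hu.continuous.continuousOn
  obtain ⟨F, rfl, hF⟩ := exists_development hκ hκ' p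
  have h0 := hF 0 (by simp)
  have hmax : IsLocalMax (u ∘ F) 0 := Eventually.of_forall fun z => hp (Set.mem_univ (F z))
  have hlap := flatLaplacian_nonpos_of_isLocalMax (h0.contDiffAt_comp hu) hmax
  rw [h0.flatLaplacian_comp hκ (by simp)] at hlap
  have h1 := nonpos_of_mul_nonpos_right hlap (Real.exp_pos _)
  have hle : u x ≤ u (F 0) := hp (Set.mem_univ x)
  calc Real.exp (2 * u x) ≤ Real.exp (2 * u (F 0)) := Real.exp_le_exp.2 (by linarith)
    _ ≤ -κ / a ^ 2 := by
      rw [le_div_iff₀ (by positivity)]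
      nlinarith [hK (F 0), Real.exp_pos (2 * u (F 0))]

/-- The same argument at a minimum point: κ ≥ K_g e^{2u} ≥ -b² e^{2u}. -/
theorem le_exp_two_mul (hκ : κ < 0) (hb : 0 < b) (hu : ContMDiff (𝓡 2) 𝓘(ℝ) 2 u)
    (hK : ∀ x, -b ^ 2 ≤ gaussCurvature g x)
    (hκ' : ∀ x, gaussCurvature (conformal g u hu) x = κ) (x : M) :
    -κ / b ^ 2 ≤ Real.exp (2 * u x) := by
  obtain ⟨p, -, hp⟩ := isCompact_univ.exists_isMinOn ⟨x, Set.mem_univ x⟩ hu.continuous.continuousOn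
  obtain ⟨F, rfl, hF⟩ := exists_development hκ hκ' p
  have h0 := hF 0 (by simp)
  have hmin : IsLocalMin (u ∘ F) 0 := Eventually.of_forall fun z => hp (Set.mem_univ (F z))
  have hlap := flatLaplacian_nonneg_of_isLocalMin (h0.contDiffAt_comp hu) hmin
  rw [h0.flatLaplacian_comp hκ (by simp)] at hlap
  have h1 := nonneg_of_mul_nonneg_right hlap (Real.exp_pos _)
  have hle : u (F 0) ≤ u x := hp (Set.mem_univ x)
  calc -κ / b ^ 2 ≤ Real.exp (2 * u (F 0)) := by
        rw [div_le_iff₀ (by positivity)]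
        nlinarith [hK (F 0), Real.exp_pos (2 * u (F 0))]
    _ ≤ Real.exp (2 * u x) := Real.exp_le_exp.2 (by linarith)

/-- The bound for the conformal factor. -/
def conformalBound (a b κ : ℝ) : ℝ :=
  max |Real.log (-κ / a ^ 2) / 2| |Real.log (-κ / b ^ 2) / 2|

theorem abs_le_conformalBound (hκ : κ < 0) (ha : 0 < a) (hb : 0 < b)
    (hu : ContMDiff (𝓡 2) 𝓘(ℝ) 2 u)
    (hK : ∀ x, gaussCurvature g x ∈ Set.Icc (-b ^ 2) (-a ^ 2))
    (hκ' : ∀ x, gaussCurvature (conformal g u hu) x = κ) (x : M) :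
    |u x| ≤ conformalBound a b κ := by
  have h1 := exp_two_mul_le hκ ha hu (fun x => (hK x).2) hκ' x
  have h2 := le_exp_two_mul hκ hb hu (fun x => (hK x).1) hκ' x
  have hκ0 : 0 < -κ := by linarith
  rw [← Real.le_log_iff_exp_le (by positivity)] at h1
  rw [← Real.log_le_iff_le_exp (by positivity)] at h2
  refine abs_le.2 ⟨?_, ?_⟩
  · have := (neg_abs_le (Real.log (-κ / b ^ 2) / 2))
    have := le_max_right |Real.log (-κ / a ^ 2) / 2| |Real.log (-κ / b ^ 2) / 2|
    rw [conformalBound]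
    linarith
  · have := (le_abs_self (Real.log (-κ / a ^ 2) / 2))
    have := le_max_left |Real.log (-κ / a ^ 2) / 2| |Real.log (-κ / b ^ 2) / 2|
    rw [conformalBound]
    linarith

/-- The flat estimate at the centre of a development. The metric there is 4/(-κ) times the Euclidean
one, so ‖ξ‖ is √(-κ)/2 times the g₁-length of `V`; the 2 cancels the factor in `abs_fderiv_le`. -/
theorem sq_differential_le (hκ : κ < 0) {A : ℝ} (hu : ContMDiff (𝓡 2) 𝓘(ℝ) 2 u)
    (hK : ∀ x, gaussCurvature g x ∈ Set.Icc (-b ^ 2) 0)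
    (hκ' : ∀ x, gaussCurvature (conformal g u hu) x = κ) (hA : ∀ x, |u x| ≤ A) (x : M)
    (V : TangentSpace (𝓡 2) x) :
    differential u x V ^ 2 ≤
      ((8 * A + (laplacianBound b κ A + 1) / 8) * Real.sqrt (-κ)) ^ 2
        * (conformal g u hu).inner x V V := by
  obtain ⟨F, rfl, hF⟩ := exists_development hκ hκ' x
  obtain ⟨ξ, hξ, hξu⟩ := (hF 0 (by simp)).exists_preimage (by simp) hu V
  have hgrad := abs_fderiv_le (fun z hz => (hF z hz).contDiffAt_comp hu) (fun z _ => hA (F z))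
    (fun z hz => (hF z hz).abs_flatLaplacian_comp_le hκ hK hA hz) ξ
  have hκ0 : 0 < -κ := by linarith
  rw [hξ, hξu, exp_two_discExp hκ (by simp), mul_pow, Real.sq_sqrt hκ0.le]
  set C := 8 * A + (laplacianBound b κ A + 1) / 8 with hC
  have h := pow_le_pow_left₀ (abs_nonneg _) hgrad 2
  rw [sq_abs] at h
  refine h.trans (le_of_eq ?_)
  rw [norm_zero]
  have hκκ : -κ * (4 / -κ) = 4 := mul_div_cancel₀ _ hκ0.ne'
  linear_combination (-C ^ 2 * ‖ξ‖ ^ 2) * hκκ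

/-- Lengths in g₁ are e^{-u} ≤ e^A times lengths in g, whence the factor e^A. For g₁ itself it is
harmless, being at least 1, and gives one constant for both norms. -/
theorem gradientNorm_bounds (hκ : κ < 0) {A : ℝ} (hu : ContMDiff (𝓡 2) 𝓘(ℝ) 2 u)
    (hK : ∀ x, gaussCurvature g x ∈ Set.Icc (-b ^ 2) 0)
    (hκ' : ∀ x, gaussCurvature (conformal g u hu) x = κ) (hA : ∀ x, |u x| ≤ A) (x : M) :
    gradientNorm g u x ≤
        (8 * A + (laplacianBound b κ A + 1) / 8) * Real.sqrt (-κ) * Real.exp A ∧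
      gradientNorm (conformal g u hu) u x ≤
        (8 * A + (laplacianBound b κ A + 1) / 8) * Real.sqrt (-κ) * Real.exp A := by
  have hκ0 : 0 < -κ := by linarith
  have hA0 : 0 ≤ A := (abs_nonneg _).trans (hA x)
  have hLB : 0 ≤ laplacianBound b κ A := by rw [laplacianBound]; positivity
  set L := (8 * A + (laplacianBound b κ A + 1) / 8) * Real.sqrt (-κ) with hL
  have hL0 : 0 ≤ L := by positivity
  have hdu := sq_differential_le hκ hu hK hκ' hA x
  rw [← hL] at hdu
  constructor
  · refine gradientNorm_le g (by positivity) fun V => (hdu V).trans ?_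
    have hconf : (conformal g u hu).inner x V V = Real.exp (-2 * u x) * g.inner x V V := rfl
    have hgV : 0 ≤ g.inner x V V := by
      by_cases hV : V = 0
      · simp [hV]
      · exact (g.pos x V hV).le
    have hexp : Real.exp (-2 * u x) ≤ Real.exp A ^ 2 := by
      rw [← Real.exp_nat_mul]
      refine Real.exp_le_exp.2 ?_
      push_cast
      linarith [(abs_le.1 (hA x)).1]
    rw [hconf, mul_pow L, mul_assoc]
    gcongr
  · refine (gradientNorm_le _ hL0 hdu).trans ?_
    exact le_mul_of_one_le_right hL0 (Real.one_le_exp hA0)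

end Conformal

end SurfaceGeometry

end

theorem mainTheorem4 :
    ∀ a b κ : ℝ, 0 < a → a ≤ b → κ < 0 →
      ∃ C₀ : ℝ, ∀ i₀ : ℝ, 0 < i₀ → ∃ C₁ : ℝ,
        ∀ (M : Type*) [TopologicalSpace M] [ChartedSpace (EuclideanSpace ℝ (Fin 2)) M]
          [IsManifold (𝓡 2) ∞ M] [T2Space M] [CompactSpace M] [ConnectedSpace M]
          (g : SurfaceGeometry.C2Metric M) (u : M → ℝ) (hu : ContMDiff (𝓡 2) 𝓘(ℝ) 2 u),
          ENNReal.ofReal i₀ ≤ SurfaceGeometry.injectivityRadius g →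
          (∀ x, SurfaceGeometry.gaussCurvature g x ∈ Set.Icc (-b ^ 2) (-a ^ 2)) →
          (∀ x, SurfaceGeometry.gaussCurvature (SurfaceGeometry.conformal g u hu) x = κ) →
          (∀ x, |u x| ≤ C₀) ∧
          (∀ x, SurfaceGeometry.gradientNorm g u x ≤ C₁) ∧
          (∀ x, SurfaceGeometry.gradientNorm (SurfaceGeometry.conformal g u hu) u x ≤ C₁) := by
  intro a b κ ha hab hκ
  -- The second witness is the constant of `gradientNorm_bounds` with `A` equal to the first.
  refine ⟨SurfaceGeometry.conformalBound a b κ, fun i₀ _ =>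
    ⟨(8 * SurfaceGeometry.conformalBound a b κ + (SurfaceGeometry.laplacianBound b κ
      (SurfaceGeometry.conformalBound a b κ) + 1) / 8) * Real.sqrt (-κ)
        * Real.exp (SurfaceGeometry.conformalBound a b κ), ?_⟩⟩
  intro M _ _ _ _ _ _ g u hu _ hK hκ'
  have hA := SurfaceGeometry.abs_le_conformalBound hκ ha (ha.trans_le hab) hu hK hκ'
  have hK' : ∀ x, SurfaceGeometry.gaussCurvature g x ∈ Set.Icc (-b ^ 2) 0 := fun x =>
    ⟨(hK x).1, (hK x).2.trans (neg_nonpos.2 (sq_nonneg a))⟩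
  have hG := SurfaceGeometry.gradientNorm_bounds hκ hu hK' hκ' hA
  exact ⟨hA, fun x => (hG x).1, fun x => (hG x).2⟩
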